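/- Let $0\le k_1<k_2$, put $a=k_1^2$, $b=k_2^2$, and let $H$ be the finite Hilbert transform on $[a,b]$, $$H[\psi](s)=\frac1\pi\,\mathrm{p.v.}\!\int_a^b\frac{\psi(r)}{r-s}\,dr,\qquad s\in(a,b).$$ Let $\alpha$ be a real Hölder continuous function on $[a,b]$ such that $\cos(\pi\alpha(s))\neq0$ for all $s\in[a,b]$ (so that $\tan(\pi\alpha)$ is defined), and $|\alpha(a)|<1$, $|\alpha(b)|<1$. Let $X_\alpha$ be the space of all real functions on $(a,b)$ of the form $$\psi(s)=\frac{g(s)}{(s-a)^{\gamma}(b-s)^{\delta}},\qquad g\ \text{Hölder continuous on }[a,b],\quad 0\le\gamma<1-\max(\alpha(a),0),\quad 0\le\delta<1-\max(-\alpha(b),0),$$ where $g,\gamma,\delta$ may depend on $\psi$. (So $X_\alpha$ contains all Hölder continuous functions on $[a,b]$; functions are identified when they agree on $(a,b)$.) Then the principal values below exist at every $s\in(a,b)$ for all $\psi,\varphi\in X_\alpha$, the operator $$L_\alpha[\psi]=\psi+\tan(\pi\alpha)\,H[\psi]$$ maps $X_\alpha$ into itself, and it has a unique inverse $L_\alpha^{-1}:X_\alpha\to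 X_\alpha$, given by $$L_\alpha^{-1}[\varphi]=\cos^2(\pi\alpha)\,\varphi-\sin(\pi\alpha)\,e^{-\pi H[\alpha]}\,H\big[\cos(\pi\alpha)\,e^{\pi H[\alpha]}\,\varphi\big].$$ That is, the right-hand side lies in $X_\alpha$ for all $\varphi\in X_\alpha$, this map is a two-sided inverse of $L_\alpha$, and for each $\varphi\in X_\alpha$ it gives the only solution $\psi\in X_\alpha$ of $L_\alpha[\psi]=\varphi$. All identities hold at every point of $(a,b)$. If $\alpha$ is constant, then for all $\varphi\in X_\alpha$ and $s\in(a,b)$ $$L_\alpha^{-1}[\varphi](s)=\cos^2(\pi\alpha)\,\varphi(s)-\sin(\pi\alpha)\cos(\pi\alpha)\left(\frac{s-a}{b-s}\right)^{\alpha}H\!\left[\left(\frac{b-r}{r-a}\right)^{\alpha}\varphi(r)\right](s),$$ where $H$ acts on the variable $r$. -/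

import Mathlib

open Real Set Filter Topology MeasureTheory

noncomputable section

/-- `f` is Hölder continuous on `S` (with some exponent in `(0, 1]`). -/
def IsHolderOn (f : ℝ → ℝ) (S : Set ℝ) : Prop :=
  ∃ C r : NNReal, 0 < r ∧ r ≤ 1 ∧ HolderOnWith C r f S

/-- The integral `(1/π) ∫ ψ(r) / (r - s) dr` over the part of `(a, b)` at distance more than `ε`
from `s`. -/
def truncHilbert (a b : ℝ) (ψ : ℝ → ℝ) (s ε : ℝ) : ℝ :=
  (1 / π) * ∫ r in {r : ℝ | r ∈ Ioo a b ∧ ε < |r - s|}, ψ r / (r - s)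

/-- The principal value defining the finite Hilbert transform of `ψ` at `s` exists: all truncated
integrals converge absolutely, and they have a limit as `ε → 0+`. -/
def HilbertExists (a b : ℝ) (ψ : ℝ → ℝ) (s : ℝ) : Prop :=
  (∀ ε : ℝ, 0 < ε → IntegrableOn (fun r => ψ r / (r - s)) {r : ℝ | r ∈ Ioo a b ∧ ε < |r - s|}) ∧
    ∃ v : ℝ, Tendsto (truncHilbert a b ψ s) (𝓝[>] 0) (𝓝 v)

/-- The finite Hilbert transform `H[ψ](s) = (1/π) p.v. ∫_a^b ψ(r) / (r - s) dr`
(meaningful where `HilbertExists a b ψ s` holds). -/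
def hilbert (a b : ℝ) (ψ : ℝ → ℝ) (s : ℝ) : ℝ :=
  limUnder (𝓝[>] (0 : ℝ)) (truncHilbert a b ψ s)

/-- The operator `L_α[ψ] = ψ + tan(πα) H[ψ]`. -/
def opL (a b : ℝ) (α ψ : ℝ → ℝ) (s : ℝ) : ℝ :=
  ψ s + tan (π * α s) * hilbert a b ψ s

/-- The density `cos(πα) e^{πH[α]} φ` whose Hilbert transform occurs in the inverse of `L_α`. -/
def invDensity (a b : ℝ) (α φ : ℝ → ℝ) (s : ℝ) : ℝ :=
  cos (π * α s) * exp (π * hilbert a b α s) * φ s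

/-- `cos²(πα) φ - sin(πα) e^{-πH[α]} H[cos(πα) e^{πH[α]} φ]`. -/
def opLInv (a b : ℝ) (α φ : ℝ → ℝ) (s : ℝ) : ℝ :=
  cos (π * α s) ^ 2 * φ s -
    sin (π * α s) * exp (-(π * hilbert a b α s)) * hilbert a b (invDensity a b α φ) s

/-- Functions on `(a, b)` of the form `g(s) / ((s - a)^γ (b - s)^δ)` with `g` Hölder continuous on
`[a, b]`, `0 ≤ γ < μ` and `0 ≤ δ < ν`. Values outside `(a, b)` are irrelevant. -/
def EndpointClass (a b μ ν : ℝ) : Set (ℝ → ℝ) :=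
  {ψ | ∃ γ δ : ℝ, 0 ≤ γ ∧ γ < μ ∧ 0 ≤ δ ∧ δ < ν ∧ ∃ g : ℝ → ℝ, IsHolderOn g (Icc a b) ∧
    ∀ s ∈ Ioo a b, ψ s = g s / ((s - a) ^ γ * (b - s) ^ δ)}

/-- The domain of `L_α`: Hölder continuous functions with singularities at the endpoints of order
`γ < 1` such that multiplication by `e^{πH[α]}`, which is comparable to
`(s - a)^{-α(a)} (b - s)^{α(b)}`, leaves the order of the singularities below `1`. -/
def domL (a b : ℝ) (α : ℝ → ℝ) : Set (ℝ → ℝ) :=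
  EndpointClass a b (1 - max (α a) 0) (1 - max (-α b) 0)

end

/-! Write B = H[α] + iα for the boundary value from above of the Cauchy transform C[α](z) = (1/π) ∫
α(r)/(r - z) dr. The whole theorem rests on Tricomi's identity H[f H[g] + g H[f]] = H[f] H[g] - f g
and on one special function, S = Im e^{πB} = sin(πα) e^{πH[α]}, whose transform is H[S] = Re e^{πB}
- 1 = cos(πα) e^{πH[α]} - 1.

Given these, inversion is algebra. Multiplying L[ψ] by cos(πα) e^{πH[α]} gives ψ + (S H[ψ] + ψ
H[S]), so Tricomi's identity evaluates the transform of this density as cos(πα) e^{πH[α]} H[ψ] - S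
ψ; substituted in the formula for the inverse, the terms with H[ψ] cancel and sin² + cos² = 1 leaves
ψ (`opLInv_opL`). The other composition is the same calculation with -α in place of α
(`opL_opLInv`). Uniqueness follows from the two compositions.

Tricomi's identity is obtained from Cauchy transforms: C[f] C[g] = C[f H[g] + g H[f]] off the real
axis (`WeightedHolder.cauchyTransform_mul`), by the partial fraction of 1/((r - z)(t - z)) with the
diagonal cut out; then the Plemelj formula (`WeightedHolder.tendsto_cauchyTransform`) and real
parts. Iterating it with g = α gives C[α]^n = C[Im B^n] for n ≥ 1. Summing the exponential series
yields e^{πC[α]} - 1 = C[S] (`exp_cauchyTransform_sub_one`), and the boundary values give H[S]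
(`hilbert_sin_mul_exp`).

The analysis takes place in the classes `WeightedHolder`, with a growth bound and a Hölder condition
at the scale of the distance to the endpoints. Unlike the form g/((s - a)^γ (b - s)^δ), they are
visibly stable under products and composition; the union over admissible exponents is the same space
(`mem_endpointClass_iff`). The transform H preserves them up to an arbitrarily small loss in the
exponents (`WeightedHolder.hilbert`). Since H[α] equals α(b) log(b - s) - α(a) log(s - a) up to a
bounded term, e^{πH[α]} shifts the exponents by α(a) and -α(b), again with a small loss. All
conditions on exponents are strict, so one small η absorbs every loss (`SmallLoss`). -/

noncomputable section

/-! ### Weighted Hölder classes: algebra and composition -/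

/-- The distance from `s ∈ (a, b)` to the endpoints. -/
def edgeDist (a b s : ℝ) : ℝ := min (s - a) (b - s)

/-- The weight `(s - a)^{-γ} (b - s)^{-δ}`. -/
def edgeWeight (a b γ δ s : ℝ) : ℝ := (s - a) ^ (-γ) * (b - s) ^ (-δ)

/-- Functions on `(a, b)` that are bounded by a multiple of `(s - a)^{-γ} (b - s)^{-δ}` and satisfy
the corresponding scale-invariant Hölder condition on the balls `B(s, d(s) / 2)`. -/
def WeightedHolder (a b γ δ : ℝ) (f : ℝ → ℝ) : Prop :=
  ∃ M μ : ℝ, 0 ≤ M ∧ 0 < μ ∧ μ ≤ 1 ∧ ∀ s ∈ Ioo a b, ∀ p q,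
    |p - s| ≤ edgeDist a b s / 2 → |q - s| ≤ edgeDist a b s / 2 →
    |f p| ≤ M * edgeWeight a b γ δ s ∧
      |f p - f q| ≤ M * edgeWeight a b γ δ s * (|p - q| / edgeDist a b s) ^ μ

section Basic

variable {a b γ δ γ' δ' s t p q : ℝ} {f g : ℝ → ℝ}

theorem edgeDist_pos (hs : s ∈ Ioo a b) : 0 < edgeDist a b s :=
  lt_min (sub_pos.2 hs.1) (sub_pos.2 hs.2)

theorem edgeDist_le_left : edgeDist a b s ≤ s - a := min_le_left _ _

theorem edgeDist_le_right : edgeDist a b s ≤ b - s := min_le_right _ _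

theorem edgeDist_le_add (a b s t : ℝ) : edgeDist a b t ≤ edgeDist a b s + |t - s| := by
  have := le_abs_self (t - s)
  have := neg_abs_le (t - s)
  rcases min_cases (s - a) (b - s) with h | h <;> rcases min_cases (t - a) (b - t) with h' | h' <;>
    simp only [edgeDist] <;> linarith

theorem edgeDist_le_length (hs : s ∈ Ioo a b) : edgeDist a b s ≤ b - a :=
  edgeDist_le_left.trans (by linarith [hs.2])

theorem mem_Ioo_of_near (hs : s ∈ Ioo a b) (hp : |p - s| ≤ edgeDist a b s / 2) : p ∈ Ioo a b := by
  have h0 := edgeDist_pos hs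
  have h1 := edgeDist_le_left (a := a) (b := b) (s := s)
  have h2 := edgeDist_le_right (a := a) (b := b) (s := s)
  rw [abs_le] at hp
  exact ⟨by linarith, by linarith⟩

theorem half_edgeDist_le_of_near (hp : |p - s| ≤ edgeDist a b s / 2) :
    edgeDist a b s / 2 ≤ edgeDist a b p := by
  have := edgeDist_le_add a b p s
  rw [abs_sub_comm] at this
  linarith

theorem near_self (hs : s ∈ Ioo a b) : |s - s| ≤ edgeDist a b s / 2 := by
  have := edgeDist_pos hs
  simp; linarith

theorem ratio_nonneg (hs : s ∈ Ioo a b) : 0 ≤ |p - q| / edgeDist a b s :=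
  div_nonneg (abs_nonneg _) (edgeDist_pos hs).le

theorem ratio_le_one (hs : s ∈ Ioo a b) (hp : |p - s| ≤ edgeDist a b s / 2)
    (hq : |q - s| ≤ edgeDist a b s / 2) : |p - q| / edgeDist a b s ≤ 1 := by
  rw [div_le_one (edgeDist_pos hs)]
  have := abs_sub_le p s q
  rw [abs_sub_comm s q] at this
  linarith

theorem edgeWeight_pos (hs : s ∈ Ioo a b) : 0 < edgeWeight a b γ δ s :=
  mul_pos (rpow_pos_of_pos (sub_pos.2 hs.1) _) (rpow_pos_of_pos (sub_pos.2 hs.2) _)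

theorem edgeWeight_mul (hs : s ∈ Ioo a b) :
    edgeWeight a b γ δ s * edgeWeight a b γ' δ' s = edgeWeight a b (γ + γ') (δ + δ') s := by
  simp only [edgeWeight]
  rw [neg_add, neg_add, rpow_add (sub_pos.2 hs.1), rpow_add (sub_pos.2 hs.2)]
  ring

theorem edgeWeight_zero : edgeWeight a b 0 0 s = 1 := by simp [edgeWeight]

theorem rpow_le_of_le_two_mul {x y : ℝ} (c : ℝ) (hx : 0 < x) (hy : 0 < y) (h₁ : y ≤ 2 * x)
    (h₂ : x ≤ 2 * y) : x ^ c ≤ 2 ^ |c| * y ^ c := by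
  rcases le_total 0 c with hc | hc
  · rw [abs_of_nonneg hc, ← mul_rpow two_pos.le hy.le]
    exact rpow_le_rpow hx.le h₂ hc
  · rw [abs_of_nonpos hc, rpow_neg two_pos.le, ← inv_rpow two_pos.le, ← mul_rpow (by norm_num) hy.le]
    exact rpow_le_rpow_of_nonpos (by positivity) (by linarith) hc

theorem edgeWeight_le_of_near (hs : s ∈ Ioo a b) (hp : |p - s| ≤ edgeDist a b s / 2) :
    edgeWeight a b γ δ p ≤ 2 ^ |-γ| * 2 ^ |-δ| * edgeWeight a b γ δ s := by
  have hp' := mem_Ioo_of_near hs hp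
  have h0 := edgeDist_pos hs
  have h1 := edgeDist_le_left (a := a) (b := b) (s := s)
  have h2 := edgeDist_le_right (a := a) (b := b) (s := s)
  rw [abs_le] at hp
  have e1 := rpow_le_of_le_two_mul (-γ) (sub_pos.2 hp'.1) (sub_pos.2 hs.1) (by linarith)
    (by linarith)
  have e2 := rpow_le_of_le_two_mul (-δ) (sub_pos.2 hp'.2) (sub_pos.2 hs.2) (by linarith)
    (by linarith)
  simp only [edgeWeight]
  calc (p - a) ^ (-γ) * (b - p) ^ (-δ)
      ≤ (2 ^ |-γ| * (s - a) ^ (-γ)) * (2 ^ |-δ| * (b - s) ^ (-δ)) :=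
        mul_le_mul e1 e2 (rpow_nonneg (sub_pos.2 hp'.2).le _)
          (mul_nonneg (by positivity) (rpow_nonneg (sub_pos.2 hs.1).le _))
    _ = _ := by ring

/-- On a bounded interval a stronger singularity dominates a weaker one; the constant is a power of
the length. -/
theorem edgeWeight_mono (hγ : γ ≤ γ') (hδ : δ ≤ δ') :
    ∃ C, 0 < C ∧ ∀ s ∈ Ioo a b, edgeWeight a b γ δ s ≤ C * edgeWeight a b γ' δ' s := by
  rcases le_or_gt b a with hab | hab
  · exact ⟨1, one_pos, fun s hs => absurd (hs.1.trans hs.2) (not_lt.2 hab)⟩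
  have hL : 0 < b - a := sub_pos.2 hab
  refine ⟨(b - a) ^ (γ' - γ) * (b - a) ^ (δ' - δ), by positivity, fun s hs => ?_⟩
  have h1 : 0 < s - a := sub_pos.2 hs.1
  have h2 : 0 < b - s := sub_pos.2 hs.2
  have e1 : (s - a) ^ (-γ) ≤ (b - a) ^ (γ' - γ) * (s - a) ^ (-γ') := by
    rw [show -γ = (γ' - γ) + -γ' by ring, rpow_add h1]
    gcongr
    linarith [hs.2]
  have e2 : (b - s) ^ (-δ) ≤ (b - a) ^ (δ' - δ) * (b - s) ^ (-δ') := by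
    rw [show -δ = (δ' - δ) + -δ' by ring, rpow_add h2]
    gcongr
    linarith [hs.1]
  calc edgeWeight a b γ δ s ≤ ((b - a) ^ (γ' - γ) * (s - a) ^ (-γ')) *
        ((b - a) ^ (δ' - δ) * (b - s) ^ (-δ')) := by
        simp only [edgeWeight]; gcongr
    _ = _ := by simp only [edgeWeight]; ring

theorem WeightedHolder.bound (hf : WeightedHolder a b γ δ f) :
    ∃ M, 0 ≤ M ∧ ∀ s ∈ Ioo a b, |f s| ≤ M * edgeWeight a b γ δ s := by
  obtain ⟨M, μ, hM, -, -, h⟩ := hf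
  exact ⟨M, hM, fun s hs => (h s hs s s (near_self hs) (near_self hs)).1⟩

theorem WeightedHolder.congr (hf : WeightedHolder a b γ δ f) (h : EqOn g f (Ioo a b)) :
    WeightedHolder a b γ δ g := by
  obtain ⟨M, μ, hM, h0, h1, H⟩ := hf
  refine ⟨M, μ, hM, h0, h1, fun s hs p q hp hq => ?_⟩
  rw [h (mem_Ioo_of_near hs hp), h (mem_Ioo_of_near hs hq)]
  exact H s hs p q hp hq

theorem WeightedHolder.mono (hf : WeightedHolder a b γ δ f) (hγ : γ ≤ γ') (hδ : δ ≤ δ') :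
    WeightedHolder a b γ' δ' f := by
  obtain ⟨M, μ, hM, h0, h1, H⟩ := hf
  obtain ⟨C, hC, hCs⟩ := edgeWeight_mono (a := a) (b := b) hγ hδ
  refine ⟨M * C, μ, by positivity, h0, h1, fun s hs p q hp hq => ?_⟩
  obtain ⟨e1, e2⟩ := H s hs p q hp hq
  have := mul_le_mul_of_nonneg_left (hCs s hs) hM
  rw [mul_assoc M C]
  refine ⟨e1.trans this, e2.trans ?_⟩
  gcongr
  exact rpow_nonneg (ratio_nonneg hs) _

theorem WeightedHolder.lower {M μ ν : ℝ} (hM : 0 ≤ M) (hνμ : ν ≤ μ) (hν : 0 < ν) (hs : s ∈ Ioo a b)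
    (hp : |p - s| ≤ edgeDist a b s / 2) (hq : |q - s| ≤ edgeDist a b s / 2)
    (h : |f p - f q| ≤ M * edgeWeight a b γ δ s * (|p - q| / edgeDist a b s) ^ μ) :
    |f p - f q| ≤ M * edgeWeight a b γ δ s * (|p - q| / edgeDist a b s) ^ ν := by
  refine h.trans (mul_le_mul_of_nonneg_left ?_ (mul_nonneg hM (edgeWeight_pos hs).le))
  exact rpow_le_rpow_of_exponent_ge' (ratio_nonneg hs) (ratio_le_one hs hp hq) hν.le hνμ

theorem WeightedHolder.add (hf : WeightedHolder a b γ δ f) (hg : WeightedHolder a b γ δ g) :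
    WeightedHolder a b γ δ (fun s => f s + g s) := by
  obtain ⟨M, μ, hM, h0, h1, H⟩ := hf
  obtain ⟨M', μ', hM', h0', h1', H'⟩ := hg
  have hν : 0 < min μ μ' := lt_min h0 h0'
  refine ⟨M + M', min μ μ', by positivity, hν, (min_le_left _ _).trans h1,
    fun s hs p q hp hq => ?_⟩
  obtain ⟨e1, e2⟩ := H s hs p q hp hq
  obtain ⟨e1', e2'⟩ := H' s hs p q hp hq
  have e3 := WeightedHolder.lower hM (min_le_left μ μ') hν hs hp hq e2
  have e3' := WeightedHolder.lower hM' (min_le_right μ μ') hν hs hp hq e2'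
  constructor
  · calc |f p + g p| ≤ |f p| + |g p| := abs_add_le _ _
      _ ≤ _ := by linarith
  · calc |f p + g p - (f q + g q)| = |(f p - f q) + (g p - g q)| := by ring_nf
      _ ≤ |f p - f q| + |g p - g q| := abs_add_le _ _
      _ ≤ _ := by linarith

theorem WeightedHolder.mul (hf : WeightedHolder a b γ δ f) (hg : WeightedHolder a b γ' δ' g) :
    WeightedHolder a b (γ + γ') (δ + δ') (fun s => f s * g s) := by
  obtain ⟨M, μ, hM, h0, h1, H⟩ := hf
  obtain ⟨M', μ', hM', h0', h1', H'⟩ := hg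
  have hν : 0 < min μ μ' := lt_min h0 h0'
  refine ⟨2 * (M * M'), min μ μ', by positivity, hν, (min_le_left _ _).trans h1,
    fun s hs p q hp hq => ?_⟩
  obtain ⟨e1, e2⟩ := H s hs p q hp hq
  obtain ⟨e1', e2'⟩ := H' s hs p q hp hq
  obtain ⟨d1, -⟩ := H s hs q p hq hp
  have e3 := WeightedHolder.lower hM (min_le_left μ μ') hν hs hp hq e2
  have e3' := WeightedHolder.lower hM' (min_le_right μ μ') hν hs hp hq e2'
  rw [← edgeWeight_mul hs]
  have w := (edgeWeight_pos (γ := γ) (δ := δ) hs).le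
  have w' := (edgeWeight_pos (γ := γ') (δ := δ') hs).le
  set R := (|p - q| / edgeDist a b s) ^ min μ μ' with hR
  have hR0 : 0 ≤ R := rpow_nonneg (ratio_nonneg hs) _
  set W := edgeWeight a b γ δ s
  set W' := edgeWeight a b γ' δ' s
  constructor
  · rw [abs_mul]
    have := mul_le_mul e1 e1' (abs_nonneg _) (by positivity)
    have h2 : 0 ≤ M * W * (M' * W') := by positivity
    linarith
  · calc |f p * g p - f q * g q| = |(f p - f q) * g p + f q * (g p - g q)| := by ring_nf
      _ ≤ |f p - f q| * |g p| + |f q| * |g p - g q| := by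
        rw [← abs_mul, ← abs_mul]; exact abs_add_le _ _
      _ ≤ (M * W * R) * (M' * W') + (M * W) * (M' * W' * R) := by gcongr
      _ = _ := by ring

theorem weightedHolder_const (c : ℝ) : WeightedHolder a b 0 0 (fun _ => c) := by
  refine ⟨|c|, 1, abs_nonneg _, one_pos, le_rfl, fun s hs p q _ _ => ?_⟩
  rw [edgeWeight_zero]
  have := ratio_nonneg hs (p := p) (q := q)
  simp only [mul_one, le_refl, sub_self, abs_zero, rpow_one, true_and]
  positivity

theorem WeightedHolder.const_mul (c : ℝ) (hf : WeightedHolder a b γ δ f) :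
    WeightedHolder a b γ δ (fun s => c * f s) := by
  simpa using (weightedHolder_const c).mul hf

theorem WeightedHolder.neg (hf : WeightedHolder a b γ δ f) :
    WeightedHolder a b γ δ (fun s => -f s) :=
  (hf.const_mul (-1)).congr fun s _ => by simp

theorem WeightedHolder.sub (hf : WeightedHolder a b γ δ f) (hg : WeightedHolder a b γ δ g) :
    WeightedHolder a b γ δ (fun s => f s - g s) :=
  (hf.add hg.neg).congr fun s _ => by simp [sub_eq_add_neg]

/-- Pairs that are far apart relative to the distance to the endpoints need no Hölder estimate: the
growth bound suffices for them. This reduces membership to comparing a centre with points very near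
it, which is how H[f] is estimated later. -/
theorem WeightedHolder.of_local {M μ : ℝ} (hM : 0 ≤ M) (hμ : 0 < μ) (hμ1 : μ ≤ 1)
    (h₁ : ∀ s ∈ Ioo a b, |f s| ≤ M * edgeWeight a b γ δ s)
    (h₂ : ∀ s ∈ Ioo a b, ∀ t ∈ Ioo a b, |t - s| ≤ edgeDist a b s / 8 →
      |f t - f s| ≤ M * edgeWeight a b γ δ s * (|t - s| / edgeDist a b s) ^ μ) :
    WeightedHolder a b γ δ f := by
  set C : ℝ := 2 ^ |-γ| * 2 ^ |-δ| with hC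
  have hC0 : 0 < C := by positivity
  -- The far case decides the constant: there the ratio |p - q| / d(s) is at least 1/16, so its μ-th
  -- power is too, and |f p| + |f q| contributes 2 M C.
  refine ⟨32 * (M * C), μ, by positivity, hμ, hμ1, fun s hs p q hp hq => ?_⟩
  have hp' := mem_Ioo_of_near hs hp
  have hq' := mem_Ioo_of_near hs hq
  have hd := edgeDist_pos hs
  have hdp := edgeDist_pos hp'
  have wp := mul_le_mul_of_nonneg_left (edgeWeight_le_of_near (γ := γ) (δ := δ) hs hp) hM
  have wq := mul_le_mul_of_nonneg_left (edgeWeight_le_of_near (γ := γ) (δ := δ) hs hq) hM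
  rw [← hC, ← mul_assoc] at wp wq
  have w0 : 0 ≤ M * C * edgeWeight a b γ δ s :=
    mul_nonneg (by positivity) (edgeWeight_pos hs).le
  have bp := (h₁ p hp').trans wp
  have bq := (h₁ q hq').trans wq
  refine ⟨by linarith, ?_⟩
  rcases le_or_gt |q - p| (edgeDist a b p / 8) with hc | hc
  · have h3 := h₂ p hp' q hq' hc
    rw [abs_sub_comm, abs_sub_comm p q]
    have e : (|q - p| / edgeDist a b p) ^ μ ≤ 2 * (|q - p| / edgeDist a b s) ^ μ := by
      calc (|q - p| / edgeDist a b p) ^ μ ≤ (2 * (|q - p| / edgeDist a b s)) ^ μ := by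
            apply rpow_le_rpow (by positivity) _ hμ.le
            rw [← mul_div_assoc, div_le_div_iff₀ hdp hd]
            nlinarith [half_edgeDist_le_of_near hp, abs_nonneg (q - p)]
        _ = 2 ^ μ * (|q - p| / edgeDist a b s) ^ μ := mul_rpow two_pos.le (by positivity)
        _ ≤ 2 * (|q - p| / edgeDist a b s) ^ μ := by
            gcongr
            calc (2 : ℝ) ^ μ ≤ 2 ^ (1 : ℝ) := rpow_le_rpow_of_exponent_le (by norm_num) hμ1
              _ = 2 := rpow_one _
    have r0 : 0 ≤ (|q - p| / edgeDist a b s) ^ μ := by positivity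
    calc |f q - f p| ≤ M * edgeWeight a b γ δ p * (|q - p| / edgeDist a b p) ^ μ := h3
      _ ≤ (M * C * edgeWeight a b γ δ s) * (2 * (|q - p| / edgeDist a b s) ^ μ) := by
        gcongr
      _ ≤ _ := by nlinarith [mul_nonneg w0 r0]
  · have h16 : 1 / 16 ≤ |p - q| / edgeDist a b s := by
      rw [le_div_iff₀ hd, abs_sub_comm]
      linarith [half_edgeDist_le_of_near hp]
    have h3 : 1 / 16 ≤ (|p - q| / edgeDist a b s) ^ μ :=
      calc (1 / 16 : ℝ) = (1 / 16) ^ (1 : ℝ) := (rpow_one _).symm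
        _ ≤ (1 / 16) ^ μ := rpow_le_rpow_of_exponent_ge (by norm_num) (by norm_num) hμ1
        _ ≤ _ := rpow_le_rpow (by norm_num) h16 hμ.le
    have h4 : |f p - f q| ≤ |f p| + |f q| := abs_sub _ _
    nlinarith [mul_le_mul_of_nonneg_left h3 w0]

theorem isHolderOn_iff {S : Set ℝ} : IsHolderOn f S ↔
    ∃ C r : ℝ, 0 ≤ C ∧ 0 < r ∧ r ≤ 1 ∧ ∀ x ∈ S, ∀ y ∈ S, |f x - f y| ≤ C * |x - y| ^ r := by
  constructor
  · rintro ⟨C, r, h0, h1, h⟩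
    refine ⟨C, r, C.2, h0, h1, fun x hx y hy => ?_⟩
    simpa [Real.dist_eq] using h.dist_le hx hy
  · rintro ⟨C, r, hC, h0, h1, h⟩
    refine ⟨C.toNNReal, r.toNNReal, by simpa using h0, by simpa using h1, fun x hx y hy => ?_⟩
    rw [edist_dist, edist_dist, Real.dist_eq, Real.dist_eq, Real.coe_toNNReal r h0.le,
      ENNReal.ofReal_rpow_of_nonneg (abs_nonneg _) h0.le]
    change _ ≤ ENNReal.ofReal C * _
    rw [← ENNReal.ofReal_mul hC]
    exact ENNReal.ofReal_le_ofReal (h x hx y hy)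

theorem weightedHolder_of_isHolderOn (hf : IsHolderOn f (Icc a b)) : WeightedHolder a b 0 0 f := by
  rcases le_or_gt b a with hab | hab
  · exact ⟨1, 1, by simp, by simp, by simp, fun s hs => absurd (hs.1.trans hs.2) (not_lt.2 hab)⟩
  obtain ⟨C, r, hC, hr, hr1, h⟩ := isHolderOn_iff.1 hf
  have hL : 0 < b - a := sub_pos.2 hab
  have ha : a ∈ Icc a b := ⟨le_rfl, hab.le⟩
  refine ⟨|f a| + C * (b - a) ^ r, r, by positivity, hr, hr1, fun s hs p q hp hq => ?_⟩
  have hp' := mem_Ioo_of_near hs hp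
  have hq' := mem_Ioo_of_near hs hq
  have hd := edgeDist_pos hs
  rw [edgeWeight_zero, mul_one]
  constructor
  · have h1 := h p (Ioo_subset_Icc_self hp') a ha
    have h2 : |p - a| ^ r ≤ (b - a) ^ r := by
      apply rpow_le_rpow (abs_nonneg _) _ hr.le
      rw [abs_of_pos (sub_pos.2 hp'.1)]; linarith [hp'.2]
    have h3 := abs_sub_abs_le_abs_sub (f p) (f a)
    nlinarith
  · have h1 := h p (Ioo_subset_Icc_self hp') q (Ioo_subset_Icc_self hq')
    have h2 : |p - q| ^ r ≤ (b - a) ^ r * (|p - q| / edgeDist a b s) ^ r := by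
      rw [← mul_rpow hL.le (by positivity)]
      apply rpow_le_rpow (abs_nonneg _) _ hr.le
      rw [← mul_div_assoc, le_div_iff₀ hd, mul_comm]
      exact mul_le_mul_of_nonneg_right (edgeDist_le_length hs) (abs_nonneg _)
    have h3 : 0 ≤ (|p - q| / edgeDist a b s) ^ r := by positivity
    calc |f p - f q| ≤ C * |p - q| ^ r := h1
      _ ≤ C * ((b - a) ^ r * (|p - q| / edgeDist a b s) ^ r) := by gcongr
      _ ≤ _ := by nlinarith [mul_nonneg (abs_nonneg (f a)) h3]

theorem WeightedHolder.comp_of_lipschitz {F : ℝ → ℝ} {K M : ℝ} (hK : 0 ≤ K)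
    (hF : ∀ p ∈ Ioo a b, ∀ q ∈ Ioo a b, |F (f p) - F (f q)| ≤ K * |f p - f q|)
    (hM : ∀ p ∈ Ioo a b, |F (f p)| ≤ M)
    (hf : WeightedHolder a b 0 0 f) : WeightedHolder a b 0 0 (fun s => F (f s)) := by
  obtain ⟨M', μ, hM', h0, h1, H⟩ := hf
  refine ⟨|M| + K * M', μ, by positivity, h0, h1, fun s hs p q hp hq => ?_⟩
  obtain ⟨e1, e2⟩ := H s hs p q hp hq
  have hp' := mem_Ioo_of_near hs hp
  have hq' := mem_Ioo_of_near hs hq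
  rw [edgeWeight_zero, mul_one] at *
  have hR : 0 ≤ (|p - q| / edgeDist a b s) ^ μ := rpow_nonneg (ratio_nonneg hs) _
  constructor
  · have := hM p hp'
    have := le_abs_self M
    have : 0 ≤ K * M' := by positivity
    linarith
  · refine (hF p hp' q hq').trans ?_
    have := mul_le_mul_of_nonneg_left e2 hK
    nlinarith [mul_nonneg (abs_nonneg M) hR]

theorem WeightedHolder.sin_comp (hf : WeightedHolder a b 0 0 f) :
    WeightedHolder a b 0 0 (fun s => sin (f s)) :=
  hf.comp_of_lipschitz (F := sin) (K := 1) (M := 1) zero_le_one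
    (fun p _ q _ => by simpa using abs_sin_sub_sin_le (f p) (f q)) (fun p _ => abs_sin_le_one _)

theorem WeightedHolder.cos_comp (hf : WeightedHolder a b 0 0 f) :
    WeightedHolder a b 0 0 (fun s => cos (f s)) :=
  hf.comp_of_lipschitz (F := cos) (K := 1) (M := 1) zero_le_one
    (fun p _ q _ => by simpa using abs_cos_sub_cos_le (f p) (f q)) (fun p _ => abs_cos_le_one _)

theorem WeightedHolder.inv {c : ℝ} (hc : 0 < c) (hfc : ∀ s ∈ Ioo a b, c ≤ |f s|)
    (hf : WeightedHolder a b 0 0 f) : WeightedHolder a b 0 0 (fun s => (f s)⁻¹) := by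
  refine hf.comp_of_lipschitz (F := fun x => x⁻¹) (K := (c * c)⁻¹) (M := c⁻¹) (by positivity)
    (fun p hp q hq => ?_) (fun p hp => ?_)
  · have hp0 := hfc p hp
    have hq0 := hfc q hq
    have hp1 : f p ≠ 0 := abs_pos.1 (hc.trans_le hp0)
    have hq1 : f q ≠ 0 := abs_pos.1 (hc.trans_le hq0)
    rw [inv_sub_inv hp1 hq1, abs_div, abs_mul, abs_sub_comm, div_eq_inv_mul]
    gcongr
  · rw [abs_inv]
    have := hfc p hp
    gcongr

/-- The right side keeps the sizes of the exponentials, so it transfers Hölder estimates to `exp ∘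
f` even when f is unbounded. -/
theorem abs_exp_sub_exp_le (x y : ℝ) : |exp x - exp y| ≤ (exp x + exp y) * |x - y| := by
  wlog h : y ≤ x generalizing x y
  · have := this y x (le_of_not_ge h)
    rwa [abs_sub_comm, add_comm, abs_sub_comm y x] at this
  rw [abs_of_nonneg (sub_nonneg.2 (exp_le_exp.2 h)), abs_of_nonneg (sub_nonneg.2 h)]
  have h1 := add_one_le_exp (y - x)
  have h2 : exp y = exp x * exp (y - x) := by rw [← exp_add]; ring_nf
  have h3 := exp_pos x
  have h4 := exp_pos y
  nlinarith [mul_nonneg h4.le (sub_nonneg.2 h)]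

/-- The growth exponents γ', δ' of e^f are given separately, since they depend on the exact
logarithmic behaviour of f; the oscillation of f adds γ, δ on top. For f = πH[α] the latter can be
taken arbitrarily small. -/
theorem WeightedHolder.exp_comp {M : ℝ} (hM : 0 ≤ M) (hf : WeightedHolder a b γ δ f)
    (hγ : 0 ≤ γ) (hδ : 0 ≤ δ)
    (h : ∀ s ∈ Ioo a b, exp (f s) ≤ M * edgeWeight a b γ' δ' s) :
    WeightedHolder a b (γ' + γ) (δ' + δ) (fun s => exp (f s)) := by
  obtain ⟨K, μ, hK, h0, h1, H⟩ := hf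
  set C : ℝ := 2 ^ |-γ'| * 2 ^ |-δ'| with hC
  obtain ⟨D, hD, hDs⟩ := edgeWeight_mono (a := a) (b := b) (γ := γ') (δ := δ') (γ' := γ' + γ)
    (δ' := δ' + δ) (by linarith) (by linarith)
  refine ⟨M * C * D + 2 * (M * C * K), μ, by positivity, h0, h1, fun s hs p q hp hq => ?_⟩
  obtain ⟨-, e2⟩ := H s hs p q hp hq
  have wp := (h p (mem_Ioo_of_near hs hp)).trans
    (mul_le_mul_of_nonneg_left (edgeWeight_le_of_near (γ := γ') (δ := δ') hs hp) hM)
  have wq := (h q (mem_Ioo_of_near hs hq)).trans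
    (mul_le_mul_of_nonneg_left (edgeWeight_le_of_near (γ := γ') (δ := δ') hs hq) hM)
  rw [← hC, ← mul_assoc] at wp wq
  have hR : 0 ≤ (|p - q| / edgeDist a b s) ^ μ := rpow_nonneg (ratio_nonneg hs) _
  have w := (edgeWeight_pos (γ := γ' + γ) (δ := δ' + δ) hs).le
  have w' := (edgeWeight_pos (γ := γ') (δ := δ') hs).le
  have hC0 : 0 < C := by positivity
  constructor
  · rw [abs_of_pos (exp_pos _)]
    have h3 := mul_le_mul_of_nonneg_left (hDs s hs) (by positivity : 0 ≤ M * C)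
    have h4 : 0 ≤ 2 * (M * C * K) * edgeWeight a b (γ' + γ) (δ' + δ) s := by positivity
    linarith
  · calc |exp (f p) - exp (f q)| ≤ (exp (f p) + exp (f q)) * |f p - f q| := abs_exp_sub_exp_le _ _
      _ ≤ (2 * (M * C * edgeWeight a b γ' δ' s)) *
          (K * edgeWeight a b γ δ s * (|p - q| / edgeDist a b s) ^ μ) := by
        gcongr; linarith
      _ = 2 * (M * C * K) * (edgeWeight a b γ' δ' s * edgeWeight a b γ δ s) *
          (|p - q| / edgeDist a b s) ^ μ := by ring
      _ ≤ _ := by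
        rw [edgeWeight_mul hs]
        have : 0 ≤ M * C * D := by positivity
        gcongr
        linarith

end Basic


/-! ### Powers of the distance to an endpoint; comparison with `EndpointClass`; integrability -/

section Endpoint

variable {a b γ δ γ' δ' s t p q : ℝ} {f g : ℝ → ℝ}

theorem abs_log_sub_log_le {x y m : ℝ} (hm : 0 < m) (hx : m ≤ x) (hy : m ≤ y) :
    |log x - log y| ≤ |x - y| / m := by
  wlog h : y ≤ x generalizing x y
  · have := this hy hx (le_of_not_ge h)
    rwa [abs_sub_comm, abs_sub_comm y x] at this
  have hx0 := hm.trans_le hx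
  have hy0 := hm.trans_le hy
  rw [abs_of_nonneg (sub_nonneg.2 (log_le_log hy0 h)), abs_of_nonneg (sub_nonneg.2 h),
    ← log_div hx0.ne' hy0.ne']
  calc log (x / y) ≤ x / y - 1 := log_le_sub_one_of_pos (by positivity)
    _ = (x - y) / y := by field_simp
    _ ≤ (x - y) / m := div_le_div_of_nonneg_left (sub_nonneg.2 h) hm hy

/-- With x^c = e^{c log x} this combines the estimate for exponentials with the Lipschitz bound of
the logarithm on [z/2, ∞). -/
theorem abs_rpow_sub_rpow_le {x y z : ℝ} (c : ℝ) (hz : 0 < z) (hx : |x - z| ≤ z / 2)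
    (hy : |y - z| ≤ z / 2) :
    |x ^ c - y ^ c| ≤ 4 * |c| * 2 ^ |c| * z ^ c * (|x - y| / z) := by
  rw [abs_le] at hx hy
  have hx0 : 0 < x := by linarith
  have hy0 : 0 < y := by linarith
  have hxc := rpow_le_of_le_two_mul c hx0 hz (by linarith) (by linarith)
  have hyc := rpow_le_of_le_two_mul c hy0 hz (by linarith) (by linarith)
  have hl := abs_log_sub_log_le (half_pos hz) (x := x) (y := y) (by linarith) (by linarith)
  have h := abs_exp_sub_exp_le (log x * c) (log y * c)
  rw [← rpow_def_of_pos hx0, ← rpow_def_of_pos hy0, ← sub_mul, abs_mul] at h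
  calc |x ^ c - y ^ c| ≤ (x ^ c + y ^ c) * (|log x - log y| * |c|) := h
    _ ≤ (2 ^ |c| * z ^ c + 2 ^ |c| * z ^ c) * (|x - y| / (z / 2) * |c|) := by gcongr
    _ = _ := by field_simp; ring

theorem weightedHolder_rpow_left (c : ℝ) : WeightedHolder a b (-c) 0 (fun s => (s - a) ^ c) := by
  refine ⟨2 ^ |c| + 4 * |c| * 2 ^ |c|, 1, by positivity, one_pos, le_rfl,
    fun s hs p q hp hq => ?_⟩
  have hd := edgeDist_pos hs
  have hz : 0 < s - a := sub_pos.2 hs.1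
  have hdz : edgeDist a b s ≤ s - a := edgeDist_le_left
  have hp1 : |(p - a) - (s - a)| ≤ (s - a) / 2 := by
    rw [sub_sub_sub_cancel_right]; linarith
  have hq1 : |(q - a) - (s - a)| ≤ (s - a) / 2 := by
    rw [sub_sub_sub_cancel_right]; linarith
  have h1 := abs_rpow_sub_rpow_le c hz hp1 hq1
  have h2 : (p - a) ^ c ≤ 2 ^ |c| * (s - a) ^ c := by
    rw [abs_le] at hp1
    exact rpow_le_of_le_two_mul c (by linarith) hz (by linarith) (by linarith)
  have hw : edgeWeight a b (-c) 0 s = (s - a) ^ c := by simp [edgeWeight]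
  have hzc : 0 < (s - a) ^ c := rpow_pos_of_pos hz c
  rw [hw, rpow_one]
  constructor
  · rw [abs_of_pos (rpow_pos_of_pos (sub_pos.2 (mem_Ioo_of_near hs hp).1) c)]
    have : 0 ≤ 4 * |c| * 2 ^ |c| * (s - a) ^ c := by positivity
    linarith
  · rw [sub_sub_sub_cancel_right] at h1
    refine h1.trans ?_
    have : (0 : ℝ) ≤ 2 ^ |c| := by positivity
    gcongr
    linarith

theorem weightedHolder_rpow_right (c : ℝ) : WeightedHolder a b 0 (-c) (fun s => (b - s) ^ c) := by
  refine ⟨2 ^ |c| + 4 * |c| * 2 ^ |c|, 1, by positivity, one_pos, le_rfl,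
    fun s hs p q hp hq => ?_⟩
  have hd := edgeDist_pos hs
  have hz : 0 < b - s := sub_pos.2 hs.2
  have hdz : edgeDist a b s ≤ b - s := edgeDist_le_right
  have hp1 : |(b - p) - (b - s)| ≤ (b - s) / 2 := by
    rw [sub_sub_sub_cancel_left, abs_sub_comm]; linarith
  have hq1 : |(b - q) - (b - s)| ≤ (b - s) / 2 := by
    rw [sub_sub_sub_cancel_left, abs_sub_comm]; linarith
  have h1 := abs_rpow_sub_rpow_le c hz hp1 hq1
  have h2 : (b - p) ^ c ≤ 2 ^ |c| * (b - s) ^ c := by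
    rw [abs_le] at hp1
    exact rpow_le_of_le_two_mul c (by linarith) hz (by linarith) (by linarith)
  have hw : edgeWeight a b 0 (-c) s = (b - s) ^ c := by simp [edgeWeight]
  have hzc : 0 < (b - s) ^ c := rpow_pos_of_pos hz c
  rw [hw, rpow_one]
  constructor
  · rw [abs_of_pos (rpow_pos_of_pos (sub_pos.2 (mem_Ioo_of_near hs hp).2) c)]
    have : 0 ≤ 4 * |c| * 2 ^ |c| * (b - s) ^ c := by positivity
    linarith
  · rw [sub_sub_sub_cancel_left, abs_sub_comm q p] at h1
    refine h1.trans ?_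
    have : (0 : ℝ) ≤ 2 ^ |c| := by positivity
    gcongr
    linarith

theorem weightedHolder_edgeWeight : WeightedHolder a b γ δ (edgeWeight a b γ δ) := by
  have := (weightedHolder_rpow_left (a := a) (b := b) (-γ)).mul
    (weightedHolder_rpow_right (a := a) (b := b) (-δ))
  simp only [neg_neg, add_zero, zero_add] at this
  exact this

/-- A function with decay at both endpoints extends by zero to a Hölder function on `[a, b]`. -/
theorem WeightedHolder.isHolderOn_of_neg {η : ℝ} (hη : 0 < η)
    (hf : WeightedHolder a b (-η) (-η) f) (h0 : ∀ s, s ∉ Ioo a b → f s = 0) :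
    IsHolderOn f (Icc a b) := by
  obtain ⟨M, μ, hM, hμ, hμ1, H⟩ := hf
  rw [isHolderOn_iff]
  rcases lt_or_ge b a with hab | hab
  · exact ⟨0, 1, le_rfl, one_pos, le_rfl, fun x hx => absurd (hx.1.trans hx.2) (not_le.2 hab)⟩
  have hL : 0 ≤ b - a := sub_nonneg.2 hab
  -- Near the diagonal the Hölder exponent is μ, elsewhere only the decay of order η is available,
  -- so the smaller of the two is the global exponent.
  set ν := min η μ with hν
  have hν0 : 0 < ν := lt_min hη hμ
  have hν1 : ν ≤ 1 := (min_le_right _ _).trans hμ1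
  set C := M * ((b - a) ^ η * (b - a) ^ (η - ν)) with hC
  have hC0 : 0 ≤ C := by positivity
  have hw : ∀ s ∈ Ioo a b, M * edgeWeight a b (-η) (-η) s ≤ C * edgeDist a b s ^ ν := by
    intro s hs
    rw [hC, mul_assoc]
    refine mul_le_mul_of_nonneg_left ?_ hM
    have hd := edgeDist_pos hs
    have hdL := edgeDist_le_length hs
    have e1 : edgeWeight a b (-η) (-η) s ≤ edgeDist a b s ^ η * (b - a) ^ η := by
      simp only [edgeWeight, neg_neg]
      have h1 : 0 < s - a := sub_pos.2 hs.1
      have h2 : 0 < b - s := sub_pos.2 hs.2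
      rcases min_cases (s - a) (b - s) with h | h
      · rw [edgeDist, h.1]
        gcongr
        exact hs.1.le
      · rw [edgeDist, h.1, mul_comm]
        gcongr
        exact hs.2.le
    have e2 : edgeDist a b s ^ η ≤ edgeDist a b s ^ ν * (b - a) ^ (η - ν) := by
      rw [show η = ν + (η - ν) by ring, rpow_add hd, add_sub_cancel_left]
      gcongr
      have := min_le_left η μ
      linarith
    calc _ ≤ edgeDist a b s ^ η * (b - a) ^ η := e1
      _ ≤ (edgeDist a b s ^ ν * (b - a) ^ (η - ν)) * (b - a) ^ η := by gcongr
      _ = _ := by ring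
  have hd0 : ∀ s ∈ Icc a b, 0 ≤ edgeDist a b s := fun s hs =>
    le_min (sub_nonneg.2 hs.1) (sub_nonneg.2 hs.2)
  have hb : ∀ s ∈ Icc a b, |f s| ≤ C * edgeDist a b s ^ ν := by
    intro s hs
    by_cases hs' : s ∈ Ioo a b
    · exact (H s hs' s s (near_self hs') (near_self hs')).1.trans (hw s hs')
    · rw [h0 s hs', abs_zero]
      exact mul_nonneg hC0 (rpow_nonneg (hd0 s hs) _)
  refine ⟨C * (2 ^ ν + 3 ^ ν), ν, by positivity, hν0, hν1, fun s hs t ht => ?_⟩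
  -- If t is not near s in this sense, the distances of s and t to the endpoints are at most 2|s -
  -- t| and 3|s - t|, and the decay of f at both points is enough.
  by_cases hc : s ∈ Ioo a b ∧ |t - s| ≤ edgeDist a b s / 2
  · obtain ⟨hs', hst⟩ := hc
    have hd := edgeDist_pos hs'
    have h2 := (H s hs' s t (near_self hs') hst).2
    have h3 := WeightedHolder.lower hM (min_le_right η μ) hν0 hs' (near_self hs') hst h2
    have h4 : 0 ≤ (|s - t| / edgeDist a b s) ^ ν := by positivity
    have h5 : (1 : ℝ) ≤ 2 ^ ν := one_le_rpow (by norm_num) hν0.le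
    have h6 : (0 : ℝ) ≤ 3 ^ ν := by positivity
    calc |f s - f t| ≤ C * edgeDist a b s ^ ν * (|s - t| / edgeDist a b s) ^ ν :=
          h3.trans (mul_le_mul_of_nonneg_right (hw s hs') h4)
      _ = C * |s - t| ^ ν := by
          rw [mul_assoc, ← mul_rpow hd.le (by positivity), mul_div_cancel₀ _ hd.ne']
      _ ≤ _ := by
          have : 0 ≤ C * |s - t| ^ ν := by positivity
          nlinarith
  · have hds : edgeDist a b s ≤ 2 * |s - t| := by
      by_cases hs' : s ∈ Ioo a b
      · have : ¬|t - s| ≤ edgeDist a b s / 2 := fun h => hc ⟨hs', h⟩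
        rw [abs_sub_comm]; linarith [not_le.1 this]
      · have : edgeDist a b s ≤ 0 := by
          by_contra hcon
          rw [not_le, edgeDist, lt_min_iff] at hcon
          exact hs' ⟨by linarith [hcon.1], by linarith [hcon.2]⟩
        have := abs_nonneg (s - t)
        linarith
    have hdt : edgeDist a b t ≤ 3 * |s - t| := by
      have := edgeDist_le_add a b s t
      rw [abs_sub_comm] at this
      linarith
    have e1 := rpow_le_rpow (hd0 s hs) hds hν0.le
    have e2 := rpow_le_rpow (hd0 t ht) hdt hν0.le
    rw [mul_rpow (by norm_num) (abs_nonneg _)] at e1 e2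
    calc |f s - f t| ≤ |f s| + |f t| := abs_sub _ _
      _ ≤ C * (2 ^ ν * |s - t| ^ ν) + C * (3 ^ ν * |s - t| ^ ν) :=
        add_le_add ((hb s hs).trans (mul_le_mul_of_nonneg_left e1 hC0))
          ((hb t ht).trans (mul_le_mul_of_nonneg_left e2 hC0))
      _ = _ := by ring

/-- For the converse direction the exponents are raised slightly. Dividing by the stronger weight
leaves a function that decays at both endpoints, and such a function extends by zero to a Hölder
function on the closed interval; this is the numerator g. -/
theorem mem_endpointClass_iff {μ ν : ℝ} (hμ : 0 < μ) (hν : 0 < ν) {ψ : ℝ → ℝ} :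
    ψ ∈ EndpointClass a b μ ν ↔ ∃ γ δ, γ < μ ∧ δ < ν ∧ WeightedHolder a b γ δ ψ := by
  constructor
  · rintro ⟨γ, δ, -, hγ, -, hδ, g, hg, h⟩
    refine ⟨γ, δ, hγ, hδ, ?_⟩
    have := (weightedHolder_of_isHolderOn hg).mul (weightedHolder_edgeWeight (γ := γ) (δ := δ))
    rw [zero_add, zero_add] at this
    refine this.congr fun s hs => ?_
    change _ = g s * ((s - a) ^ (-γ) * (b - s) ^ (-δ))
    rw [h s hs, rpow_neg (sub_pos.2 hs.1).le, rpow_neg (sub_pos.2 hs.2).le, ← mul_inv,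
      div_eq_mul_inv]
  · rintro ⟨γ, δ, hγ, hδ, h⟩
    -- The maximum with 0 is there because `EndpointClass` asks for nonnegative exponents, while γ
    -- may be negative.
    obtain ⟨γ', hγ', hγμ⟩ := exists_between (max_lt hγ hμ)
    obtain ⟨δ', hδ', hδν⟩ := exists_between (max_lt hδ hν)
    rw [max_lt_iff] at hγ' hδ'
    refine ⟨γ', δ', hγ'.2.le, hγμ, hδ'.2.le, hδν,
      (Ioo a b).indicator fun s => ψ s * edgeWeight a b (-γ') (-δ') s, ?_, fun s hs => ?_⟩
    · have hη : 0 < min (γ' - γ) (δ' - δ) := lt_min (by linarith) (by linarith)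
      refine WeightedHolder.isHolderOn_of_neg hη ?_ fun s hs => indicator_of_notMem hs _
      refine ((h.mul (weightedHolder_edgeWeight (γ := -γ') (δ := -δ'))).congr
        fun s hs => indicator_of_mem hs _).mono ?_ ?_
      · linarith [min_le_left (γ' - γ) (δ' - δ)]
      · linarith [min_le_right (γ' - γ) (δ' - δ)]
    · have h1 := rpow_pos_of_pos (sub_pos.2 hs.1) γ'
      have h2 := rpow_pos_of_pos (sub_pos.2 hs.2) δ'
      rw [indicator_of_mem hs, edgeWeight, neg_neg, neg_neg]
      field_simp

theorem WeightedHolder.continuousOn (hf : WeightedHolder a b γ δ f) :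
    ContinuousOn f (Ioo a b) := by
  obtain ⟨M, μ, hM, hμ, hμ1, H⟩ := hf
  intro s hs
  have hd := edgeDist_pos hs
  apply ContinuousAt.continuousWithinAt
  rw [ContinuousAt, tendsto_iff_norm_sub_tendsto_zero]
  have hlim : Tendsto (fun p => M * edgeWeight a b γ δ s * (|p - s| / edgeDist a b s) ^ μ) (𝓝 s)
      (𝓝 0) := by
    have : Continuous fun p => M * edgeWeight a b γ δ s * (|p - s| / edgeDist a b s) ^ μ := by
      refine continuous_const.mul (Continuous.rpow_const (by fun_prop) fun _ => Or.inr hμ.le)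
    have h := this.tendsto s
    simpa [zero_rpow hμ.ne'] using h
  refine squeeze_zero' (Eventually.of_forall fun _ => norm_nonneg _) ?_ hlim
  have hball : ∀ᶠ p in 𝓝 s, |p - s| < edgeDist a b s / 2 := by
    have := Metric.ball_mem_nhds s (half_pos hd)
    filter_upwards [this] with p hp
    simpa [Real.dist_eq] using hp
  filter_upwards [hball] with p hp
  exact (H s hs p s hp.le (near_self hs)).2

theorem integrableOn_rpow_left {c : ℝ} (hc : -1 < c) :
    IntegrableOn (fun s => (s - a) ^ c) (Ioo a b) := by
  rcases le_or_gt b a with hab | hab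
  · simp [Ioo_eq_empty_of_le hab]
  have h := (intervalIntegral.intervalIntegrable_rpow' (a := 0) (b := b - a) hc).comp_sub_right a
  rw [zero_add, sub_add_cancel, intervalIntegrable_iff_integrableOn_Ioo_of_le hab.le] at h
  exact h

theorem integrableOn_rpow_right {c : ℝ} (hc : -1 < c) :
    IntegrableOn (fun s => (b - s) ^ c) (Ioo a b) := by
  rcases le_or_gt b a with hab | hab
  · simp [Ioo_eq_empty_of_le hab]
  have h := (intervalIntegral.intervalIntegrable_rpow' (a := b - a) (b := 0) hc).comp_sub_left b
  rw [sub_zero, sub_sub_cancel, intervalIntegrable_iff_integrableOn_Ioo_of_le hab.le] at h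
  exact h

theorem integrableOn_edgeWeight (hγ : γ < 1) (hδ : δ < 1) :
    IntegrableOn (edgeWeight a b γ δ) (Ioo a b) := by
  rcases le_or_gt b a with hab | hab
  · simp [Ioo_eq_empty_of_le hab]
  -- With nonnegative exponents each factor is bounded on the half of the interval away from its own
  -- endpoint, so the weight is dominated by a sum of two one-sided powers.
  wlog h0 : 0 ≤ γ ∧ 0 ≤ δ generalizing γ δ
  · obtain ⟨C, hC, h⟩ := edgeWeight_mono (a := a) (b := b) (le_max_left γ 0) (le_max_left δ 0)
    have h1 := (this (max_lt hγ one_pos) (max_lt hδ one_pos)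
      ⟨le_max_right _ _, le_max_right _ _⟩).const_mul C
    refine Integrable.mono' h1
      (weightedHolder_edgeWeight.continuousOn.aestronglyMeasurable measurableSet_Ioo) ?_
    filter_upwards [ae_restrict_mem measurableSet_Ioo] with s hs
    rw [Real.norm_of_nonneg (edgeWeight_pos hs).le]
    exact h s hs
  obtain ⟨hγ0, hδ0⟩ := h0
  have hL : 0 < (b - a) / 2 := half_pos (sub_pos.2 hab)
  have h1 := ((integrableOn_rpow_left (a := a) (b := b) (c := -γ) (by linarith)).const_mul
    (((b - a) / 2) ^ (-δ))).add
    ((integrableOn_rpow_right (a := a) (b := b) (c := -δ) (by linarith)).const_mul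
    (((b - a) / 2) ^ (-γ)))
  refine Integrable.mono' h1
      (weightedHolder_edgeWeight.continuousOn.aestronglyMeasurable measurableSet_Ioo) ?_
  filter_upwards [ae_restrict_mem measurableSet_Ioo] with s hs
  rw [Real.norm_of_nonneg (edgeWeight_pos hs).le]
  have p1 := rpow_pos_of_pos (sub_pos.2 hs.1) (-γ)
  have p2 := rpow_pos_of_pos (sub_pos.2 hs.2) (-δ)
  have p3 := rpow_pos_of_pos hL (-γ)
  have p4 := rpow_pos_of_pos hL (-δ)
  simp only [edgeWeight, Pi.add_apply]
  rcases le_total ((b - a) / 2) (s - a) with h | h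
  · have := rpow_le_rpow_of_nonpos hL h (by linarith : -γ ≤ 0)
    nlinarith [mul_le_mul_of_nonneg_right this p2.le, mul_pos p4 p1]
  · have := rpow_le_rpow_of_nonpos hL (by linarith : (b - a) / 2 ≤ b - s) (by linarith : -δ ≤ 0)
    nlinarith [mul_le_mul_of_nonneg_right this p1.le, mul_pos p3 p2]

theorem WeightedHolder.integrableOn (hf : WeightedHolder a b γ δ f) (hγ : γ < 1) (hδ : δ < 1) :
    IntegrableOn f (Ioo a b) := by
  obtain ⟨M, -, h⟩ := hf.bound
  refine Integrable.mono' ((integrableOn_edgeWeight hγ hδ).const_mul M)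
    (hf.continuousOn.aestronglyMeasurable measurableSet_Ioo) ?_
  filter_upwards [ae_restrict_mem measurableSet_Ioo] with s hs using h s hs

end Endpoint


/-! ### Principal values as absolutely convergent integrals -/

/-- An even cutoff function, equal to `1` at `0` and supported in `[-D, D]`. -/
def cutoff (D u : ℝ) : ℝ := max 0 (1 - (u / D) ^ 2)

/-- The kernel `(1 - cutoff D u) / u`. -/
def farKernel (D u : ℝ) : ℝ := u / max D |u| ^ 2

/-- The integrand that remains when the odd part is removed from the principal value. -/
def pvIntegrand (f : ℝ → ℝ) (D s r : ℝ) : ℝ := (f r - f s * cutoff D (r - s)) / (r - s)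

/-- A quantitative Hölder condition at the point `s`. -/
structure HolderAt (a b : ℝ) (f : ℝ → ℝ) (s D A μ : ℝ) : Prop where
  pos : 0 < D
  nonneg : 0 ≤ A
  exponent_pos : 0 < μ
  left : a < s - D
  right : s + D < b
  bound : ∀ r, |r - s| ≤ D → |f r - f s| ≤ A * |r - s| ^ μ

section Kernel

variable {a b γ δ γ' δ' s t D A μ : ℝ} {f g : ℝ → ℝ}

theorem cutoff_neg (u : ℝ) : cutoff D (-u) = cutoff D u := by
  simp [cutoff, neg_div]

theorem cutoff_nonneg (u : ℝ) : 0 ≤ cutoff D u := le_max_left _ _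

theorem cutoff_le_one (u : ℝ) : cutoff D u ≤ 1 :=
  max_le zero_le_one (by linarith [sq_nonneg (u / D)])

theorem abs_cutoff_le_one (u : ℝ) : |cutoff D u| ≤ 1 := by
  rw [abs_of_nonneg (cutoff_nonneg u)]; exact cutoff_le_one u

theorem cutoff_eq_zero (hD : 0 < D) {u : ℝ} (hu : D ≤ |u|) : cutoff D u = 0 := by
  apply max_eq_left
  have : 1 ≤ (u / D) ^ 2 := by
    rw [← sq_abs, abs_div, abs_of_pos hD]
    exact one_le_pow₀ ((one_le_div hD).2 hu)
  linarith

theorem cutoff_zero : cutoff D 0 = 1 := by simp [cutoff]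

theorem continuous_cutoff : Continuous (cutoff D) := by
  unfold cutoff; fun_prop

theorem farKernel_eq (hD : 0 < D) (u : ℝ) : farKernel D u = (1 - cutoff D u) / u := by
  rcases eq_or_ne u 0 with rfl | hu
  · simp [farKernel]
  rcases le_total D |u| with h | h
  · rw [cutoff_eq_zero hD h, farKernel, max_eq_right h, sq_abs]
    field_simp
    simp
  · have : (u / D) ^ 2 ≤ 1 := by
      rw [← sq_abs, abs_div, abs_of_pos hD]
      exact pow_le_one₀ (by positivity) ((div_le_one hD).2 h)
    rw [farKernel, max_eq_left h, cutoff, max_eq_right (by linarith)]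
    field_simp
    ring

theorem abs_farKernel_le (hD : 0 < D) (u : ℝ) : |farKernel D u| ≤ 1 / max D |u| := by
  have h : 0 < max D |u| := lt_max_of_lt_left hD
  rw [farKernel, abs_div, abs_of_pos (pow_pos h 2), div_le_div_iff₀ (pow_pos h 2) h, one_mul, sq]
  exact mul_le_mul_of_nonneg_right (le_max_right _ _) h.le

/-- The far kernel has size 1 / max(D, |u|), and moving its argument gains the factor |u - v| / D.
This makes the far part of H[f] Lipschitz at scale D. -/
theorem abs_farKernel_sub_le (hD : 0 < D) (u v : ℝ) :
    |farKernel D u - farKernel D v| ≤ 3 * |u - v| / (D * max D |u|) := by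
  set P := max D |u| with hP
  set Q := max D |v| with hQ
  have hDP : D ≤ P := le_max_left _ _
  have hDQ : D ≤ Q := le_max_left _ _
  have hP0 : 0 < P := hD.trans_le hDP
  have hQ0 : 0 < Q := hD.trans_le hDQ
  have hvQ : |v| ≤ Q := le_max_right _ _
  have hPQ : |Q - P| ≤ |u - v| := by
    have h1 := abs_max_sub_max_le_abs |v| |u| D
    rw [max_comm |v|, max_comm |u|] at h1
    exact h1.trans ((abs_abs_sub_abs_le v u).trans (abs_sub_comm v u).le)
  have e : farKernel D u - farKernel D v =
      (u - v) / P ^ 2 + v * (Q - P) * ((Q + P) / (P ^ 2 * Q ^ 2)) := by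
    simp only [farKernel, ← hP, ← hQ]; field_simp; ring
  have h1 : |(u - v) / P ^ 2| ≤ |u - v| / (D * P) := by
    rw [abs_div, abs_of_pos (pow_pos hP0 2), sq]
    gcongr
  have h2 : |v * (Q - P) * ((Q + P) / (P ^ 2 * Q ^ 2))| ≤ 2 * |u - v| / (D * P) := by
    rw [abs_mul, abs_mul, abs_of_pos (by positivity : 0 < (Q + P) / (P ^ 2 * Q ^ 2))]
    calc |v| * |Q - P| * ((Q + P) / (P ^ 2 * Q ^ 2)) ≤ Q * |u - v| * ((Q + P) / (P ^ 2 * Q ^ 2)) := by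
          gcongr
      _ = |u - v| / P * (1 / P + 1 / Q) := by field_simp
      _ ≤ |u - v| / P * (1 / D + 1 / D) := by gcongr
      _ = _ := by field_simp; ring
  rw [e]
  calc _ ≤ |u - v| / (D * P) + 2 * |u - v| / (D * P) := (abs_add_le _ _).trans (add_le_add h1 h2)
    _ = _ := by ring

theorem continuous_farKernel (hD : 0 < D) : Continuous (farKernel D) := by
  unfold farKernel
  refine Continuous.div (by fun_prop) (by fun_prop) fun u => ?_
  have : 0 < max D |u| := lt_max_of_lt_left hD
  positivity

/-- The near term is integrable by the Hölder condition at s, the far term because its kernel is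
bounded. All size estimates go through this splitting. -/
theorem pvIntegrand_eq (hD : 0 < D) (r : ℝ) : pvIntegrand f D s r =
    (f r - f s) * (cutoff D (r - s) / (r - s)) + f r * farKernel D (r - s) := by
  rw [farKernel_eq hD, pvIntegrand]; ring

/-- The integrable singularity `|u|^{μ-1}` on `[-D, D]`. -/
def nearBound (D μ u : ℝ) : ℝ := (Iic D).indicator (fun x => x ^ (μ - 1)) |u|

theorem nearBound_nonneg (u : ℝ) : 0 ≤ nearBound D μ u :=
  indicator_apply_nonneg fun _ => rpow_nonneg (abs_nonneg u) _

theorem integral_nearBound (hD : 0 < D) (hμ : 0 < μ) :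
    ∫ u, nearBound D μ u = 2 * (D ^ μ / μ) := by
  have h : ∫ u, nearBound D μ u = _ :=
    integral_comp_abs (f := (Iic D).indicator fun x => x ^ (μ - 1))
  rw [h, setIntegral_indicator measurableSet_Iic, Ioi_inter_Iic,
    ← intervalIntegral.integral_of_le hD.le, integral_rpow (Or.inl (by linarith)),
    sub_add_cancel, zero_rpow hμ.ne', sub_zero]

theorem integral_odd_comp_sub {φ : ℝ → ℝ} (hφ : ∀ u, φ (-u) = -φ u) (s : ℝ) :
    ∫ r, φ (r - s) = 0 := by
  rw [integral_sub_right_eq_self]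
  have h := integral_neg_eq_self φ volume
  simp only [hφ, integral_neg] at h
  linarith

theorem integrable_nearBound (hD : 0 < D) (hμ : 0 < μ) : Integrable (nearBound D μ) := by
  -- The Bochner integral of a non-integrable function is 0, whereas the formula above gives a
  -- positive value.
  by_contra h
  have h1 := integral_nearBound hD hμ
  rw [integral_undef h] at h1
  have : 0 < 2 * (D ^ μ / μ) := by positivity
  linarith

theorem HolderAt.mem_Ioo (h : HolderAt a b f s D A μ) {r : ℝ} (hr : |r - s| ≤ D) : r ∈ Ioo a b := by
  rw [abs_le] at hr
  exact ⟨by linarith [h.left], by linarith [h.right]⟩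

theorem HolderAt.abs_near_le (h : HolderAt a b f s D A μ) (r : ℝ) :
    |(f r - f s) * (cutoff D (r - s) / (r - s))| ≤ A * nearBound D μ (r - s) := by
  rcases le_or_gt |r - s| D with hr | hr
  · rw [nearBound, indicator_of_mem (mem_Iic.2 hr), abs_mul, abs_div]
    rcases eq_or_ne (r - s) 0 with h0 | h0
    · rw [h0, abs_zero, div_zero, mul_zero]
      exact mul_nonneg h.nonneg (rpow_nonneg le_rfl _)
    · have h0' := abs_pos.2 h0
      calc |f r - f s| * (|cutoff D (r - s)| / |r - s|)
          ≤ (A * |r - s| ^ μ) * (1 / |r - s|) := by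
            gcongr
            · exact mul_nonneg h.nonneg (rpow_nonneg (abs_nonneg _) _)
            · exact h.bound r hr
            · exact abs_cutoff_le_one _
        _ = A * |r - s| ^ (μ - 1) := by rw [rpow_sub_one h0'.ne']; ring
  · rw [cutoff_eq_zero h.pos hr.le, zero_div, mul_zero, abs_zero]
    exact mul_nonneg h.nonneg (nearBound_nonneg _)

theorem measurable_cutoff_div : Measurable fun u => cutoff D u / u :=
  continuous_cutoff.measurable.div measurable_id

theorem HolderAt.aestronglyMeasurable_near (hf : IntegrableOn f (Ioo a b)) :
    AEStronglyMeasurable (fun r => (f r - f s) * (cutoff D (r - s) / (r - s)))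
      (volume.restrict (Ioo a b)) :=
  (hf.1.sub aestronglyMeasurable_const).mul
    (measurable_cutoff_div.comp (measurable_id.sub_const s)).aestronglyMeasurable

theorem HolderAt.integrableOn_near (h : HolderAt a b f s D A μ) (hf : IntegrableOn f (Ioo a b)) :
    IntegrableOn (fun r => (f r - f s) * (cutoff D (r - s) / (r - s))) (Ioo a b) :=
  Integrable.mono' (((integrable_nearBound h.pos h.exponent_pos).comp_sub_right s).const_mul
    A).integrableOn (HolderAt.aestronglyMeasurable_near hf)
    (Eventually.of_forall fun r => h.abs_near_le r)

theorem integrableOn_div_max (hD : 0 < D) (hf : IntegrableOn f (Ioo a b)) :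
    IntegrableOn (fun r => |f r| / max D |r - s|) (Ioo a b) := by
  refine Integrable.mono' (hf.abs.div_const D) ?_ (Eventually.of_forall fun r => ?_)
  · exact hf.abs.1.div₀ (Continuous.aestronglyMeasurable (by fun_prop))
  · rw [norm_div, norm_of_nonneg (abs_nonneg _), norm_of_nonneg (hD.le.trans (le_max_left _ _))]
    exact div_le_div_of_nonneg_left (abs_nonneg _) hD (le_max_left _ _)

theorem abs_mul_farKernel_le (hD : 0 < D) (r : ℝ) :
    |f r * farKernel D (r - s)| ≤ |f r| / max D |r - s| := by
  rw [abs_mul, div_eq_mul_one_div]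
  exact mul_le_mul_of_nonneg_left (abs_farKernel_le hD _) (abs_nonneg _)

theorem integrableOn_far (hD : 0 < D) (hf : IntegrableOn f (Ioo a b)) :
    IntegrableOn (fun r => f r * farKernel D (r - s)) (Ioo a b) :=
  Integrable.mono' (integrableOn_div_max hD hf)
    (hf.1.mul ((continuous_farKernel hD).comp (by fun_prop)).aestronglyMeasurable)
    (Eventually.of_forall fun r => abs_mul_farKernel_le hD r)

theorem HolderAt.integrableOn_pvIntegrand (h : HolderAt a b f s D A μ)
    (hf : IntegrableOn f (Ioo a b)) : IntegrableOn (pvIntegrand f D s) (Ioo a b) :=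
  ((h.integrableOn_near hf).add (integrableOn_far h.pos hf)).congr
    (Eventually.of_forall fun r => (pvIntegrand_eq h.pos r).symm)

theorem HolderAt.integral_abs_pvIntegrand_le (h : HolderAt a b f s D A μ)
    (hf : IntegrableOn f (Ioo a b)) : ∫ r in Ioo a b, |pvIntegrand f D s r| ≤
      A * (2 * (D ^ μ / μ)) + ∫ r in Ioo a b, |f r| / max D |r - s| := by
  have hn : Integrable (fun r => A * nearBound D μ (r - s)) :=
    ((integrable_nearBound h.pos h.exponent_pos).comp_sub_right s).const_mul A
  calc ∫ r in Ioo a b, |pvIntegrand f D s r|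
      ≤ ∫ r in Ioo a b, (A * nearBound D μ (r - s) + |f r| / max D |r - s|) := by
        refine integral_mono_of_nonneg (Eventually.of_forall fun _ => abs_nonneg _)
          (hn.integrableOn.add (integrableOn_div_max h.pos hf)) (Eventually.of_forall fun r => ?_)
        simp only [pvIntegrand_eq h.pos]
        exact (abs_add_le _ _).trans (add_le_add (h.abs_near_le r) (abs_mul_farKernel_le h.pos r))
    _ = (∫ r in Ioo a b, A * nearBound D μ (r - s)) + ∫ r in Ioo a b, |f r| / max D |r - s| :=
        integral_add hn.integrableOn (integrableOn_div_max h.pos hf)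
    _ ≤ (∫ r, A * nearBound D μ (r - s)) + ∫ r in Ioo a b, |f r| / max D |r - s| := by
        refine add_le_add (setIntegral_le_integral hn (Eventually.of_forall fun r =>
          mul_nonneg h.nonneg (nearBound_nonneg _))) le_rfl
    _ = _ := by
        rw [integral_const_mul, integral_sub_right_eq_self (nearBound D μ),
          integral_nearBound h.pos h.exponent_pos]

/-- Integration against an even multiplier of `1 / (r - s)`: the odd part cancels. -/
theorem HolderAt.integral_mul_even (h : HolderAt a b f s D A μ) (hf : IntegrableOn f (Ioo a b))
    {m : ℝ → ℝ} (hm : ∀ u, m (-u) = m u) (hmm : Measurable m) (hm1 : ∀ u, |m u| ≤ 1)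
    (hint : IntegrableOn (fun r => f r * (m (r - s) / (r - s))) (Ioo a b)) :
    ∫ r in Ioo a b, f r * (m (r - s) / (r - s)) =
      ∫ r in Ioo a b, pvIntegrand f D s r * m (r - s) := by
  have hN : IntegrableOn (fun r => pvIntegrand f D s r * m (r - s)) (Ioo a b) :=
    (h.integrableOn_pvIntegrand hf).mul_bdd (c := 1)
      (hmm.comp (measurable_id.sub_const s)).aestronglyMeasurable
      (Eventually.of_forall fun r => hm1 _)
  -- The cutoff is supported in [s - D, s + D] ⊂ (a, b), so the integral extends to ℝ, where the
  -- integrand is odd about s.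
  have hodd : ∫ r in Ioo a b, f s * (cutoff D (r - s) * m (r - s) / (r - s)) = 0 := by
    rw [setIntegral_eq_integral_of_forall_compl_eq_zero, integral_const_mul,
      integral_odd_comp_sub (φ := fun u => cutoff D u * m u / u), mul_zero]
    · intro u
      simp only [cutoff_neg, hm, div_neg]
    · intro r hr
      rw [cutoff_eq_zero h.pos (le_of_not_ge fun hr' => hr (h.mem_Ioo hr')), zero_mul, zero_div,
        mul_zero]
  have e : ∀ r, f s * (cutoff D (r - s) * m (r - s) / (r - s)) =
      f r * (m (r - s) / (r - s)) - pvIntegrand f D s r * m (r - s) := fun r => by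
    rw [pvIntegrand]; ring
  simp only [e] at hodd
  rw [integral_sub hint hN] at hodd
  linarith

theorem setOf_trunc (a b s ε : ℝ) : {r : ℝ | r ∈ Ioo a b ∧ ε < |r - s|} =
    Ioo a b ∩ {r | ε < |r - s|} := rfl

theorem measurableSet_trunc (s ε : ℝ) : MeasurableSet {r : ℝ | ε < |r - s|} :=
  (isOpen_lt continuous_const (by fun_prop)).measurableSet

theorem integrableOn_trunc (hf : IntegrableOn f (Ioo a b)) {ε : ℝ} (hε : 0 < ε) :
    IntegrableOn (fun r => f r / (r - s)) {r : ℝ | r ∈ Ioo a b ∧ ε < |r - s|} := by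
  rw [setOf_trunc]
  have hf' : IntegrableOn f (Ioo a b ∩ {r | ε < |r - s|}) := hf.mono_set inter_subset_left
  refine Integrable.mono' (hf'.abs.div_const ε) (hf'.1.div₀ (Continuous.aestronglyMeasurable
    (by fun_prop))) ?_
  filter_upwards [ae_restrict_mem (measurableSet_Ioo.inter (measurableSet_trunc s ε))] with r hr
  rw [norm_div]
  exact div_le_div_of_nonneg_left (abs_nonneg _) hε (le_of_lt hr.2)

/-- The even multiplier here is the indicator of {ε < |u|}. The new integrand no longer depends on ε
and is integrable, which yields both the limit and a bound uniform in ε. -/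
theorem HolderAt.truncHilbert_eq (h : HolderAt a b f s D A μ) (hf : IntegrableOn f (Ioo a b))
    {ε : ℝ} (hε : 0 < ε) : truncHilbert a b f s ε = (1 / π) *
      ∫ r in Ioo a b ∩ {r | ε < |r - s|}, pvIntegrand f D s r := by
  have hms : MeasurableSet {u : ℝ | ε < |u|} := measurableSet_lt measurable_const (by fun_prop)
  have e1 : ∀ r, f r * ({u : ℝ | ε < |u|}.indicator 1 (r - s) / (r - s)) =
      {r | ε < |r - s|}.indicator (fun r => f r / (r - s)) r := fun r => by
    by_cases hr : ε < |r - s|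
    · rw [indicator_of_mem (by exact hr), indicator_of_mem (by exact hr), Pi.one_apply]; ring
    · rw [indicator_of_notMem (by exact hr), indicator_of_notMem (by exact hr)]; simp
  have e2 : ∀ r, pvIntegrand f D s r * {u : ℝ | ε < |u|}.indicator 1 (r - s) =
      {r | ε < |r - s|}.indicator (pvIntegrand f D s) r := fun r => by
    by_cases hr : ε < |r - s|
    · rw [indicator_of_mem (by exact hr), indicator_of_mem (by exact hr), Pi.one_apply, mul_one]
    · rw [indicator_of_notMem (by exact hr), indicator_of_notMem (by exact hr), mul_zero]
  have key := h.integral_mul_even hf (m := {u : ℝ | ε < |u|}.indicator 1) (fun u => ?_)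
    (measurable_one.indicator hms) (fun u => ?_) ?_
  · simp only [e1, e2] at key
    rw [setIntegral_indicator (measurableSet_trunc s ε),
      setIntegral_indicator (measurableSet_trunc s ε)] at key
    rw [truncHilbert, setOf_trunc, key]
  · simp [indicator]
  · by_cases hu : ε < |u| <;> simp [indicator, hu]
  · simp only [e1]
    have := integrableOn_trunc (s := s) hf hε
    rw [setOf_trunc, inter_comm] at this
    rw [IntegrableOn, integrable_indicator_iff (measurableSet_trunc s ε), IntegrableOn,
      Measure.restrict_restrict (measurableSet_trunc s ε)]
    exact this

theorem HolderAt.tendsto_truncHilbert (h : HolderAt a b f s D A μ)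
    (hf : IntegrableOn f (Ioo a b)) : Tendsto (truncHilbert a b f s) (𝓝[>] 0)
      (𝓝 ((1 / π) * ∫ r in Ioo a b, pvIntegrand f D s r)) := by
  have hN := h.integrableOn_pvIntegrand hf
  have hlim : Tendsto (fun ε => ∫ r in Ioo a b, {r | ε < |r - s|}.indicator (pvIntegrand f D s) r)
      (𝓝[>] 0) (𝓝 (∫ r in Ioo a b, pvIntegrand f D s r)) := by
    refine tendsto_integral_filter_of_dominated_convergence (fun r => |pvIntegrand f D s r|)
      (Eventually.of_forall fun ε => hN.1.indicator (measurableSet_trunc s ε))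
      (Eventually.of_forall fun ε => Eventually.of_forall fun r => norm_indicator_le_norm_self _ _)
      hN.abs ?_
    have hne : ∀ᵐ r ∂(volume.restrict (Ioo a b)), r ≠ s :=
      ae_restrict_of_ae (measure_eq_zero_iff_ae_notMem.1 (measure_singleton s))
    filter_upwards [hne] with r hr
    have h0 : 0 < |r - s| := abs_pos.2 (sub_ne_zero.2 hr)
    refine tendsto_const_nhds.congr' ?_
    filter_upwards [mem_nhdsWithin_of_mem_nhds (Iio_mem_nhds h0)] with ε hε
    rw [indicator_of_mem (by exact hε)]
  refine (hlim.const_mul (1 / π)).congr' ?_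
  filter_upwards [self_mem_nhdsWithin] with ε hε
  rw [h.truncHilbert_eq hf hε, setIntegral_indicator (measurableSet_trunc s ε)]

theorem HolderAt.hilbertExists (h : HolderAt a b f s D A μ) (hf : IntegrableOn f (Ioo a b)) :
    HilbertExists a b f s :=
  ⟨fun _ hε => integrableOn_trunc hf hε, _, h.tendsto_truncHilbert hf⟩

theorem HolderAt.hilbert_eq (h : HolderAt a b f s D A μ) (hf : IntegrableOn f (Ioo a b)) :
    hilbert a b f s = (1 / π) * ∫ r in Ioo a b, pvIntegrand f D s r :=
  (h.tendsto_truncHilbert hf).limUnder_eq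

theorem HilbertExists.tendsto (h : HilbertExists a b f s) :
    Tendsto (truncHilbert a b f s) (𝓝[>] 0) (𝓝 (hilbert a b f s)) :=
  tendsto_nhds_limUnder h.2

theorem HolderAt.abs_truncHilbert_le (h : HolderAt a b f s D A μ) (hf : IntegrableOn f (Ioo a b))
    {ε : ℝ} (hε : 0 < ε) : |truncHilbert a b f s ε| ≤ ∫ r in Ioo a b, |pvIntegrand f D s r| := by
  have hN := h.integrableOn_pvIntegrand hf
  rw [h.truncHilbert_eq hf hε, abs_mul, abs_of_pos (by positivity)]
  have h1 : |∫ r in Ioo a b ∩ {r | ε < |r - s|}, pvIntegrand f D s r| ≤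
      ∫ r in Ioo a b, |pvIntegrand f D s r| :=
    abs_integral_le_integral_abs.trans
      (setIntegral_mono_set hN.abs (Eventually.of_forall fun _ => abs_nonneg _)
        inter_subset_left.eventuallyLE)
  have h2 : 1 / π ≤ 1 := by
    rw [div_le_one pi_pos]; linarith [pi_gt_three]
  calc 1 / π * _ ≤ 1 * ∫ r in Ioo a b, |pvIntegrand f D s r| := by
        gcongr
    _ = _ := one_mul _

end Kernel


/-! ### Uniform bounds for the truncated transforms -/

section FarBound

variable {a b γ δ γ' δ' s t D A μ M : ℝ} {f g : ℝ → ℝ}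

/-- Interpolation: 1/m = m^{-θ} m^{θ-1}, with the first factor controlled by d and the second by x.
It trades part of the kernel for a power of the distance of s to the endpoint and leaves an
integrable power in r. -/
theorem inv_le_of_le_mul {m d x θ : ℝ} (hd : 0 < d) (hx : 0 < x) (h0 : 0 ≤ θ) (h1 : θ ≤ 1)
    (hmd : d ≤ 5 * m) (hmx : x ≤ 5 * m) : 1 / m ≤ 5 * d ^ (-θ) * x ^ (θ - 1) := by
  have hm : 0 < 5 * m := hd.trans_le hmd
  have e : 1 / m = 5 * ((5 * m) ^ (-θ) * (5 * m) ^ (θ - 1)) := by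
    rw [← rpow_add hm, show -θ + (θ - 1) = -1 by ring, rpow_neg_one]
    have : m ≠ 0 := by rintro rfl; simp at hm
    field_simp
  rw [e, mul_assoc]
  have h2 := rpow_le_rpow_of_nonpos hd hmd (by linarith : -θ ≤ 0)
  have h3 := rpow_le_rpow_of_nonpos hx hmx (by linarith : θ - 1 ≤ 0)
  gcongr

/-- If a is the endpoint nearer to s, the kernel is at most a multiple of (s - a)^{-γ'} (r -
a)^{γ'-1}. Against the weight this leaves (r - a)^{-(γ+1-γ')} (b - r)^{-δ}, integrable precisely
because γ < γ' and δ < 1. The case of b is symmetric. -/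
theorem integral_edgeWeight_div_max_le (hγ : γ < γ') (hδ : δ < δ') (h0γ : 0 ≤ γ') (h0δ : 0 ≤ δ')
    (h1γ : γ' ≤ 1) (h1δ : δ' ≤ 1) : ∃ C, 0 ≤ C ∧ ∀ s ∈ Ioo a b,
      ∫ r in Ioo a b, edgeWeight a b γ δ r / max (edgeDist a b s / 4) |r - s| ≤
        C * edgeWeight a b γ' δ' s := by
  obtain ⟨C₁, hC₁, h₁⟩ := edgeWeight_mono (a := a) (b := b) (le_refl γ') h0δ
  obtain ⟨C₂, hC₂, h₂⟩ := edgeWeight_mono (a := a) (b := b) h0γ (le_refl δ')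
  have i₁ : IntegrableOn (edgeWeight a b (γ + 1 - γ') δ) (Ioo a b) :=
    integrableOn_edgeWeight (by linarith) (by linarith)
  have i₂ : IntegrableOn (edgeWeight a b γ (δ + 1 - δ')) (Ioo a b) :=
    integrableOn_edgeWeight (by linarith) (by linarith)
  set I₁ := ∫ r in Ioo a b, edgeWeight a b (γ + 1 - γ') δ r
  set I₂ := ∫ r in Ioo a b, edgeWeight a b γ (δ + 1 - δ') r
  have p₁ : 0 ≤ I₁ := setIntegral_nonneg measurableSet_Ioo fun r hr => (edgeWeight_pos hr).le
  have p₂ : 0 ≤ I₂ := setIntegral_nonneg measurableSet_Ioo fun r hr => (edgeWeight_pos hr).le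
  refine ⟨5 * C₁ * I₁ + 5 * C₂ * I₂, by positivity, fun s hs => ?_⟩
  have hd := edgeDist_pos hs
  have hw := (edgeWeight_pos (γ := γ') (δ := δ') hs).le
  have hnn : ∀ᵐ r ∂(volume.restrict (Ioo a b)),
      0 ≤ edgeWeight a b γ δ r / max (edgeDist a b s / 4) |r - s| := by
    filter_upwards [ae_restrict_mem measurableSet_Ioo] with r hr
    have := (edgeWeight_pos (γ := γ) (δ := δ) hr).le
    positivity
  rcases le_total (s - a) (b - s) with hc | hc
  · have hds : edgeDist a b s = s - a := min_eq_left hc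
    calc _ ≤ ∫ r in Ioo a b, 5 * (s - a) ^ (-γ') * edgeWeight a b (γ + 1 - γ') δ r := by
          refine integral_mono_of_nonneg hnn (i₁.const_mul _) ?_
          filter_upwards [ae_restrict_mem measurableSet_Ioo] with r hr
          have hra : 0 < r - a := sub_pos.2 hr.1
          have hm1 : edgeDist a b s / 4 ≤ max (edgeDist a b s / 4) |r - s| := le_max_left _ _
          have hm2 : |r - s| ≤ max (edgeDist a b s / 4) |r - s| := le_max_right _ _
          have hm3 := le_abs_self (r - s)
          rw [hds] at hm1 hm2 hd ⊢
          -- The 5 is 4 + 1: with m the maximum, s - a ≤ 4m and |r - s| ≤ m, hence r - a ≤ 5m.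
          have := inv_le_of_le_mul hd hra h0γ h1γ
            (m := max ((s - a) / 4) |r - s|) (by linarith) (by linarith)
          calc _ = edgeWeight a b γ δ r * (1 / max ((s - a) / 4) |r - s|) := by ring
            _ ≤ edgeWeight a b γ δ r * (5 * (s - a) ^ (-γ') * (r - a) ^ (γ' - 1)) :=
              mul_le_mul_of_nonneg_left this (edgeWeight_pos hr).le
            _ = _ := by
              rw [edgeWeight, edgeWeight, show -(γ + 1 - γ') = -γ + (γ' - 1) by ring, rpow_add hra]
              ring
      _ = 5 * (s - a) ^ (-γ') * I₁ := integral_const_mul _ _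
      _ ≤ 5 * (C₁ * edgeWeight a b γ' δ' s) * I₁ := by
          have := h₁ s hs
          rw [edgeWeight, neg_zero, rpow_zero, mul_one] at this
          gcongr
      _ ≤ _ := by
        have : 0 ≤ 5 * C₂ * I₂ * edgeWeight a b γ' δ' s := by positivity
        linarith
  · have hds : edgeDist a b s = b - s := min_eq_right hc
    calc _ ≤ ∫ r in Ioo a b, 5 * (b - s) ^ (-δ') * edgeWeight a b γ (δ + 1 - δ') r := by
          refine integral_mono_of_nonneg hnn (i₂.const_mul _) ?_
          filter_upwards [ae_restrict_mem measurableSet_Ioo] with r hr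
          have hra : 0 < b - r := sub_pos.2 hr.2
          have hm1 : edgeDist a b s / 4 ≤ max (edgeDist a b s / 4) |r - s| := le_max_left _ _
          have hm2 : |r - s| ≤ max (edgeDist a b s / 4) |r - s| := le_max_right _ _
          have hm3 := neg_le_abs (r - s)
          rw [hds] at hm1 hm2 hd ⊢
          have := inv_le_of_le_mul hd hra h0δ h1δ
            (m := max ((b - s) / 4) |r - s|) (by linarith) (by linarith)
          calc _ = edgeWeight a b γ δ r * (1 / max ((b - s) / 4) |r - s|) := by ring
            _ ≤ edgeWeight a b γ δ r * (5 * (b - s) ^ (-δ') * (b - r) ^ (δ' - 1)) :=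
              mul_le_mul_of_nonneg_left this (edgeWeight_pos hr).le
            _ = _ := by
              rw [edgeWeight, edgeWeight, show -(δ + 1 - δ') = -δ + (δ' - 1) by ring, rpow_add hra]
              ring
      _ = 5 * (b - s) ^ (-δ') * I₂ := integral_const_mul _ _
      _ ≤ 5 * (C₂ * edgeWeight a b γ' δ' s) * I₂ := by
          have := h₂ s hs
          rw [edgeWeight, neg_zero, rpow_zero, one_mul] at this
          gcongr
      _ ≤ _ := by
        have : 0 ≤ 5 * C₁ * I₁ * edgeWeight a b γ' δ' s := by positivity
        linarith

/-- The constant of the far part for a function bounded by a weight. -/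
theorem WeightedHolder.integral_div_max_le (hf : WeightedHolder a b γ δ f) (hγ : γ < γ')
    (hδ : δ < δ') (h0γ : 0 ≤ γ') (h0δ : 0 ≤ δ') (h1γ : γ' ≤ 1) (h1δ : δ' ≤ 1) :
    ∃ C, 0 ≤ C ∧ ∀ s ∈ Ioo a b,
      ∫ r in Ioo a b, |f r| / max (edgeDist a b s / 4) |r - s| ≤ C * edgeWeight a b γ' δ' s := by
  obtain ⟨C, hC, h⟩ := integral_edgeWeight_div_max_le (a := a) (b := b) hγ hδ h0γ h0δ h1γ h1δ
  obtain ⟨M, hM, hb⟩ := hf.bound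
  refine ⟨M * C, by positivity, fun s hs => ?_⟩
  have hd := edgeDist_pos hs
  rw [mul_assoc]
  refine le_trans ?_ (mul_le_mul_of_nonneg_left (h s hs) hM)
  rw [← integral_const_mul]
  have hw : IntegrableOn (edgeWeight a b γ δ) (Ioo a b) :=
    integrableOn_edgeWeight (by linarith) (by linarith)
  have hw' : IntegrableOn (fun r => edgeWeight a b γ δ r / max (edgeDist a b s / 4) |r - s|)
      (Ioo a b) := by
    refine (integrableOn_div_max (s := s) (by linarith : 0 < edgeDist a b s / 4) hw).congr ?_
    filter_upwards [ae_restrict_mem measurableSet_Ioo] with r hr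
    rw [abs_of_pos (edgeWeight_pos hr)]
  refine integral_mono_of_nonneg (Eventually.of_forall fun r => ?_) (hw'.const_mul M) ?_
  · change 0 ≤ _
    positivity
  · filter_upwards [ae_restrict_mem measurableSet_Ioo] with r hr
    rw [← mul_div_assoc]
    exact div_le_div_of_nonneg_right (hb r hr) (by positivity)

/-- The Hölder condition at the points near `s`, with the scale of `s`. -/
theorem WeightedHolder.holderAt (hf : WeightedHolder a b γ δ f) :
    ∃ M μ : ℝ, 0 ≤ M ∧ 0 < μ ∧ μ ≤ 1 ∧ ∀ s ∈ Ioo a b,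
      (∀ p q, |p - s| ≤ edgeDist a b s / 2 → |q - s| ≤ edgeDist a b s / 2 →
        |f p| ≤ M * edgeWeight a b γ δ s ∧
        |f p - f q| ≤ M * edgeWeight a b γ δ s * (|p - q| / edgeDist a b s) ^ μ) ∧
      ∀ t, |t - s| ≤ edgeDist a b s / 8 → HolderAt a b f t (edgeDist a b s / 4)
        (M * edgeWeight a b γ δ s * edgeDist a b s ^ (-μ)) μ := by
  obtain ⟨M, μ, hM, hμ, hμ1, H⟩ := hf
  refine ⟨M, μ, hM, hμ, hμ1, fun s hs => ⟨H s hs, fun t ht => ?_⟩⟩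
  have hd := edgeDist_pos hs
  have hw := (edgeWeight_pos (γ := γ) (δ := δ) hs).le
  have hdl := edgeDist_le_left (a := a) (b := b) (s := s)
  have hdr := edgeDist_le_right (a := a) (b := b) (s := s)
  have ht' := abs_le.1 ht
  -- The radii fit: 1/8 + 1/4 = 3/8 of the edge distance of s, below the 1/2 on which the Hölder
  -- condition holds.
  refine ⟨by linarith, by positivity, hμ, by linarith, by linarith, fun r hr => ?_⟩
  have hrs : |r - s| ≤ edgeDist a b s / 2 := (abs_sub_le r t s).trans (by linarith)
  refine (H s hs r t hrs (by linarith)).2.trans (le_of_eq ?_)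
  rw [div_rpow (abs_nonneg _) hd.le, rpow_neg hd.le]
  ring

theorem WeightedHolder.holderAt_self (hf : WeightedHolder a b γ δ f) (hs : s ∈ Ioo a b) :
    ∃ A μ, HolderAt a b f s (edgeDist a b s / 4) A μ := by
  obtain ⟨M, μ, -, -, -, h⟩ := hf.holderAt
  exact ⟨_, μ, (h s hs).2 s (by have := edgeDist_pos hs; simp; linarith)⟩

theorem near_const_le {d : ℝ} (hd : 0 < d) (hμ : 0 < μ) :
    d ^ (-μ) * (2 * ((d / 4) ^ μ / μ)) ≤ 2 / μ := by
  have h1 : (d / 4) ^ μ ≤ d ^ μ := rpow_le_rpow (by positivity) (by linarith) hμ.le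
  have h2 : 0 < d ^ μ := rpow_pos_of_pos hd _
  rw [rpow_neg hd.le]
  calc (d ^ μ)⁻¹ * (2 * ((d / 4) ^ μ / μ)) ≤ (d ^ μ)⁻¹ * (2 * (d ^ μ / μ)) := by gcongr
    _ = _ := by field_simp

theorem WeightedHolder.integral_abs_pvIntegrand_le (hf : WeightedHolder a b γ δ f) (hγ : γ < γ')
    (hδ : δ < δ') (h0γ : 0 ≤ γ') (h0δ : 0 ≤ δ') (h1γ : γ' ≤ 1) (h1δ : δ' ≤ 1) :
    ∃ C, 0 ≤ C ∧ ∀ s ∈ Ioo a b,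
      ∫ r in Ioo a b, |pvIntegrand f (edgeDist a b s / 4) s r| ≤ C * edgeWeight a b γ' δ' s := by
  have hint := hf.integrableOn (by linarith) (by linarith)
  obtain ⟨C, hC, h⟩ := hf.integral_div_max_le hγ hδ h0γ h0δ h1γ h1δ
  obtain ⟨C', hC', h'⟩ := edgeWeight_mono (a := a) (b := b) hγ.le hδ.le
  obtain ⟨M, μ, hM, hμ, -, hA⟩ := hf.holderAt
  refine ⟨M * C' * (2 / μ) + C, by positivity, fun s hs => ?_⟩
  have hd := edgeDist_pos hs
  have hs' := (hA s hs).2 s (by simp; linarith)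
  refine (hs'.integral_abs_pvIntegrand_le hint).trans ?_
  rw [add_mul]
  refine add_le_add ?_ (h s hs)
  have hw := (edgeWeight_pos (γ := γ) (δ := δ) hs).le
  rw [mul_assoc]
  calc M * edgeWeight a b γ δ s * _ ≤ M * (C' * edgeWeight a b γ' δ' s) * (2 / μ) :=
        mul_le_mul (mul_le_mul_of_nonneg_left (h' s hs) hM) (near_const_le hd hμ) (by positivity)
          (mul_nonneg hM (hw.trans (h' s hs)))
    _ = _ := by ring

theorem WeightedHolder.hilbertExists (hf : WeightedHolder a b γ δ f) (hγ : γ < 1) (hδ : δ < 1)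
    (hs : s ∈ Ioo a b) : HilbertExists a b f s := by
  obtain ⟨A, μ, h⟩ := hf.holderAt_self hs
  exact h.hilbertExists (hf.integrableOn hγ hδ)

/-- Uniformity in ε provides the dominating function when ε → 0 is taken under an outer integral in
the product formula. -/
theorem WeightedHolder.abs_truncHilbert_le (hf : WeightedHolder a b γ δ f) (hγ : γ < γ')
    (hδ : δ < δ') (h0γ : 0 ≤ γ') (h0δ : 0 ≤ δ') (h1γ : γ' ≤ 1) (h1δ : δ' ≤ 1) :
    ∃ C, 0 ≤ C ∧ ∀ s ∈ Ioo a b, ∀ ε, 0 < ε →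
      |truncHilbert a b f s ε| ≤ C * edgeWeight a b γ' δ' s := by
  obtain ⟨C, hC, h⟩ := hf.integral_abs_pvIntegrand_le hγ hδ h0γ h0δ h1γ h1δ
  refine ⟨C, hC, fun s hs ε hε => ?_⟩
  obtain ⟨A, μ, h'⟩ := hf.holderAt_self hs
  exact (h'.abs_truncHilbert_le (hf.integrableOn (by linarith) (by linarith)) hε).trans (h s hs)

end FarBound


/-! ### The Hilbert transform on weighted Hölder classes -/

section HilbertHolder

variable {a b γ δ γ' δ' s t D A μ M : ℝ} {f g : ℝ → ℝ}

theorem HolderAt.near_eq_zero (h : HolderAt a b f s D A μ) {r : ℝ} (hr : r ∉ Ioo a b) :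
    (f r - f s) * (cutoff D (r - s) / (r - s)) = 0 := by
  rw [cutoff_eq_zero h.pos (le_of_not_ge fun hr' => hr (h.mem_Ioo hr')), zero_div, mul_zero]

theorem HolderAt.integrable_near_shift (h : HolderAt a b f s D A μ)
    (hf : IntegrableOn f (Ioo a b)) :
    Integrable (fun u => (f (s + u) - f s) * (cutoff D u / u)) := by
  have h1 : Integrable (fun r => (f r - f s) * (cutoff D (r - s) / (r - s))) :=
    (integrableOn_iff_integrable_of_support_subset fun r hr =>
      by_contra fun hr' => hr (h.near_eq_zero hr')).1 (h.integrableOn_near hf)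
  simpa using h1.comp_add_left s

/-- The near part is written over all of ℝ in the variable u = r - s, so that the near parts at two
points carry the same kernel and can be subtracted under the integral. -/
theorem HolderAt.hilbert_eq_near_add_far (h : HolderAt a b f s D A μ)
    (hf : IntegrableOn f (Ioo a b)) : hilbert a b f s = (1 / π) *
      ((∫ u, (f (s + u) - f s) * (cutoff D u / u)) +
        ∫ r in Ioo a b, f r * farKernel D (r - s)) := by
  rw [h.hilbert_eq hf]
  simp only [pvIntegrand_eq h.pos]
  rw [integral_add (h.integrableOn_near hf) (integrableOn_far h.pos hf),
    setIntegral_eq_integral_of_forall_compl_eq_zero fun r hr => h.near_eq_zero hr,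
    ← integral_add_left_eq_self _ s]
  simp

theorem min_rpow_le {x y ν : ℝ} (hx : 0 ≤ x) (hy : 0 ≤ y) (hν : 0 < ν) :
    min (x ^ ν) (y ^ ν) ≤ y ^ (ν / 2) * x ^ (ν / 2) := by
  have h : ∀ z : ℝ, 0 ≤ z → z ^ ν = z ^ (ν / 2) * z ^ (ν / 2) := fun z hz => by
    rw [← rpow_add_of_nonneg hz (by linarith) (by linarith), add_halves]
  rcases le_total x y with hxy | hxy
  · refine (min_le_left _ _).trans ?_
    rw [h x hx]
    gcongr
  · refine (min_le_right _ _).trans ?_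
    rw [h y hy]
    gcongr

/-- The second difference f(t+u) - f(t) - f(s+u) + f(s) is of order |u|^μ and, regrouped, of order
|t - s|^μ. The geometric mean of the two bounds keeps half of the exponent for integrability against
1/|u| and half for the Hölder condition in t. -/
theorem abs_near_sub_le {d W : ℝ} (hd : 0 < d) (hW : 0 ≤ W) (hμ : 0 < μ) (ht : |t - s| ≤ d / 8)
    (H : ∀ p q, |p - s| ≤ d / 2 → |q - s| ≤ d / 2 → |f p - f q| ≤ W * (|p - q| / d) ^ μ) (u : ℝ) :
    |(f (t + u) - f t) * (cutoff (d / 4) u / u) - (f (s + u) - f s) * (cutoff (d / 4) u / u)| ≤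
      2 * W * (|t - s| / d) ^ (μ / 2) * d ^ (-(μ / 2)) * nearBound (d / 4) (μ / 2) u := by
  rw [← sub_mul, abs_mul]
  rcases le_or_gt (d / 4) |u| with hu | hu
  · rw [cutoff_eq_zero (by positivity) hu, zero_div, abs_zero, mul_zero]
    have := nearBound_nonneg (D := d / 4) (μ := μ / 2) u
    positivity
  rcases eq_or_ne u 0 with rfl | hu0
  · simp only [div_zero, abs_zero, mul_zero]
    have := nearBound_nonneg (D := d / 4) (μ := μ / 2) 0
    positivity
  have hu1 : 0 < |u| := abs_pos.2 hu0
  have p1 : |s + u - s| ≤ d / 2 := by rw [add_sub_cancel_left]; linarith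
  have p2 : |t + u - s| ≤ d / 2 := by
    rw [add_sub_right_comm]; exact (abs_add_le _ _).trans (by linarith)
  have p3 : |s - s| ≤ d / 2 := by simp; linarith
  have p4 : |t - s| ≤ d / 2 := by linarith
  have e1 := H _ _ p2 p4
  have e2 := H _ _ p1 p3
  have e3 := H _ _ p2 p1
  have e4 := H _ _ p4 p3
  rw [add_sub_cancel_left] at e1 e2
  rw [add_sub_add_right_eq_sub] at e3
  have b1 : |f (t + u) - f t - (f (s + u) - f s)| ≤ 2 * W * (|u| / d) ^ μ :=
    (abs_sub _ _).trans (by linarith)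
  have b2 : |f (t + u) - f t - (f (s + u) - f s)| ≤ 2 * W * (|t - s| / d) ^ μ := by
    rw [sub_sub_sub_comm]
    exact (abs_sub _ _).trans (by linarith)
  have b3 : |f (t + u) - f t - (f (s + u) - f s)| ≤
      2 * W * ((|t - s| / d) ^ (μ / 2) * (|u| / d) ^ (μ / 2)) := by
    refine (le_min b1 b2).trans ?_
    rw [← mul_min_of_nonneg _ _ (by positivity)]
    exact mul_le_mul_of_nonneg_left (min_rpow_le (by positivity) (by positivity) hμ)
      (by positivity)
  have hk : |cutoff (d / 4) u / u| ≤ 1 / |u| := by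
    rw [abs_div]
    gcongr
    exact abs_cutoff_le_one u
  calc _ ≤ 2 * W * ((|t - s| / d) ^ (μ / 2) * (|u| / d) ^ (μ / 2)) * (1 / |u|) :=
        mul_le_mul b3 hk (abs_nonneg _) (by positivity)
    _ = _ := by
      rw [nearBound, indicator_of_mem (mem_Iic.2 hu.le), rpow_sub_one hu1.ne',
        div_rpow (abs_nonneg _) hd.le (μ / 2), div_rpow (abs_nonneg _) hd.le (μ / 2),
        rpow_neg hd.le]
      ring

theorem abs_far_sub_le (hD : 0 < D) (hf : IntegrableOn f (Ioo a b)) :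
    |(∫ r in Ioo a b, f r * farKernel D (r - t)) - ∫ r in Ioo a b, f r * farKernel D (r - s)| ≤
      3 * |t - s| / D * ∫ r in Ioo a b, |f r| / max D |r - s| := by
  rw [← integral_sub (integrableOn_far hD hf) (integrableOn_far hD hf), ← integral_const_mul,
    ← norm_eq_abs]
  refine norm_integral_le_of_norm_le ((integrableOn_div_max hD hf).const_mul _)
    (Eventually.of_forall fun r => ?_)
  rw [← mul_sub, norm_mul, norm_eq_abs, norm_eq_abs, abs_sub_comm (farKernel D (r - t))]
  have h := abs_farKernel_sub_le hD (r - s) (r - t)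
  rw [sub_sub_sub_cancel_left] at h
  have hm : 0 < max D |r - s| := lt_max_of_lt_left hD
  calc _ ≤ |f r| * (3 * |t - s| / (D * max D |r - s|)) :=
        mul_le_mul_of_nonneg_left h (abs_nonneg _)
    _ = _ := by field_simp

/-- The finite Hilbert transform preserves weighted Hölder classes up to an arbitrarily small loss
in the exponents. -/
theorem WeightedHolder.hilbert (hf : WeightedHolder a b γ δ f) (hγ : γ < γ') (hδ : δ < δ')
    (h0γ : 0 ≤ γ') (h0δ : 0 ≤ δ') (h1γ : γ' ≤ 1) (h1δ : δ' ≤ 1) :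
    WeightedHolder a b γ' δ' (hilbert a b f) := by
  have hint := hf.integrableOn (by linarith) (by linarith)
  obtain ⟨C, hC, hCb⟩ := hf.abs_truncHilbert_le hγ hδ h0γ h0δ h1γ h1δ
  obtain ⟨C₁, hC₁, h₁⟩ := hf.integral_div_max_le hγ hδ h0γ h0δ h1γ h1δ
  obtain ⟨C₂, hC₂, h₂⟩ := edgeWeight_mono (a := a) (b := b) hγ.le hδ.le
  obtain ⟨M, μ, hM, hμ, hμ1, H⟩ := hf.holderAt
  -- The three summands bound the size of H[f], the near difference and the far difference; 12 is
  -- the 3 of the far kernel divided by the cutoff radius factor 1/4.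
  refine WeightedHolder.of_local (M := C + 2 * M * C₂ * (2 / (μ / 2)) + 12 * C₁) (μ := μ / 2)
    (by positivity) (by positivity) (by linarith) (fun s hs => ?_) (fun s hs t _ hst => ?_)
  · have hw := (edgeWeight_pos (γ := γ') (δ := δ') hs).le
    have h3 : |_root_.hilbert a b f s| ≤ C * edgeWeight a b γ' δ' s := by
      refine le_of_tendsto (hf.hilbertExists (by linarith) (by linarith) hs).tendsto.abs ?_
      filter_upwards [self_mem_nhdsWithin] with ε hε using hCb s hs ε hε
    have : 0 ≤ (2 * M * C₂ * (2 / (μ / 2)) + 12 * C₁) * edgeWeight a b γ' δ' s := by positivity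
    linarith
  · have hw := (edgeWeight_pos (γ := γ) (δ := δ) hs).le
    have hw' := (edgeWeight_pos (γ := γ') (δ := δ') hs).le
    have hd := edgeDist_pos hs
    obtain ⟨Hs, Ht⟩ := H s hs
    have hs0 := Ht s (by simp; linarith)
    have ht0 := Ht t hst
    rw [hs0.hilbert_eq_near_add_far hint, ht0.hilbert_eq_near_add_far hint, ← mul_sub,
      add_sub_add_comm, abs_mul, abs_of_pos (by positivity : 0 < 1 / π)]
    set R := (|t - s| / edgeDist a b s) ^ (μ / 2) with hR
    have hR0 : 0 ≤ R := by positivity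
    have hhR : |t - s| / edgeDist a b s ≤ R := by
      calc |t - s| / edgeDist a b s = (|t - s| / edgeDist a b s) ^ (1 : ℝ) := (rpow_one _).symm
        _ ≤ R := rpow_le_rpow_of_exponent_ge' (by positivity)
          ((div_le_one hd).2 (by linarith)) (by positivity) (by linarith)
    have n1 := norm_integral_le_of_norm_le
      (f := fun u => (f (t + u) - f t) * (cutoff (edgeDist a b s / 4) u / u) -
        (f (s + u) - f s) * (cutoff (edgeDist a b s / 4) u / u))
      ((integrable_nearBound (by positivity : 0 < edgeDist a b s / 4) (half_pos hμ)).const_mul _)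
      (Eventually.of_forall (abs_near_sub_le hd (mul_nonneg hM hw) hμ hst
        fun p q hp hq => (Hs p q hp hq).2))
    rw [integral_sub (ht0.integrable_near_shift hint) (hs0.integrable_near_shift hint),
      integral_const_mul, integral_nearBound (by positivity) (half_pos hμ), norm_eq_abs,
      ← hR] at n1
    have n2 : 2 * (M * edgeWeight a b γ δ s) * R * edgeDist a b s ^ (-(μ / 2)) *
        (2 * ((edgeDist a b s / 4) ^ (μ / 2) / (μ / 2))) ≤
        2 * M * C₂ * (2 / (μ / 2)) * edgeWeight a b γ' δ' s * R := by
      calc _ = 2 * M * R * edgeWeight a b γ δ s * (edgeDist a b s ^ (-(μ / 2)) *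
            (2 * ((edgeDist a b s / 4) ^ (μ / 2) / (μ / 2)))) := by ring
        _ ≤ 2 * M * R * (C₂ * edgeWeight a b γ' δ' s) * (2 / (μ / 2)) := by
          have := h₂ s hs
          have := near_const_le hd (half_pos hμ)
          gcongr
        _ = _ := by ring
    have f1 := abs_far_sub_le (s := s) (t := t) (by positivity : 0 < edgeDist a b s / 4) hint
    have f2 : 3 * |t - s| / (edgeDist a b s / 4) *
        (∫ r in Ioo a b, |f r| / max (edgeDist a b s / 4) |r - s|) ≤
        12 * C₁ * edgeWeight a b γ' δ' s * R := by
      calc _ = 12 * (|t - s| / edgeDist a b s) *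
            ∫ r in Ioo a b, |f r| / max (edgeDist a b s / 4) |r - s| := by
            ring
        _ ≤ 12 * R * (C₁ * edgeWeight a b γ' δ' s) := by
            have := h₁ s hs
            have : 0 ≤ ∫ r in Ioo a b, |f r| / max (edgeDist a b s / 4) |r - s| :=
              integral_nonneg fun r => by positivity
            gcongr
        _ = _ := by ring
    have hpi : 1 / π ≤ 1 := by
      rw [div_le_one pi_pos]; linarith [pi_gt_three]
    refine (mul_le_of_le_one_left (abs_nonneg _) hpi).trans ((abs_add_le _ _).trans ?_)
    have : 0 ≤ C * edgeWeight a b γ' δ' s * R := by positivity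
    linarith [n1.trans n2, f1.trans f2]

end HilbertHolder


/-! ### Boundary values of the Cauchy transform (Plemelj) -/

/-- The Cauchy transform `(1/π) ∫_a^b f(r) / (r - z) dr`. -/
def cauchyTransform (a b : ℝ) (f : ℝ → ℝ) (z : ℂ) : ℂ :=
  (1 / (π : ℂ)) * ∫ r in Ioo a b, (f r : ℂ) / ((r : ℂ) - z)

section Plemelj

variable {a b γ δ γ' δ' s t D A μ M : ℝ} {f g : ℝ → ℝ}

theorem sq_add_sq_pos {ε : ℝ} (hε : 0 < ε) (u : ℝ) : 0 < u ^ 2 + ε ^ 2 := by positivity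

theorem abs_mul_div_sq_add_sq_le {ε : ℝ} (hε : 0 < ε) (u : ℝ) :
    |u * ε / (u ^ 2 + ε ^ 2)| ≤ 1 := by
  rw [abs_div, abs_of_pos (sq_add_sq_pos hε u), div_le_one (sq_add_sq_pos hε u), abs_mul,
    abs_of_pos hε]
  nlinarith [sq_nonneg (|u| - ε), sq_abs u, sq_nonneg u, sq_nonneg ε]

theorem abs_div_sq_add_sq_le {ε : ℝ} (hε : 0 < ε) (u : ℝ) :
    |u / (u ^ 2 + ε ^ 2)| ≤ 1 / ε := by
  have h := abs_mul_div_sq_add_sq_le hε u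
  rw [mul_div_right_comm, abs_mul, abs_of_pos hε] at h
  rwa [le_div_iff₀ hε]

theorem abs_div_sq_add_sq_le' {ε : ℝ} (hε : 0 < ε) (u : ℝ) :
    |ε / (u ^ 2 + ε ^ 2)| ≤ 1 / ε := by
  rw [abs_div, abs_of_pos (sq_add_sq_pos hε u), abs_of_pos hε,
    div_le_div_iff₀ (sq_add_sq_pos hε u) hε]
  nlinarith [sq_nonneg u]

theorem continuous_div_sq_add_sq {φ : ℝ → ℝ} (hφ : Continuous φ) {ε : ℝ} (hε : 0 < ε) :
    Continuous fun u => φ u / (u ^ 2 + ε ^ 2) :=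
  hφ.div (by fun_prop) fun u => (sq_add_sq_pos hε u).ne'

theorem integrableOn_mul_div_sq_add_sq (hf : IntegrableOn f (Ioo a b)) {ε : ℝ} (hε : 0 < ε) :
    IntegrableOn (fun r => f r * ((r - s) / ((r - s) ^ 2 + ε ^ 2))) (Ioo a b) :=
  Integrable.mul_bdd (c := 1 / ε) hf
    ((continuous_div_sq_add_sq continuous_id hε).comp
      (continuous_id.sub continuous_const)).aestronglyMeasurable
    (Eventually.of_forall fun r => abs_div_sq_add_sq_le hε (r - s))

theorem integrableOn_mul_div_sq_add_sq' (hf : IntegrableOn f (Ioo a b)) {ε : ℝ} (hε : 0 < ε) :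
    IntegrableOn (fun r => f r * (ε / ((r - s) ^ 2 + ε ^ 2))) (Ioo a b) :=
  Integrable.mul_bdd (c := 1 / ε) hf
    ((continuous_div_sq_add_sq continuous_const hε).comp
      (continuous_id.sub continuous_const)).aestronglyMeasurable
    (Eventually.of_forall fun r => abs_div_sq_add_sq_le' hε (r - s))

/-- Real and imaginary parts of 1/(r - s - iε) are the conjugate Poisson and the Poisson kernel;
their limits are found separately. -/
theorem cauchyTransform_eq (hf : IntegrableOn f (Ioo a b)) {ε : ℝ} (hε : 0 < ε) :
    cauchyTransform a b f (s + ε * Complex.I) = (1 / (π : ℂ)) *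
      (((∫ r in Ioo a b, f r * ((r - s) / ((r - s) ^ 2 + ε ^ 2)) : ℝ) : ℂ) +
        ((∫ r in Ioo a b, f r * (ε / ((r - s) ^ 2 + ε ^ 2)) : ℝ) : ℂ) * Complex.I) := by
  rw [cauchyTransform, ← integral_complex_ofReal, ← integral_complex_ofReal, ← integral_mul_const, ← integral_add]
  · congr 1
    refine integral_congr_ae (Eventually.of_forall fun r => ?_)
    have h1 : (r : ℂ) - (s + ε * Complex.I) ≠ 0 := fun h => by
      have := congrArg Complex.im h
      simp at this
      exact hε.ne' this
    have h2 : ((r : ℂ) - s) ^ 2 + ε ^ 2 ≠ 0 := by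
      exact_mod_cast (sq_add_sq_pos hε (r - s)).ne'
    push_cast
    field_simp
    ring_nf
    simp only [Complex.I_sq]
    ring
  · exact (integrableOn_mul_div_sq_add_sq hf hε).ofReal
  · exact (integrableOn_mul_div_sq_add_sq' hf hε).ofReal.mul_const _

/-- The conjugate Poisson kernel is 1/u times the even multiplier u²/(u² + ε²) ≤ 1. The odd part
cancels as it does for the truncation, and dominated convergence gives the same limit. -/
theorem HolderAt.tendsto_conjugatePoisson (h : HolderAt a b f s D A μ)
    (hf : IntegrableOn f (Ioo a b)) :
    Tendsto (fun ε => ∫ r in Ioo a b, f r * ((r - s) / ((r - s) ^ 2 + ε ^ 2))) (𝓝[>] 0)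
      (𝓝 (∫ r in Ioo a b, pvIntegrand f D s r)) := by
  have hN := h.integrableOn_pvIntegrand hf
  have key : ∀ ε : ℝ, 0 < ε → ∫ r in Ioo a b, f r * ((r - s) / ((r - s) ^ 2 + ε ^ 2)) =
      ∫ r in Ioo a b, pvIntegrand f D s r * ((r - s) ^ 2 / ((r - s) ^ 2 + ε ^ 2)) := by
    intro ε hε
    -- This also holds at u = 0, where division by zero yields 0 on the left.
    have e : ∀ u : ℝ, u ^ 2 / (u ^ 2 + ε ^ 2) / u = u / (u ^ 2 + ε ^ 2) := fun u => by
      rcases eq_or_ne u 0 with rfl | hu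
      · simp
      · field_simp
    have := h.integral_mul_even hf (m := fun u => u ^ 2 / (u ^ 2 + ε ^ 2)) (by simp)
      (continuous_div_sq_add_sq (by fun_prop) hε).measurable (fun u => ?_) ?_
    · simpa only [e] using this
    · rw [abs_of_nonneg (by positivity), div_le_one (sq_add_sq_pos hε u)]
      linarith [sq_nonneg ε]
    · simp only [e]
      exact integrableOn_mul_div_sq_add_sq hf hε
  have hlim : Tendsto (fun ε => ∫ r in Ioo a b, pvIntegrand f D s r *
      ((r - s) ^ 2 / ((r - s) ^ 2 + ε ^ 2))) (𝓝[>] 0)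
      (𝓝 (∫ r in Ioo a b, pvIntegrand f D s r)) := by
    refine tendsto_integral_filter_of_dominated_convergence (fun r => |pvIntegrand f D s r|)
      ?_ ?_ hN.abs ?_
    · filter_upwards [self_mem_nhdsWithin] with ε hε
      exact hN.1.mul ((continuous_div_sq_add_sq (φ := fun u => u ^ 2) (by fun_prop) hε).comp
        (continuous_id.sub continuous_const)).aestronglyMeasurable
    · refine Eventually.of_forall fun ε => Eventually.of_forall fun r => ?_
      rw [norm_mul, norm_eq_abs]
      refine mul_le_of_le_one_right (abs_nonneg _) ?_
      rw [norm_of_nonneg (by positivity)]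
      exact div_le_one_of_le₀ (by linarith [sq_nonneg ε]) (by positivity)
    · refine Eventually.of_forall fun r => ?_
      rcases eq_or_ne (r - s) 0 with h0 | h0
      · simp [pvIntegrand, h0]
      · have hc : ContinuousAt (fun ε : ℝ => pvIntegrand f D s r *
            ((r - s) ^ 2 / ((r - s) ^ 2 + ε ^ 2))) 0 := by
          refine continuousAt_const.mul (ContinuousAt.div continuousAt_const (by fun_prop) ?_)
          positivity
        have := hc.tendsto
        have e : (r - s) ^ 2 / ((r - s) ^ 2 + 0 ^ 2) = 1 := by
          field_simp; simp
        rw [e, mul_one] at this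
        exact this.mono_left nhdsWithin_le_nhds
  refine hlim.congr' ?_
  filter_upwards [self_mem_nhdsWithin] with ε hε using (key ε hε).symm

/-- After the substitution u = εv the cutoff tends pointwise to 1 and ∫ dv/(1 + v²) = π remains. -/
theorem tendsto_integral_cutoff_poisson :
    Tendsto (fun ε : ℝ => ∫ u, cutoff D u * (ε / (u ^ 2 + ε ^ 2))) (𝓝[>] 0) (𝓝 π) := by
  have hlim : Tendsto (fun ε : ℝ => ∫ v : ℝ, cutoff D (ε * v) * (1 + v ^ 2)⁻¹) (𝓝[>] 0)
      (𝓝 (∫ v : ℝ, (1 + v ^ 2)⁻¹)) := by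
    refine tendsto_integral_filter_of_dominated_convergence (fun v => (1 + v ^ 2)⁻¹)
      (Eventually.of_forall fun ε => ?_) (Eventually.of_forall fun ε => Eventually.of_forall
        fun v => ?_) integrable_inv_one_add_sq (Eventually.of_forall fun v => ?_)
    · exact ((continuous_cutoff.comp (by fun_prop)).aestronglyMeasurable).mul
        integrable_inv_one_add_sq.1
    · rw [norm_mul, norm_of_nonneg (by positivity : (0 : ℝ) ≤ (1 + v ^ 2)⁻¹)]
      exact mul_le_of_le_one_left (by positivity) (abs_cutoff_le_one _)
    · have hc : Continuous fun ε : ℝ => cutoff D (ε * v) * (1 + v ^ 2)⁻¹ :=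
        (continuous_cutoff.comp (by fun_prop)).mul continuous_const
      have := hc.tendsto 0
      rw [zero_mul, cutoff_zero, one_mul] at this
      exact this.mono_left nhdsWithin_le_nhds
  rw [integral_univ_inv_one_add_sq] at hlim
  refine hlim.congr' ?_
  filter_upwards [self_mem_nhdsWithin] with ε (hε : 0 < ε)
  have h := Measure.integral_comp_mul_left (fun u => cutoff D u * (ε / (u ^ 2 + ε ^ 2))) ε
  rw [abs_of_pos (inv_pos.2 hε), smul_eq_mul, eq_inv_mul_iff_mul_eq₀ hε.ne'] at h
  rw [← h, ← integral_const_mul]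
  refine integral_congr_ae (Eventually.of_forall fun v => ?_)
  have : 1 + v ^ 2 ≠ 0 := by positivity
  have : (ε * v) ^ 2 + ε ^ 2 ≠ 0 := by positivity
  simp only
  field_simp
  ring

theorem HolderAt.tendsto_poisson (h : HolderAt a b f s D A μ)
    (hf : IntegrableOn f (Ioo a b)) :
    Tendsto (fun ε => ∫ r in Ioo a b, f r * (ε / ((r - s) ^ 2 + ε ^ 2))) (𝓝[>] 0)
      (𝓝 (π * f s)) := by
  have hN := h.integrableOn_pvIntegrand hf
  have hNm : ∀ ε : ℝ, 0 < ε → AEStronglyMeasurable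
      (fun r => pvIntegrand f D s r * ((r - s) * ε / ((r - s) ^ 2 + ε ^ 2)))
      (volume.restrict (Ioo a b)) := fun ε hε =>
    hN.1.mul ((continuous_div_sq_add_sq (φ := fun u => u * ε) (by fun_prop) hε).comp
        (continuous_id.sub continuous_const)).aestronglyMeasurable
  have hNb : ∀ ε : ℝ, 0 < ε → ∀ r, ‖pvIntegrand f D s r * ((r - s) * ε / ((r - s) ^ 2 + ε ^ 2))‖ ≤
      |pvIntegrand f D s r| := fun ε hε r => by
    rw [norm_mul]
    exact mul_le_of_le_one_right (abs_nonneg _) (abs_mul_div_sq_add_sq_le hε _)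
  -- Here f is split as (r - s) times the principal value integrand plus f(s) times the cutoff. The
  -- first piece is damped by uε/(u² + ε²), which is bounded by 1 and tends to 0; the second is an
  -- approximate identity.
  have key : ∀ ε : ℝ, 0 < ε → ∫ r in Ioo a b, f r * (ε / ((r - s) ^ 2 + ε ^ 2)) =
      (∫ r in Ioo a b, pvIntegrand f D s r * ((r - s) * ε / ((r - s) ^ 2 + ε ^ 2))) +
        f s * ∫ u, cutoff D u * (ε / (u ^ 2 + ε ^ 2)) := by
    intro ε hε
    have e : ∀ r, f r * (ε / ((r - s) ^ 2 + ε ^ 2)) -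
        pvIntegrand f D s r * ((r - s) * ε / ((r - s) ^ 2 + ε ^ 2)) =
        f s * (cutoff D (r - s) * (ε / ((r - s) ^ 2 + ε ^ 2))) := fun r => by
      rcases eq_or_ne (r - s) 0 with h0 | h0
      · rw [h0, cutoff_zero, sub_eq_zero.1 h0]; simp
      · rw [pvIntegrand]; field_simp; ring
    have hI : IntegrableOn (fun r => pvIntegrand f D s r *
        ((r - s) * ε / ((r - s) ^ 2 + ε ^ 2))) (Ioo a b) :=
      Integrable.mono' hN.abs (hNm ε hε) (Eventually.of_forall fun r => hNb ε hε r)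
    rw [← sub_eq_iff_eq_add', ← integral_sub (integrableOn_mul_div_sq_add_sq' hf hε) hI]
    simp only [e]
    rw [setIntegral_eq_integral_of_forall_compl_eq_zero fun r hr => ?_, integral_const_mul,
      integral_sub_right_eq_self (fun u => cutoff D u * (ε / (u ^ 2 + ε ^ 2)))]
    rw [cutoff_eq_zero h.pos (le_of_not_ge fun hr' => hr (h.mem_Ioo hr'))]
    ring
  have hlim : Tendsto (fun ε => ∫ r in Ioo a b, pvIntegrand f D s r *
      ((r - s) * ε / ((r - s) ^ 2 + ε ^ 2))) (𝓝[>] 0) (𝓝 (∫ r in Ioo a b, (0 : ℝ))) := by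
    refine tendsto_integral_filter_of_dominated_convergence (fun r => |pvIntegrand f D s r|)
      ?_ ?_ hN.abs ?_
    · filter_upwards [self_mem_nhdsWithin] with ε hε using hNm ε hε
    · filter_upwards [self_mem_nhdsWithin] with ε hε
      exact Eventually.of_forall fun r => hNb ε hε r
    · refine Eventually.of_forall fun r => ?_
      rcases eq_or_ne (r - s) 0 with h0 | h0
      · simp [h0]
      · have hc : ContinuousAt (fun ε : ℝ => pvIntegrand f D s r *
            ((r - s) * ε / ((r - s) ^ 2 + ε ^ 2))) 0 := by
          refine continuousAt_const.mul (ContinuousAt.div (by fun_prop) (by fun_prop) ?_)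
          positivity
        have := hc.tendsto
        rw [mul_zero, zero_div, mul_zero] at this
        exact this.mono_left nhdsWithin_le_nhds
  rw [integral_zero] at hlim
  have h2 := hlim.add ((tendsto_integral_cutoff_poisson (D := D)).const_mul (f s))
  rw [zero_add, mul_comm] at h2
  refine h2.congr' ?_
  filter_upwards [self_mem_nhdsWithin] with ε hε using (key ε hε).symm

/-- The Plemelj formula for the limit of the Cauchy transform from above. -/
theorem WeightedHolder.tendsto_cauchyTransform (hf : WeightedHolder a b γ δ f) (hγ : γ < 1)
    (hδ : δ < 1) (hs : s ∈ Ioo a b) :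
    Tendsto (fun ε : ℝ => cauchyTransform a b f (s + ε * Complex.I)) (𝓝[>] 0)
      (𝓝 (_root_.hilbert a b f s + f s * Complex.I)) := by
  obtain ⟨A, μ, h⟩ := hf.holderAt_self hs
  have hint := hf.integrableOn hγ hδ
  have h1 := (Complex.continuous_ofReal.tendsto _).comp (h.tendsto_conjugatePoisson hint)
  have h2 := (Complex.continuous_ofReal.tendsto _).comp (h.tendsto_poisson hint)
  have h3 := (h1.add (h2.mul_const Complex.I)).const_mul (1 / (π : ℂ))
  have e : (1 / (π : ℂ)) * (((∫ r in Ioo a b, pvIntegrand f (edgeDist a b s / 4) s r : ℝ) : ℂ) +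
      ((π * f s : ℝ) : ℂ) * Complex.I) = _root_.hilbert a b f s + f s * Complex.I := by
    rw [h.hilbert_eq hint]
    have : (π : ℂ) ≠ 0 := by exact_mod_cast pi_ne_zero
    push_cast
    field_simp
  rw [e] at h3
  refine h3.congr' ?_
  filter_upwards [self_mem_nhdsWithin] with ε hε
  exact (cauchyTransform_eq hint hε).symm

end Plemelj


/-! ### Products of Cauchy transforms and Tricomi's formula -/

/-- The truncated Hilbert kernel `u⁻¹` on `{ε < |u|}`. -/
def truncKernel (ε u : ℝ) : ℝ := {u : ℝ | ε < |u|}.indicator (fun u => u⁻¹) u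

section Product

variable {a b γ δ γ' δ' γ₁ δ₁ γ₂ δ₂ s t ε : ℝ} {f g : ℝ → ℝ} {z : ℂ}

theorem measurable_truncKernel : Measurable (truncKernel ε) :=
  measurable_inv.indicator (measurableSet_lt measurable_const (by fun_prop))

theorem truncKernel_neg (u : ℝ) : truncKernel ε (-u) = -truncKernel ε u := by
  by_cases h : ε < |u| <;> simp [truncKernel, indicator, h, inv_neg]

theorem abs_truncKernel_le (hε : 0 < ε) (u : ℝ) : |truncKernel ε u| ≤ 1 / ε := by
  by_cases h : ε < |u|
  · rw [truncKernel, indicator_of_mem (by exact h), abs_inv, ← one_div]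
    exact one_div_le_one_div_of_le hε h.le
  · rw [truncKernel, indicator_of_notMem (by exact h), abs_zero]
    positivity

theorem integral_mul_truncKernel (f : ℝ → ℝ) (s ε : ℝ) :
    ∫ r in Ioo a b, f r * truncKernel ε (r - s) = π * truncHilbert a b f s ε := by
  have e : ∀ r, f r * truncKernel ε (r - s) =
      {r | ε < |r - s|}.indicator (fun r => f r / (r - s)) r := fun r => by
    by_cases h : ε < |r - s|
    · rw [truncKernel, indicator_of_mem (by exact h), indicator_of_mem (by exact h), div_eq_mul_inv]
    · rw [truncKernel, indicator_of_notMem (by exact h), indicator_of_notMem (by exact h), mul_zero]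
  simp only [e]
  rw [setIntegral_indicator (measurableSet_trunc s ε), truncHilbert, setOf_trunc, ← mul_assoc,
    mul_one_div_cancel pi_ne_zero, one_mul]

theorem sub_ne_zero_of_im (hz : z.im ≠ 0) (r : ℝ) : (r : ℂ) - z ≠ 0 := fun h => by
  have := congrArg Complex.im h
  simp at this
  exact hz this

theorem norm_inv_sub_le (hz : z.im ≠ 0) (r : ℝ) : ‖((r : ℂ) - z)⁻¹‖ ≤ 1 / |z.im| := by
  rw [norm_inv, ← one_div]
  refine one_div_le_one_div_of_le (abs_pos.2 hz) ?_
  simpa using Complex.abs_im_le_norm ((r : ℂ) - z)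

theorem continuous_inv_sub (hz : z.im ≠ 0) : Continuous fun r : ℝ => ((r : ℂ) - z)⁻¹ :=
  Continuous.inv₀ (by fun_prop) (sub_ne_zero_of_im hz)

theorem integrableOn_div_sub (hf : IntegrableOn f (Ioo a b)) (hz : z.im ≠ 0) :
    IntegrableOn (fun r => (f r : ℂ) / ((r : ℂ) - z)) (Ioo a b) := by
  simp only [div_eq_mul_inv]
  exact Integrable.mul_bdd (c := 1 / |z.im|) hf.ofReal (continuous_inv_sub hz).aestronglyMeasurable
    (Eventually.of_forall fun r => norm_inv_sub_le hz r)

theorem ae_ne_prod : ∀ᵐ p : ℝ × ℝ ∂((volume.restrict (Ioo a b)).prod (volume.restrict (Ioo a b))),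
    p.1 ≠ p.2 := by
  have hm : MeasurableSet {p : ℝ × ℝ | p.1 = p.2} := measurableSet_eq_fun measurable_fst
    measurable_snd
  have := (Measure.measure_prod_null (μ := volume.restrict (Ioo a b))
    (ν := volume.restrict (Ioo a b)) hm).2 (Eventually.of_forall fun x => by
      have : Prod.mk x ⁻¹' {p : ℝ × ℝ | p.1 = p.2} = {x} := by
        ext y; simp [eq_comm]
      simp only [this, Pi.zero_apply]; simp)
  simpa [ae_iff] using this

theorem integrable_prod_mul_truncKernel {F G : ℝ → ℂ} (hF : IntegrableOn F (Ioo a b))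
    (hG : IntegrableOn G (Ioo a b)) (hε : 0 < ε) :
    Integrable (fun p : ℝ × ℝ => F p.1 * G p.2 * (truncKernel ε (p.2 - p.1) : ℂ))
      ((volume.restrict (Ioo a b)).prod (volume.restrict (Ioo a b))) := by
  refine Integrable.mul_bdd (c := 1 / ε) (hF.mul_prod hG) ?_ (Eventually.of_forall fun p => ?_)
  · exact (Complex.measurable_ofReal.comp
      (measurable_truncKernel.comp (measurable_snd.sub measurable_fst))).aestronglyMeasurable
  · rw [Complex.norm_real]
    exact abs_truncKernel_le hε _

/-- Measurability in s comes from Fubini, as a partial integral of an integrable function of two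
variables. -/
theorem aestronglyMeasurable_truncHilbert (hf : IntegrableOn f (Ioo a b)) (hε : 0 < ε) :
    AEStronglyMeasurable (fun s => (truncHilbert a b f s ε : ℂ)) (volume.restrict (Ioo a b)) := by
  have h1 := (integrable_prod_mul_truncKernel (a := a) (b := b) (F := fun _ => 1)
    (G := fun r => (f r : ℂ)) (by simp) hf.ofReal hε).integral_prod_left.1
  have e : ∀ s, (truncHilbert a b f s ε : ℂ) = (1 / (π : ℂ)) *
      ∫ r in Ioo a b, 1 * (f r : ℂ) * (truncKernel ε (r - s) : ℂ) := fun s => by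
    have h2 := integral_mul_truncKernel (a := a) (b := b) f s ε
    have h3 : ∫ r in Ioo a b, 1 * (f r : ℂ) * (truncKernel ε (r - s) : ℂ) =
        ((∫ r in Ioo a b, f r * truncKernel ε (r - s) : ℝ) : ℂ) := by
      rw [← integral_complex_ofReal]
      simp
    have : (π : ℂ) ≠ 0 := by exact_mod_cast pi_ne_zero
    rw [h3, h2]
    push_cast
    field_simp
  simp only [e]
  exact h1.const_mul _

theorem integral_prod_truncKernel (hg : IntegrableOn g (Ioo a b)) {F : ℝ → ℂ}
    (hF : IntegrableOn F (Ioo a b)) (hε : 0 < ε) :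
    ∫ p : ℝ × ℝ, F p.1 * (g p.2 : ℂ) * (truncKernel ε (p.2 - p.1) : ℂ)
      ∂((volume.restrict (Ioo a b)).prod (volume.restrict (Ioo a b))) =
      π * ∫ r in Ioo a b, F r * (truncHilbert a b g r ε : ℂ) := by
  have hg' : IntegrableOn (fun r => (g r : ℂ)) (Ioo a b) := hg.ofReal
  rw [integral_prod _ (integrable_prod_mul_truncKernel hF hg' hε), ← integral_const_mul]
  refine integral_congr_ae (Eventually.of_forall fun r => ?_)
  simp only
  simp_rw [mul_assoc]
  rw [integral_const_mul]
  have h2 := integral_mul_truncKernel (a := a) (b := b) g r ε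
  have h3 : ∫ t in Ioo a b, (g t : ℂ) * (truncKernel ε (t - r) : ℂ) =
      ((∫ t in Ioo a b, g t * truncKernel ε (t - r) : ℝ) : ℂ) := by
    rw [← integral_complex_ofReal]
    simp
  rw [h3, h2]
  push_cast
  ring

/-- Partial fractions: 1/((r - z)(t - z)) = (1/(t - r)) (1/(r - z) - 1/(t - z)). Off the strip |t -
r| ≤ ε both terms are integrable in (r, t), so Fubini applies to each; the singular kernel never has
its order of integration exchanged. -/
theorem integral_prod_trunc (hf : IntegrableOn f (Ioo a b)) (hg : IntegrableOn g (Ioo a b))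
    (hz : z.im ≠ 0) (hε : 0 < ε) :
    ∫ p : ℝ × ℝ, {p : ℝ × ℝ | ε < |p.2 - p.1|}.indicator
      (fun p => (f p.1 : ℂ) / ((p.1 : ℂ) - z) * ((g p.2 : ℂ) / ((p.2 : ℂ) - z))) p
      ∂((volume.restrict (Ioo a b)).prod (volume.restrict (Ioo a b))) =
      π * (∫ r in Ioo a b, (f r : ℂ) / ((r : ℂ) - z) * (truncHilbert a b g r ε : ℂ)) +
        π * ∫ r in Ioo a b, (g r : ℂ) / ((r : ℂ) - z) * (truncHilbert a b f r ε : ℂ) := by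
  have hF := integrableOn_div_sub hf hz
  have hG := integrableOn_div_sub hg hz
  have hf' : IntegrableOn (fun r => (f r : ℂ)) (Ioo a b) := hf.ofReal
  have hg' : IntegrableOn (fun r => (g r : ℂ)) (Ioo a b) := hg.ofReal
  have i1 := integrable_prod_mul_truncKernel hF hg' hε
  have i2 := (integrable_prod_mul_truncKernel hG hf' hε).swap
  simp only [Function.comp_def] at i2
  -- The second double integral has its variables swapped, so that both are over the same pair (r,
  -- t); the oddness of the kernel then supplies the minus sign of the partial fraction.
  rw [← integral_prod_truncKernel hg hF hε, ← integral_prod_truncKernel hf hG hε,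
    ← integral_prod_swap (fun p : ℝ × ℝ => (g p.1 : ℂ) / ((p.1 : ℂ) - z) * (f p.2 : ℂ) *
      (truncKernel ε (p.2 - p.1) : ℂ)), ← integral_add i1 i2]
  · refine integral_congr_ae (Eventually.of_forall fun p => ?_)
    have h1 := sub_ne_zero_of_im hz p.1
    have h2 := sub_ne_zero_of_im hz p.2
    simp only [Prod.fst_swap, Prod.snd_swap]
    rw [← neg_sub p.2 p.1, truncKernel_neg]
    by_cases h : ε < |p.2 - p.1|
    · have h0 : (p.2 : ℂ) - p.1 ≠ 0 := by
        have : p.2 - p.1 ≠ 0 := abs_pos.1 (hε.trans h)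
        exact_mod_cast this
      rw [indicator_of_mem (by exact h), truncKernel, indicator_of_mem (by exact h)]
      push_cast
      field_simp
      ring
    · rw [indicator_of_notMem (by exact h), truncKernel, indicator_of_notMem (by exact h)]
      simp

/-- The removed strip shrinks to the diagonal, a null set, and the untruncated integrand is
integrable on the square. -/
theorem tendsto_integral_prod_trunc (hf : IntegrableOn f (Ioo a b)) (hg : IntegrableOn g (Ioo a b))
    (hz : z.im ≠ 0) :
    Tendsto (fun ε : ℝ => ∫ p : ℝ × ℝ, {p : ℝ × ℝ | ε < |p.2 - p.1|}.indicator
      (fun p => (f p.1 : ℂ) / ((p.1 : ℂ) - z) * ((g p.2 : ℂ) / ((p.2 : ℂ) - z))) p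
      ∂((volume.restrict (Ioo a b)).prod (volume.restrict (Ioo a b)))) (𝓝[>] 0)
      (𝓝 ((∫ r in Ioo a b, (f r : ℂ) / ((r : ℂ) - z)) *
        ∫ r in Ioo a b, (g r : ℂ) / ((r : ℂ) - z))) := by
  have hFG := (integrableOn_div_sub hf hz).mul_prod (integrableOn_div_sub hg hz)
  rw [← integral_prod_mul]
  refine tendsto_integral_filter_of_dominated_convergence _
    (Eventually.of_forall fun ε => hFG.1.indicator
      (measurableSet_lt measurable_const (by fun_prop)))
    (Eventually.of_forall fun ε => Eventually.of_forall fun r => norm_indicator_le_norm_self _ _)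
    hFG.norm ?_
  filter_upwards [ae_ne_prod] with p hp
  have h0 : 0 < |p.2 - p.1| := abs_pos.2 (sub_ne_zero.2 hp.symm)
  refine tendsto_const_nhds.congr' ?_
  filter_upwards [mem_nhdsWithin_of_mem_nhds (Iio_mem_nhds h0)] with ε hε
  rw [indicator_of_mem (by exact hε)]

/-- The exponents for which `f * H[g]` is of integrable type. -/
theorem exists_exponent (hγ₁ : γ₁ + max γ₂ 0 < 1) (hγ₂ : γ₂ < 1) :
    ∃ γ', γ₂ < γ' ∧ 0 ≤ γ' ∧ γ' ≤ 1 ∧ γ₁ + γ' < 1 := by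
  obtain ⟨γ', h1, h2⟩ := exists_between
    (lt_min (max_lt hγ₂ one_pos) (by linarith : max γ₂ 0 < 1 - γ₁))
  rw [max_lt_iff] at h1
  rw [lt_min_iff] at h2
  exact ⟨γ', h1.1, h1.2.le, h2.1.le, by linarith⟩

theorem WeightedHolder.mul_hilbert (hf : WeightedHolder a b γ₁ δ₁ f)
    (hg : WeightedHolder a b γ₂ δ₂ g) (hγ : γ₁ + max γ₂ 0 < 1) (hγ₂ : γ₂ < 1)
    (hδ : δ₁ + max δ₂ 0 < 1) (hδ₂ : δ₂ < 1) :
    ∃ γ δ, γ < 1 ∧ δ < 1 ∧ WeightedHolder a b γ δ (fun s => f s * _root_.hilbert a b g s) := by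
  obtain ⟨γ', h1, h2, h3, h4⟩ := exists_exponent hγ hγ₂
  obtain ⟨δ', k1, k2, k3, k4⟩ := exists_exponent hδ hδ₂
  exact ⟨_, _, h4, k4, hf.mul (hg.hilbert h1 k1 h2 k2 h3 k3)⟩

theorem WeightedHolder.tendsto_integral_truncHilbert (hf : WeightedHolder a b γ₁ δ₁ f)
    (hg : WeightedHolder a b γ₂ δ₂ g) (hγ : γ₁ + max γ₂ 0 < 1) (hγ₂ : γ₂ < 1)
    (hδ : δ₁ + max δ₂ 0 < 1) (hδ₂ : δ₂ < 1) (hz : z.im ≠ 0) :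
    Tendsto (fun ε => ∫ r in Ioo a b, (f r : ℂ) / ((r : ℂ) - z) * (truncHilbert a b g r ε : ℂ))
      (𝓝[>] 0) (𝓝 (∫ r in Ioo a b,
        ((f r * _root_.hilbert a b g r : ℝ) : ℂ) / ((r : ℂ) - z))) := by
  obtain ⟨γ', h1, h2, h3, h4⟩ := exists_exponent hγ hγ₂
  obtain ⟨δ', k1, k2, k3, k4⟩ := exists_exponent hδ hδ₂
  obtain ⟨C, hC, hCb⟩ := hg.abs_truncHilbert_le h1 k1 h2 k2 h3 k3
  have hfi := hf.integrableOn (by linarith [le_max_right γ₂ 0]) (by linarith [le_max_right δ₂ 0])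
  have hgi := hg.integrableOn hγ₂ hδ₂
  -- The truncated transforms of g are bounded by one weight for all ε, and the hypotheses on the
  -- exponents say exactly that f times such a weight can be made integrable.
  have hbound : IntegrableOn (fun r => |f r * edgeWeight a b γ' δ' r| * (1 / |z.im| * C))
      (Ioo a b) := ((hf.mul weightedHolder_edgeWeight).integrableOn h4 k4).abs.mul_const _
  refine tendsto_integral_filter_of_dominated_convergence _ ?_ ?_ hbound ?_
  · filter_upwards [self_mem_nhdsWithin] with ε hε
    exact (integrableOn_div_sub hfi hz).1.mul (aestronglyMeasurable_truncHilbert hgi hε)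
  · filter_upwards [self_mem_nhdsWithin] with ε hε
    filter_upwards [ae_restrict_mem measurableSet_Ioo] with r hr
    have hw := edgeWeight_pos (γ := γ') (δ := δ') hr
    rw [norm_mul, div_eq_mul_inv, norm_mul, Complex.norm_real, Complex.norm_real, norm_eq_abs,
      norm_eq_abs, abs_mul, abs_of_pos hw]
    calc |f r| * ‖((r : ℂ) - z)⁻¹‖ * |truncHilbert a b g r ε|
        ≤ |f r| * (1 / |z.im|) * (C * edgeWeight a b γ' δ' r) := by
          have := norm_inv_sub_le hz r
          have := hCb r hr ε hε
          gcongr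
      _ = _ := by ring
  · filter_upwards [ae_restrict_mem measurableSet_Ioo] with r hr
    have h5 := (Complex.continuous_ofReal.tendsto _).comp
      (hg.hilbertExists hγ₂ hδ₂ hr).tendsto
    have h6 := h5.const_mul ((f r : ℂ) / ((r : ℂ) - z))
    have e : ((f r * _root_.hilbert a b g r : ℝ) : ℂ) / ((r : ℂ) - z) =
        (f r : ℂ) / ((r : ℂ) - z) * (_root_.hilbert a b g r : ℂ) := by
      push_cast; ring
    rw [e]
    exact h6

/-- The product of two Cauchy transforms is a Cauchy transform. -/
theorem WeightedHolder.cauchyTransform_mul (hf : WeightedHolder a b γ₁ δ₁ f)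
    (hg : WeightedHolder a b γ₂ δ₂ g) (hγ : γ₁ + max γ₂ 0 < 1) (hγ' : γ₂ + max γ₁ 0 < 1)
    (hδ : δ₁ + max δ₂ 0 < 1) (hδ' : δ₂ + max δ₁ 0 < 1) (hz : z.im ≠ 0) :
    cauchyTransform a b f z * cauchyTransform a b g z = cauchyTransform a b
      (fun r => f r * _root_.hilbert a b g r + g r * _root_.hilbert a b f r) z := by
  have g1 : γ₁ < 1 := by linarith [le_max_right γ₂ 0]
  have g2 : γ₂ < 1 := by linarith [le_max_right γ₁ 0]
  have d1 : δ₁ < 1 := by linarith [le_max_right δ₂ 0]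
  have d2 : δ₂ < 1 := by linarith [le_max_right δ₁ 0]
  have hfi := hf.integrableOn g1 d1
  have hgi := hg.integrableOn g2 d2
  have L := tendsto_integral_prod_trunc hfi hgi hz
  have R := ((hf.tendsto_integral_truncHilbert hg hγ g2 hδ d2 hz).const_mul (π : ℂ)).add
    ((hg.tendsto_integral_truncHilbert hf hγ' g1 hδ' d1 hz).const_mul (π : ℂ))
  have key := tendsto_nhds_unique L (R.congr' (by
    filter_upwards [self_mem_nhdsWithin] with ε hε
    exact (integral_prod_trunc hfi hgi hz hε).symm))
  obtain ⟨_, _, h1, h2, h3⟩ := hf.mul_hilbert hg hγ g2 hδ d2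
  obtain ⟨_, _, k1, k2, k3⟩ := hg.mul_hilbert hf hγ' g1 hδ' d1
  have hpi : (π : ℂ) ≠ 0 := by exact_mod_cast pi_ne_zero
  simp only [cauchyTransform]
  rw [mul_mul_mul_comm, key, ← mul_add, ← integral_add
    (integrableOn_div_sub (h3.integrableOn h1 h2) hz)
    (integrableOn_div_sub (k3.integrableOn k1 k2) hz)]
  simp only [Complex.ofReal_add, add_div]
  field_simp

theorem WeightedHolder.mul_hilbert_add (hf : WeightedHolder a b γ₁ δ₁ f)
    (hg : WeightedHolder a b γ₂ δ₂ g) (hγ : γ₁ + max γ₂ 0 < 1) (hγ' : γ₂ + max γ₁ 0 < 1)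
    (hδ : δ₁ + max δ₂ 0 < 1) (hδ' : δ₂ + max δ₁ 0 < 1) :
    ∃ γ δ, γ < 1 ∧ δ < 1 ∧ WeightedHolder a b γ δ
      (fun r => f r * _root_.hilbert a b g r + g r * _root_.hilbert a b f r) := by
  obtain ⟨γ, δ, h1, h2, h3⟩ := hf.mul_hilbert hg hγ (by linarith [le_max_right γ₁ 0]) hδ
    (by linarith [le_max_right δ₁ 0])
  obtain ⟨γ', δ', k1, k2, k3⟩ := hg.mul_hilbert hf hγ' (by linarith [le_max_right γ₂ 0]) hδ'
    (by linarith [le_max_right δ₂ 0])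
  exact ⟨max γ γ', max δ δ', max_lt h1 k1, max_lt h2 k2,
    (h3.mono (le_max_left _ _) (le_max_left _ _)).add
      (k3.mono (le_max_right _ _) (le_max_right _ _))⟩

theorem add_mul_I_im_ne_zero (s : ℝ) (hε : 0 < ε) : ((s : ℂ) + ε * Complex.I).im ≠ 0 := by
  simp [hε.ne']

/-- Tricomi's product formula `H[f H[g] + g H[f]] = H[f] H[g] - f g`. -/
theorem WeightedHolder.hilbert_mul_hilbert_add (hf : WeightedHolder a b γ₁ δ₁ f)
    (hg : WeightedHolder a b γ₂ δ₂ g) (hγ : γ₁ + max γ₂ 0 < 1) (hγ' : γ₂ + max γ₁ 0 < 1)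
    (hδ : δ₁ + max δ₂ 0 < 1) (hδ' : δ₂ + max δ₁ 0 < 1) (hs : s ∈ Ioo a b) :
    _root_.hilbert a b (fun r => f r * _root_.hilbert a b g r + g r * _root_.hilbert a b f r) s =
      _root_.hilbert a b f s * _root_.hilbert a b g s - f s * g s := by
  obtain ⟨γ, δ, h1, h2, h3⟩ := hf.mul_hilbert_add hg hγ hγ' hδ hδ'
  have L := (hf.tendsto_cauchyTransform (by linarith [le_max_right γ₂ 0])
    (by linarith [le_max_right δ₂ 0]) hs).mul (hg.tendsto_cauchyTransform
      (by linarith [le_max_right γ₁ 0]) (by linarith [le_max_right δ₁ 0]) hs)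
  have R := h3.tendsto_cauchyTransform h1 h2 hs
  have key := tendsto_nhds_unique R (L.congr' (by
    filter_upwards [self_mem_nhdsWithin] with ε hε
    exact hf.cauchyTransform_mul hg hγ hγ' hδ hδ' (add_mul_I_im_ne_zero s hε)))
  simpa using congrArg Complex.re key

end Product


/-! ### Linearity of the transforms -/

section Linear

variable {a b γ δ γ' δ' s t ε : ℝ} {f g : ℝ → ℝ} {z : ℂ}

theorem truncHilbert_congr (h : EqOn f g (Ioo a b)) : truncHilbert a b f = truncHilbert a b g := by
  funext s ε
  rw [truncHilbert, truncHilbert, setIntegral_congr_fun]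
  · rw [setOf_trunc]
    exact measurableSet_Ioo.inter (measurableSet_trunc s ε)
  · intro r hr
    simp only [h hr.1]

theorem hilbert_congr (h : EqOn f g (Ioo a b)) : hilbert a b f = hilbert a b g := by
  funext s
  rw [hilbert, hilbert, truncHilbert_congr h]

theorem HilbertExists.hilbert_add (hf : HilbertExists a b f s) (hg : HilbertExists a b g s) :
    hilbert a b (fun r => f r + g r) s = hilbert a b f s + hilbert a b g s := by
  refine Tendsto.limUnder_eq ((hf.tendsto.add hg.tendsto).congr' ?_)
  filter_upwards [self_mem_nhdsWithin] with ε hε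
  simp only [truncHilbert, add_div]
  rw [integral_add (hf.1 ε hε) (hg.1 ε hε), mul_add]

theorem HilbertExists.hilbert_const_mul (c : ℝ) (hf : HilbertExists a b f s) :
    hilbert a b (fun r => c * f r) s = c * hilbert a b f s := by
  refine Tendsto.limUnder_eq ((hf.tendsto.const_mul c).congr fun ε => ?_)
  simp only [truncHilbert, mul_div_assoc]
  rw [integral_const_mul]
  ring

theorem HilbertExists.hilbert_neg (hf : HilbertExists a b f s) :
    hilbert a b (fun r => -f r) s = -hilbert a b f s := by
  simpa using hf.hilbert_const_mul (-1)

theorem HilbertExists.hilbert_sub (hf : HilbertExists a b f s) (hg : HilbertExists a b g s) :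
    hilbert a b (fun r => f r - g r) s = hilbert a b f s - hilbert a b g s := by
  refine Tendsto.limUnder_eq ((hf.tendsto.sub hg.tendsto).congr' ?_)
  filter_upwards [self_mem_nhdsWithin] with ε hε
  simp only [truncHilbert, sub_div]
  rw [integral_sub (hf.1 ε hε) (hg.1 ε hε), mul_sub]

theorem cauchyTransform_congr (h : EqOn f g (Ioo a b)) (z : ℂ) :
    cauchyTransform a b f z = cauchyTransform a b g z := by
  rw [cauchyTransform, cauchyTransform, setIntegral_congr_fun measurableSet_Ioo]
  intro r hr
  simp only [h hr]

theorem cauchyTransform_const_mul (c : ℝ) (z : ℂ) :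
    cauchyTransform a b (fun r => c * f r) z = c * cauchyTransform a b f z := by
  simp only [cauchyTransform, Complex.ofReal_mul, mul_div_assoc]
  rw [integral_const_mul]
  ring

end Linear

/-! ### Logarithmic behaviour of H[α] at the endpoints -/

section LogBound

variable {a b s η : ℝ} {α : ℝ → ℝ}

/-- Computed through the conjugate Poisson integral, whose integrand has the smooth antiderivative
log((r - s)² + ε²)/2; no truncation at s is needed. -/
theorem hilbert_one (hs : s ∈ Ioo a b) :
    π * hilbert a b (fun _ => 1) s = log (b - s) - log (s - a) := by
  have h1 : WeightedHolder a b 0 0 (fun _ : ℝ => (1 : ℝ)) := weightedHolder_const 1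
  obtain ⟨A, μ, h⟩ := h1.holderAt_self hs
  have hint := h1.integrableOn one_pos one_pos
  have hab := hs.1.trans hs.2
  rw [h.hilbert_eq hint, ← mul_assoc, mul_one_div_cancel pi_ne_zero, one_mul]
  refine tendsto_nhds_unique (h.tendsto_conjugatePoisson hint) ?_
  have key : ∀ ε : ℝ, 0 < ε → ∫ r in Ioo a b, 1 * ((r - s) / ((r - s) ^ 2 + ε ^ 2)) =
      log ((b - s) ^ 2 + ε ^ 2) / 2 - log ((a - s) ^ 2 + ε ^ 2) / 2 := by
    intro ε hε
    have hc : Continuous fun r : ℝ => (r - s) / ((r - s) ^ 2 + ε ^ 2) :=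
      (continuous_div_sq_add_sq continuous_id hε).comp (continuous_id.sub continuous_const)
    simp only [one_mul]
    rw [← integral_Ioc_eq_integral_Ioo, ← intervalIntegral.integral_of_le hab.le]
    refine intervalIntegral.integral_eq_sub_of_hasDerivAt
      (f := fun r => log ((r - s) ^ 2 + ε ^ 2) / 2) (fun r _ => ?_) (hc.intervalIntegrable _ _)
    have h2 := ((((hasDerivAt_id r).sub_const s).pow 2).add_const (ε ^ 2)).log
      (sq_add_sq_pos hε (r - s)).ne'
    refine (h2.div_const 2).congr_deriv ?_
    simp only [id, Nat.cast_ofNat, Pi.pow_apply, Nat.add_one_sub_one, pow_one]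
    have := (sq_add_sq_pos hε (r - s)).ne'
    field_simp
  have hlim : Tendsto (fun ε : ℝ => log ((b - s) ^ 2 + ε ^ 2) / 2 -
      log ((a - s) ^ 2 + ε ^ 2) / 2) (𝓝[>] 0) (𝓝 (log (b - s) - log (s - a))) := by
    have hb : b - s ≠ 0 := (sub_pos.2 hs.2).ne'
    have ha : a - s ≠ 0 := (sub_neg.2 hs.1).ne
    have hc : ContinuousAt (fun ε : ℝ => log ((b - s) ^ 2 + ε ^ 2) / 2 -
        log ((a - s) ^ 2 + ε ^ 2) / 2) 0 := by
      refine ContinuousAt.sub (ContinuousAt.div_const (ContinuousAt.log (by fun_prop) ?_) _)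
        (ContinuousAt.div_const (ContinuousAt.log (by fun_prop) ?_) _) <;> positivity
    have := hc.tendsto
    have e : log ((b - s) ^ 2 + 0 ^ 2) / 2 - log ((a - s) ^ 2 + 0 ^ 2) / 2 =
        log (b - s) - log (s - a) := by
      rw [← neg_sub s a, neg_sq, zero_pow two_ne_zero, add_zero, add_zero, log_pow, log_pow]
      push_cast; ring
    rw [e] at this
    exact this.mono_left nhdsWithin_le_nhds
  refine hlim.congr' ?_
  filter_upwards [self_mem_nhdsWithin] with ε hε using (key ε hε).symm

/-- Subtracting the constant α(s) makes the density vanish at s, so the cutoff drops out of the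
principal value integrand. -/
theorem pi_mul_hilbert_eq (hα : WeightedHolder a b 0 0 α) (hs : s ∈ Ioo a b) :
    π * hilbert a b α s = (∫ r in Ioo a b, (α r - α s) / (r - s)) +
      α s * (log (b - s) - log (s - a)) := by
  have h0 : WeightedHolder a b 0 0 (fun r => α r - α s) := hα.sub (weightedHolder_const _)
  have h1 : WeightedHolder a b 0 0 (fun _ : ℝ => (1 : ℝ)) := weightedHolder_const 1
  have h2 : WeightedHolder a b 0 0 (fun _ : ℝ => α s * (1 : ℝ)) := h1.const_mul _
  have e : α = fun r => (α r - α s) + α s * 1 := by funext r; ring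
  have e1 : hilbert a b α s = hilbert a b (fun r => α r - α s) s +
      α s * hilbert a b (fun _ => 1) s := by
    conv_lhs => rw [e]
    rw [HilbertExists.hilbert_add (h0.hilbertExists one_pos one_pos hs)
      (h2.hilbertExists one_pos one_pos hs),
      (h1.hilbertExists one_pos one_pos hs).hilbert_const_mul]
  obtain ⟨A, μ, h⟩ := h0.holderAt_self hs
  rw [e1, mul_add, h.hilbert_eq (h0.integrableOn one_pos one_pos), ← mul_assoc,
    mul_one_div_cancel pi_ne_zero, one_mul, mul_left_comm, hilbert_one hs]
  simp [pvIntegrand]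

theorem rpow_mul_abs_log_le {L r : ℝ} (hr : 0 < r) :
    ∃ C, 0 ≤ C ∧ ∀ x, 0 < x → x ≤ L → x ^ r * |log x| ≤ C := by
  rcases le_or_gt L 0 with hL | hL
  · exact ⟨0, le_rfl, fun x h1 h2 => absurd (h1.trans_le h2) (not_lt.2 hL)⟩
  refine ⟨(L ^ r * L ^ r + 1) / r, by positivity, fun x hx hxL => ?_⟩
  have hxr := rpow_pos_of_pos hx r
  have h1 := log_le_rpow_div hx.le hr
  have h2 := log_le_rpow_div (inv_pos.2 hx).le hr
  rw [log_inv, inv_rpow hx.le] at h2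
  have h3 : |log x| ≤ (x ^ r + (x ^ r)⁻¹) / r := by
    have p1 : 0 ≤ x ^ r / r := by positivity
    have p2 : 0 ≤ (x ^ r)⁻¹ / r := by positivity
    rw [add_div]
    exact abs_le.2 ⟨by linarith, by linarith⟩
  have h4 : x ^ r ≤ L ^ r := rpow_le_rpow hx.le hxL hr.le
  calc x ^ r * |log x| ≤ x ^ r * ((x ^ r + (x ^ r)⁻¹) / r) := by gcongr
    _ = (x ^ r * x ^ r + 1) / r := by field_simp
    _ ≤ _ := by gcongr

/-- The regular integral is bounded by the Hölder condition. Replacing α(s) by the endpoint values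
costs terms such as (b - s)^r |log(b - s)|, which are bounded. -/
theorem exists_abs_pi_mul_hilbert_sub_le (hα : IsHolderOn α (Icc a b)) : ∃ C, ∀ s ∈ Ioo a b,
    |π * hilbert a b α s - (α b * log (b - s) - α a * log (s - a))| ≤ C := by
  have hW := weightedHolder_of_isHolderOn hα
  obtain ⟨K, r, hK, hr, -, h⟩ := isHolderOn_iff.1 hα
  obtain ⟨C, hC, hCx⟩ := rpow_mul_abs_log_le (L := b - a) hr
  refine ⟨K * (2 * ((b - a) ^ r / r)) + (K * C + K * C), fun s hs => ?_⟩
  have hab := hs.1.trans hs.2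
  have hs' := Ioo_subset_Icc_self hs
  have hsa : 0 < s - a := sub_pos.2 hs.1
  have hbs : 0 < b - s := sub_pos.2 hs.2
  have hL : 0 < b - a := sub_pos.2 hab
  have e : π * hilbert a b α s - (α b * log (b - s) - α a * log (s - a)) =
      (∫ r in Ioo a b, (α r - α s) / (r - s)) +
        ((α s - α b) * log (b - s) - (α s - α a) * log (s - a)) := by
    rw [pi_mul_hilbert_eq hW hs]; ring
  have b1 : |∫ r in Ioo a b, (α r - α s) / (r - s)| ≤ K * (2 * ((b - a) ^ r / r)) := by
    have hn : Integrable fun x => K * nearBound (b - a) r (x - s) :=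
      ((integrable_nearBound hL hr).comp_sub_right s).const_mul K
    calc _ ≤ ∫ x in Ioo a b, K * nearBound (b - a) r (x - s) := by
          rw [← norm_eq_abs]
          refine norm_integral_le_of_norm_le hn.integrableOn ?_
          filter_upwards [ae_restrict_mem measurableSet_Ioo] with x hx
          have hxs : |x - s| ≤ b - a :=
            abs_le.2 ⟨by linarith [hx.1, hs.2], by linarith [hx.2, hs.1]⟩
          rw [nearBound, indicator_of_mem (mem_Iic.2 hxs), norm_div, norm_eq_abs, norm_eq_abs]
          rcases eq_or_ne (x - s) 0 with h0 | h0
          · rw [h0, abs_zero, div_zero]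
            exact mul_nonneg hK (rpow_nonneg le_rfl _)
          · have h0' := abs_pos.2 h0
            rw [rpow_sub_one h0'.ne', ← mul_div_assoc]
            exact div_le_div_of_nonneg_right (h x (Ioo_subset_Icc_self hx) s hs') h0'.le
      _ ≤ ∫ x, K * nearBound (b - a) r (x - s) :=
          setIntegral_le_integral hn (Eventually.of_forall fun x =>
            mul_nonneg hK (nearBound_nonneg _))
      _ = _ := by
          rw [integral_const_mul, integral_sub_right_eq_self (nearBound (b - a) r),
            integral_nearBound hL hr]
  have b2 : |(α s - α b) * log (b - s)| ≤ K * C := by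
    have h1 := h s hs' b ⟨hab.le, le_rfl⟩
    rw [abs_sub_comm s b, abs_of_pos hbs] at h1
    rw [abs_mul]
    calc _ ≤ K * (b - s) ^ r * |log (b - s)| := by gcongr
      _ ≤ _ := by
        rw [mul_assoc]
        exact mul_le_mul_of_nonneg_left (hCx _ hbs (by linarith)) hK
  have b3 : |(α s - α a) * log (s - a)| ≤ K * C := by
    have h1 := h s hs' a ⟨le_rfl, hab.le⟩
    rw [abs_of_pos hsa] at h1
    rw [abs_mul]
    calc _ ≤ K * (s - a) ^ r * |log (s - a)| := by gcongr
      _ ≤ _ := by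
        rw [mul_assoc]
        exact mul_le_mul_of_nonneg_left (hCx _ hsa (by linarith)) hK
  rw [e]
  exact (abs_add_le _ _).trans (add_le_add b1 ((abs_sub _ _).trans (add_le_add b2 b3)))

theorem exists_exp_pi_mul_hilbert_le (hα : IsHolderOn α (Icc a b)) : ∃ M, 0 ≤ M ∧ ∀ s ∈ Ioo a b,
    exp (π * hilbert a b α s) ≤ M * edgeWeight a b (α a) (-α b) s := by
  obtain ⟨C, hC⟩ := exists_abs_pi_mul_hilbert_sub_le hα
  refine ⟨exp C, (exp_pos _).le, fun s hs => ?_⟩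
  have h := (abs_le.1 (hC s hs)).2
  rw [edgeWeight, rpow_def_of_pos (sub_pos.2 hs.1), rpow_def_of_pos (sub_pos.2 hs.2), ← exp_add,
    ← exp_add]
  exact exp_le_exp.2 (by linarith)

theorem weightedHolder_exp_pi_mul_hilbert (hα : IsHolderOn α (Icc a b)) (hη : 0 < η) (hη1 : η ≤ 1) :
    WeightedHolder a b (α a + η) (-α b + η) (fun s => exp (π * hilbert a b α s)) := by
  obtain ⟨M, hM, h⟩ := exists_exp_pi_mul_hilbert_le hα
  exact WeightedHolder.exp_comp hM (((weightedHolder_of_isHolderOn hα).hilbert hη hη hη.le hη.le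
    hη1 hη1).const_mul π) hη.le hη.le h

theorem IsHolderOn.neg {S : Set ℝ} (hα : IsHolderOn α S) : IsHolderOn (fun s => -α s) S := by
  rw [isHolderOn_iff] at *
  obtain ⟨C, r, hC, h0, h1, h⟩ := hα
  refine ⟨C, r, hC, h0, h1, fun x hx y hy => ?_⟩
  rw [neg_sub_neg, abs_sub_comm]
  exact h x hx y hy

theorem hilbert_neg_of_isHolderOn (hα : IsHolderOn α (Icc a b)) (hs : s ∈ Ioo a b) :
    hilbert a b (fun r => -α r) s = -hilbert a b α s :=
  ((weightedHolder_of_isHolderOn hα).hilbertExists one_pos one_pos hs).hilbert_neg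

theorem weightedHolder_exp_neg_pi_mul_hilbert (hα : IsHolderOn α (Icc a b)) (hη : 0 < η)
    (hη1 : η ≤ 1) :
    WeightedHolder a b (-α a + η) (α b + η) (fun s => exp (-(π * hilbert a b α s))) := by
  have h := weightedHolder_exp_pi_mul_hilbert hα.neg hη hη1
  rw [neg_neg] at h
  refine h.congr fun s hs => ?_
  simp only
  rw [hilbert_neg_of_isHolderOn hα hs, mul_neg]

end LogBound


/-! ### The exponential of the Cauchy transform -/

/-- The boundary value `H[α] + i α` of the Cauchy transform of `α`. -/
def boundaryValue (a b : ℝ) (α : ℝ → ℝ) (r : ℝ) : ℂ := (hilbert a b α r : ℂ) + α r * Complex.I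

section Exponential

variable {a b s η : ℝ} {α : ℝ → ℝ} {z : ℂ}

/-- Since H[α] is only logarithmically singular, every power has arbitrarily small exponents. The
induction must carry all η at once: the step uses η/2 for each factor. -/
theorem weightedHolder_boundaryValue_pow (hα : WeightedHolder a b 0 0 α) (n : ℕ) :
    ∀ η : ℝ, 0 < η → η ≤ 1 →
      WeightedHolder a b η η (fun r => (boundaryValue a b α r ^ n).re) ∧
      WeightedHolder a b η η (fun r => (boundaryValue a b α r ^ n).im) := by
  induction n with
  | zero =>
    intro η hη hη1
    simp only [pow_zero, Complex.one_re, Complex.one_im]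
    exact ⟨(weightedHolder_const 1).mono hη.le hη.le, (weightedHolder_const 0).mono hη.le hη.le⟩
  | succ n ih =>
    intro η hη hη1
    obtain ⟨h1, h2⟩ := ih (η / 2) (by linarith) (by linarith)
    have hH : WeightedHolder a b (η / 2) (η / 2) (hilbert a b α) :=
      hα.hilbert (by linarith) (by linarith) (by linarith) (by linarith) (by linarith)
        (by linarith)
    have hα' : WeightedHolder a b (η / 2) (η / 2) α := hα.mono (by linarith) (by linarith)
    have k1 := (h1.mul hH).sub (h2.mul hα')
    have k2 := (h1.mul hα').add (h2.mul hH)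
    rw [add_halves] at k1 k2
    constructor
    · refine k1.congr fun r _ => ?_
      simp [pow_succ, boundaryValue]
    · refine k2.congr fun r _ => ?_
      simp [pow_succ, boundaryValue]

/-- With f = Im B^{n+1} and H[f] = Re B^{n+1}, the combination f H[α] + α H[f] is Im B^{n+2}, while
H[f] H[α] - f α is Re B^{n+2}. So the product formulas for H and for the Cauchy transform propagate
both claims together. -/
theorem hilbert_boundaryValue_pow (hα : WeightedHolder a b 0 0 α) (n : ℕ) :
    (∀ s ∈ Ioo a b, hilbert a b (fun r => (boundaryValue a b α r ^ (n + 1)).im) s =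
      (boundaryValue a b α s ^ (n + 1)).re) ∧
    ∀ z : ℂ, z.im ≠ 0 → cauchyTransform a b α z ^ (n + 1) =
      cauchyTransform a b (fun r => (boundaryValue a b α r ^ (n + 1)).im) z := by
  induction n with
  | zero => simp [boundaryValue]
  | succ n ih =>
    obtain ⟨ih1, ih2⟩ := ih
    have hW := (weightedHolder_boundaryValue_pow hα (n + 1) (1 / 2) (by norm_num) (by norm_num)).2
    have e : EqOn (fun r => (boundaryValue a b α r ^ (n + 1 + 1)).im)
        (fun r => (boundaryValue a b α r ^ (n + 1)).im * hilbert a b α r +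
          α r * hilbert a b (fun r => (boundaryValue a b α r ^ (n + 1)).im) r) (Ioo a b) := by
      intro r hr
      simp only [ih1 r hr]
      rw [pow_succ, Complex.mul_im]
      simp [boundaryValue]
      ring
    constructor
    · intro s hs
      rw [hilbert_congr e, hW.hilbert_mul_hilbert_add hα (by norm_num) (by norm_num) (by norm_num)
        (by norm_num) hs, ih1 s hs, pow_succ _ (n + 1), Complex.mul_re]
      simp [boundaryValue]
    · intro z hz
      rw [cauchyTransform_congr e, ← hW.cauchyTransform_mul hα (by norm_num) (by norm_num)
        (by norm_num) (by norm_num) hz, ← ih2 z hz, pow_succ _ (n + 1)]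

theorem exp_pi_mul_boundaryValue_re (r : ℝ) : (Complex.exp (π * boundaryValue a b α r)).re =
    cos (π * α r) * exp (π * hilbert a b α r) := by
  rw [Complex.exp_re]
  simp [boundaryValue, mul_comm]

theorem exp_pi_mul_boundaryValue_im (r : ℝ) : (Complex.exp (π * boundaryValue a b α r)).im =
    sin (π * α r) * exp (π * hilbert a b α r) := by
  rw [Complex.exp_im]
  simp [boundaryValue, mul_comm]

/-- This dominates the exponential series. The norm forces both e^{πH[α]} and e^{-πH[α]} to be
integrable, which is where the two-sided bounds |α(a)|, |α(b)| < 1 enter. -/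
theorem integrableOn_exp_norm_boundaryValue (hα : IsHolderOn α (Icc a b)) (ha : |α a| < 1)
    (hb : |α b| < 1) :
    IntegrableOn (fun r => exp (π * ‖boundaryValue a b α r‖)) (Ioo a b) := by
  have hW := weightedHolder_of_isHolderOn hα
  have hH : WeightedHolder a b (1 / 2) (1 / 2) (hilbert a b α) := hW.hilbert (by norm_num)
    (by norm_num) (by norm_num) (by norm_num) (by norm_num) (by norm_num)
  obtain ⟨K, hK, hKb⟩ := hW.bound
  obtain ⟨η, hη, hη'⟩ := exists_between (lt_min (sub_pos.2 ha) (sub_pos.2 hb))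
  rw [lt_min_iff] at hη'
  have hη1 : η ≤ 1 := by linarith [abs_nonneg (α a)]
  have a1 := le_abs_self (α a)
  have a2 := neg_abs_le (α a)
  have b1 := le_abs_self (α b)
  have b2 := neg_abs_le (α b)
  have i1 := (weightedHolder_exp_pi_mul_hilbert hα hη hη1).integrableOn (by linarith) (by linarith)
  have i2 := (weightedHolder_exp_neg_pi_mul_hilbert hα hη hη1).integrableOn (by linarith)
    (by linarith)
  refine Integrable.mono' ((i1.add i2).const_mul (exp (π * K))) ?_ ?_
  · refine ContinuousOn.aestronglyMeasurable ?_ measurableSet_Ioo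
    refine continuous_exp.comp_continuousOn (continuousOn_const.mul (ContinuousOn.norm ?_))
    exact (Complex.continuous_ofReal.comp_continuousOn hH.continuousOn).add
      ((Complex.continuous_ofReal.comp_continuousOn hW.continuousOn).mul continuousOn_const)
  · filter_upwards [ae_restrict_mem measurableSet_Ioo] with r hr
    rw [norm_of_nonneg (exp_pos _).le]
    have h1 : ‖boundaryValue a b α r‖ ≤ |hilbert a b α r| + K := by
      refine (norm_add_le _ _).trans ?_
      have := hKb r hr
      rw [edgeWeight_zero, mul_one] at this
      simpa using this
    have h2 : exp (π * |hilbert a b α r|) ≤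
        exp (π * hilbert a b α r) + exp (-(π * hilbert a b α r)) := by
      rcases abs_cases (hilbert a b α r) with h | h
      · rw [h.1]; linarith [exp_pos (-(π * hilbert a b α r))]
      · rw [h.1, mul_neg]; linarith [exp_pos (π * hilbert a b α r)]
    calc exp (π * ‖boundaryValue a b α r‖) ≤ exp (π * K + π * |hilbert a b α r|) := by
          rw [← mul_add]
          exact exp_le_exp.2 (mul_le_mul_of_nonneg_left (by linarith) pi_pos.le)
      _ ≤ _ := by
          rw [exp_add]
          exact mul_le_mul_of_nonneg_left h2 (exp_pos _).le

/-- The identity for powers is summed with the coefficients π^n/n!, interchanging sum and integral.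
The term n = 0 is exceptional, because Im B^0 = 0 while C[α]^0 = 1; this is the source of the -1. -/
theorem exp_cauchyTransform_sub_one (hα : IsHolderOn α (Icc a b)) (ha : |α a| < 1)
    (hb : |α b| < 1) (hz : z.im ≠ 0) :
    Complex.exp (π * cauchyTransform a b α z) - 1 = cauchyTransform a b
      (fun r => sin (π * α r) * exp (π * hilbert a b α r)) z := by
  have hW := weightedHolder_of_isHolderOn hα
  set B := boundaryValue a b α with hB
  have hexp : ∀ w : ℂ, HasSum (fun n : ℕ => w ^ n / (n.factorial : ℂ)) (Complex.exp w) := fun w => by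
    rw [Complex.exp_eq_exp_ℂ]
    exact NormedSpace.expSeries_div_hasSum_exp w
  have hterm : ∀ (n : ℕ) (r : ℝ), (((π : ℂ) * B r) ^ n / (n.factorial : ℂ)).im =
      π ^ n / n.factorial * (B r ^ n).im := fun n r => by
    rw [mul_pow, mul_div_right_comm]
    have : ((π : ℂ) ^ n / (n.factorial : ℂ)) = ((π ^ n / n.factorial : ℝ) : ℂ) := by push_cast; rfl
    rw [this, Complex.im_ofReal_mul]
  have hint := integrableOn_exp_norm_boundaryValue hα ha hb
  have hsum : HasSum (fun n : ℕ => ∫ r in Ioo a b,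
      ((π ^ n / n.factorial * (B r ^ n).im : ℝ) : ℂ) / ((r : ℂ) - z))
      (∫ r in Ioo a b, ((sin (π * α r) * exp (π * hilbert a b α r) : ℝ) : ℂ) / ((r : ℂ) - z)) := by
    have hreal : ∀ r, HasSum (fun n : ℕ => (π * ‖B r‖) ^ n / (n.factorial : ℝ))
        (exp (π * ‖B r‖)) := fun r => by
      rw [Real.exp_eq_exp_ℝ]
      exact NormedSpace.expSeries_div_hasSum_exp _
    refine hasSum_integral_of_dominated_convergence
      (fun n r => (π * ‖B r‖) ^ n / (n.factorial : ℝ) * (1 / |z.im|)) (fun n => ?_) (fun n => ?_)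
      (Eventually.of_forall fun r => ((hreal r).mul_right _).summable) ?_
      (Eventually.of_forall fun r => ?_)
    · have h1 := ((weightedHolder_boundaryValue_pow hW n (1 / 2) (by norm_num) (by norm_num)).2.const_mul
        (π ^ n / n.factorial)).integrableOn (by norm_num) (by norm_num)
      exact (integrableOn_div_sub h1 hz).1
    · refine Eventually.of_forall fun r => ?_
      rw [div_eq_mul_inv, norm_mul, ← hterm, Complex.norm_real]
      refine mul_le_mul ((Complex.abs_im_le_norm _).trans (le_of_eq ?_)) (norm_inv_sub_le hz r)
        (norm_nonneg _) (by positivity)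
      rw [norm_div, norm_pow, norm_mul, Complex.norm_real, norm_of_nonneg pi_pos.le]
      simp
    · have : (fun r => ∑' n : ℕ, (π * ‖B r‖) ^ n / (n.factorial : ℝ) * (1 / |z.im|)) =
          fun r => exp (π * ‖B r‖) * (1 / |z.im|) := by
        funext r
        exact ((hreal r).mul_right _).tsum_eq
      rw [this]
      exact hint.mul_const _
    · have h1 := Complex.hasSum_im (hexp (π * B r))
      simp only [hterm] at h1
      rw [hB, exp_pi_mul_boundaryValue_im] at h1
      exact (Complex.hasSum_ofReal.2 h1).div_const _
  have hsum' := hsum.mul_left (1 / (π : ℂ))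
  -- The 1 is removed from the zeroth term only, so that the two series agree term by term.
  have hL := (hexp (π * cauchyTransform a b α z)).sub (hasSum_ite_eq 0 (1 : ℂ))
  refine hL.unique ?_
  refine hsum'.congr_fun fun n => ?_
  change _ = cauchyTransform a b (fun r => π ^ n / n.factorial * (B r ^ n).im) z
  rw [cauchyTransform_const_mul]
  rcases n with _ | n
  · simp [cauchyTransform]
  · rw [← (hilbert_boundaryValue_pow hW n).2 z hz, if_neg (Nat.succ_ne_zero n), sub_zero, mul_pow]
    push_cast
    ring

theorem weightedHolder_sin_mul_exp (hα : IsHolderOn α (Icc a b)) (hη : 0 < η) (hη1 : η ≤ 1) :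
    WeightedHolder a b (α a + η) (-α b + η)
      (fun r => sin (π * α r) * exp (π * hilbert a b α r)) := by
  simpa only [zero_add] using ((weightedHolder_of_isHolderOn hα).const_mul π).sin_comp.mul
    (weightedHolder_exp_pi_mul_hilbert hα hη hη1)

/-- `H[sin(πα) e^{πH[α]}] = cos(πα) e^{πH[α]} - 1`. -/
theorem hilbert_sin_mul_exp (hα : IsHolderOn α (Icc a b)) (ha : |α a| < 1) (hb : |α b| < 1)
    (hs : s ∈ Ioo a b) :
    hilbert a b (fun r => sin (π * α r) * exp (π * hilbert a b α r)) s =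
      cos (π * α s) * exp (π * hilbert a b α s) - 1 := by
  have hW := weightedHolder_of_isHolderOn hα
  obtain ⟨η, hη, hη'⟩ := exists_between (lt_min (sub_pos.2 ha) (sub_pos.2 hb))
  rw [lt_min_iff] at hη'
  have hη1 : η ≤ 1 := by linarith [abs_nonneg (α a)]
  have a1 := le_abs_self (α a)
  have b2 := neg_abs_le (α b)
  have hS := weightedHolder_sin_mul_exp hα hη hη1
  have R := hS.tendsto_cauchyTransform (by linarith) (by linarith) hs
  have L := ((Complex.continuous_exp.tendsto _).comp ((hW.tendsto_cauchyTransform one_pos one_pos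
    hs).const_mul (π : ℂ))).sub_const 1
  have key := tendsto_nhds_unique R (L.congr' (by
    filter_upwards [self_mem_nhdsWithin] with ε hε
    exact exp_cauchyTransform_sub_one hα ha hb (add_mul_I_im_ne_zero s hε)))
  have h := congrArg Complex.re key
  have e := exp_pi_mul_boundaryValue_re (a := a) (b := b) (α := α) s
  rw [boundaryValue] at e
  rw [Complex.sub_re, e, Complex.add_re, Complex.ofReal_re, Complex.re_ofReal_mul, Complex.I_re,
    mul_zero, add_zero, Complex.one_re] at h
  exact h

theorem hilbert_sin_mul_exp_neg (hα : IsHolderOn α (Icc a b)) (ha : |α a| < 1) (hb : |α b| < 1)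
    (hs : s ∈ Ioo a b) :
    hilbert a b (fun r => sin (π * α r) * exp (-(π * hilbert a b α r))) s =
      1 - cos (π * α s) * exp (-(π * hilbert a b α s)) := by
  have h := hilbert_sin_mul_exp hα.neg (by rwa [abs_neg]) (by rwa [abs_neg]) hs
  have e : EqOn (fun r => sin (π * -α r) * exp (π * hilbert a b (fun r => -α r) r))
      (fun r => (-1) * (sin (π * α r) * exp (-(π * hilbert a b α r)))) (Ioo a b) := fun r hr => by
    simp only
    rw [hilbert_neg_of_isHolderOn hα hr, mul_neg, mul_neg, sin_neg]
    ring
  obtain ⟨η, hη, hη'⟩ := exists_between (lt_min (sub_pos.2 ha) (sub_pos.2 hb))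
  rw [lt_min_iff] at hη'
  have hη1 : η ≤ 1 := by linarith [abs_nonneg (α a)]
  have a2 := neg_abs_le (α a)
  have b1 := le_abs_self (α b)
  have hW : WeightedHolder a b (-α a + η) (α b + η)
      (fun r => sin (π * α r) * exp (-(π * hilbert a b α r))) := by
    simpa only [zero_add] using ((weightedHolder_of_isHolderOn hα).const_mul π).sin_comp.mul
      (weightedHolder_exp_neg_pi_mul_hilbert hα hη hη1)
  rw [hilbert_congr e, (hW.hilbertExists (by linarith) (by linarith) hs).hilbert_const_mul,
    hilbert_neg_of_isHolderOn hα hs, mul_neg, mul_neg, cos_neg] at h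
  linarith

end Exponential


/-! ### Inversion of L_α -/

section Inverse

variable {a b γ δ s η : ℝ} {α φ ψ : ℝ → ℝ}

theorem mem_domL_iff (ha : |α a| < 1) (hb : |α b| < 1) : ψ ∈ domL a b α ↔
    ∃ γ δ, γ < 1 - max (α a) 0 ∧ δ < 1 - max (-α b) 0 ∧ WeightedHolder a b γ δ ψ := by
  rw [abs_lt] at ha hb
  exact mem_endpointClass_iff (sub_pos.2 (max_lt ha.2 one_pos))
    (sub_pos.2 (max_lt (by linarith) one_pos))

/-- A loss `η` in the exponent that is harmless at an endpoint. -/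
def SmallLoss (x γ η : ℝ) : Prop :=
  0 ≤ γ ∧ 0 < η ∧ η ≤ 1 ∧ 4 * η ≤ 1 - |x| ∧ 4 * η ≤ 1 - max x 0 - γ

theorem exists_smallLoss (ha : |α a| < 1) (hb : |α b| < 1) (hψ : ψ ∈ domL a b α) :
    ∃ γ δ η, SmallLoss (α a) γ η ∧ SmallLoss (-α b) δ η ∧ WeightedHolder a b γ δ ψ := by
  obtain ⟨γ, δ, hγ, hδ, h⟩ := (mem_domL_iff ha hb).1 hψ
  rw [abs_lt] at ha hb
  have hγ' : max γ 0 < 1 - max (α a) 0 := max_lt hγ (sub_pos.2 (max_lt ha.2 one_pos))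
  have hδ' : max δ 0 < 1 - max (-α b) 0 := max_lt hδ (sub_pos.2 (max_lt (by linarith) one_pos))
  have ha' := abs_lt.2 ha
  have hb' := abs_lt.2 hb
  obtain ⟨η, hη, hη'⟩ := exists_between (lt_min (lt_min (sub_pos.2 ha') (sub_pos.2 hb'))
    (lt_min (sub_pos.2 hγ') (sub_pos.2 hδ')))
  simp only [lt_min_iff] at hη'
  obtain ⟨⟨h1, h2⟩, h3, h4⟩ := hη'
  refine ⟨max γ 0, max δ 0, η / 4, ⟨le_max_right _ _, ?_, ?_, ?_, ?_⟩,
    ⟨le_max_right _ _, ?_, ?_, ?_, ?_⟩,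
    h.mono (le_max_left _ _) (le_max_left _ _)⟩ <;>
    first | linarith [abs_nonneg (α a)] | (rw [abs_neg]; linarith)

/-- A ledger of all exponent conditions used below, with x = α(a) at the left endpoint and x = -α(b)
at the right. The last entry is the tightest: multiplying by e^{πH[α]}, applying H and multiplying
by e^{-πH[α]} loses 3η in all, and the factor 4 in `SmallLoss` keeps the inequality strict. -/
theorem SmallLoss.bounds {x γ η : ℝ} (h : SmallLoss x γ η) :
    γ < 1 ∧ γ + η < 1 ∧ x + η < 1 ∧ -x + η < 1 ∧ x + η + γ < 1 ∧ γ + η < 1 - max x 0 ∧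
      x + η + max γ 0 < 1 ∧ γ + max (x + η) 0 < 1 ∧
      -x + η + max (x + η + γ) 0 < 1 ∧ x + η + γ + max (-x + η) 0 < 1 ∧
      max (x + η + γ) 0 + η ≤ 1 ∧ -x + η + (max (x + η + γ) 0 + η) < 1 - max x 0 := by
  obtain ⟨h0, h1, h2, h3, h4⟩ := h
  have e1 := le_abs_self x
  have e2 := neg_abs_le x
  have e3 := le_max_left x 0
  have e4 := le_max_right x 0
  have e5 : max x 0 ≤ |x| := max_le e1 (abs_nonneg x)
  have e6 : max x 0 - x ≤ |x| := by
    rcases max_cases x 0 with h | h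
    · linarith [abs_nonneg x]
    · linarith
  have e7 : max γ 0 = γ := max_eq_left h0
  refine ⟨by linarith, by linarith, by linarith, by linarith, by linarith, by linarith,
    by linarith, ?_, ?_, ?_, ?_, ?_⟩
  · rcases max_cases (x + η) 0 with h | h <;> linarith
  · rcases max_cases (x + η + γ) 0 with h | h <;> linarith
  · rcases max_cases (-x + η) 0 with h | h <;> linarith
  · rcases max_cases (x + η + γ) 0 with h | h <;> linarith
  · rcases max_cases (x + η + γ) 0 with h | h
    · linarith
    · rcases max_cases x 0 with h' | h' <;> linarith

theorem weightedHolder_cos (hα : IsHolderOn α (Icc a b)) :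
    WeightedHolder a b 0 0 (fun s => cos (π * α s)) :=
  ((weightedHolder_of_isHolderOn hα).const_mul π).cos_comp

theorem weightedHolder_sin (hα : IsHolderOn α (Icc a b)) :
    WeightedHolder a b 0 0 (fun s => sin (π * α s)) :=
  ((weightedHolder_of_isHolderOn hα).const_mul π).sin_comp

/-- The cosine is nonzero on a compact interval, hence bounded away from 0. -/
theorem weightedHolder_tan (hab : a < b) (hα : IsHolderOn α (Icc a b))
    (hcos : ∀ s ∈ Icc a b, cos (π * α s) ≠ 0) :
    WeightedHolder a b 0 0 (fun s => tan (π * α s)) := by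
  have hc : ContinuousOn α (Icc a b) := by
    obtain ⟨C, r, h0, -, h⟩ := hα
    exact h.continuousOn h0
  obtain ⟨x, hx, hmin⟩ := isCompact_Icc.exists_isMinOn (nonempty_Icc.2 hab.le)
    ((continuous_cos.comp_continuousOn (continuousOn_const.mul hc)).abs :
      ContinuousOn (fun s => |cos (π * α s)|) (Icc a b))
  have h := (weightedHolder_sin hα).mul ((weightedHolder_cos hα).inv (abs_pos.2 (hcos x hx))
    fun s hs => hmin (Ioo_subset_Icc_self hs))
  rw [add_zero] at h
  refine h.congr fun s _ => ?_
  simp only [tan_eq_sin_div_cos, div_eq_mul_inv, Function.comp_apply, Pi.mul_apply]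

theorem weightedHolder_invDensity (hα : IsHolderOn α (Icc a b)) (hη : 0 < η) (hη1 : η ≤ 1)
    (hφ : WeightedHolder a b γ δ φ) :
    WeightedHolder a b (α a + η + γ) (-α b + η + δ) (invDensity a b α φ) := by
  have h := ((weightedHolder_cos hα).mul (weightedHolder_exp_pi_mul_hilbert hα hη hη1)).mul hφ
  rw [zero_add, zero_add] at h
  exact h

theorem weightedHolder_sin_mul_exp_neg (hα : IsHolderOn α (Icc a b)) (hη : 0 < η) (hη1 : η ≤ 1) :
    WeightedHolder a b (-α a + η) (α b + η)
      (fun s => sin (π * α s) * exp (-(π * hilbert a b α s))) := by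
  simpa only [zero_add] using (weightedHolder_sin hα).mul
    (weightedHolder_exp_neg_pi_mul_hilbert hα hη hη1)

theorem hilbertExists_of_mem_domL (hα : IsHolderOn α (Icc a b)) (ha : |α a| < 1) (hb : |α b| < 1)
    (hψ : ψ ∈ domL a b α) (hs : s ∈ Ioo a b) :
    HilbertExists a b ψ s ∧ HilbertExists a b (invDensity a b α ψ) s := by
  obtain ⟨γ, δ, η, hγ, hδ, h⟩ := exists_smallLoss ha hb hψ
  obtain ⟨g1, -, -, -, g2, -⟩ := hγ.bounds
  obtain ⟨d1, -, -, -, d2, -⟩ := hδ.bounds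
  exact ⟨h.hilbertExists g1 d1 hs,
    (weightedHolder_invDensity hα hγ.2.1 hγ.2.2.1 h).hilbertExists g2 d2 hs⟩

theorem opL_mem_domL (hab : a < b) (hα : IsHolderOn α (Icc a b))
    (hcos : ∀ s ∈ Icc a b, cos (π * α s) ≠ 0) (ha : |α a| < 1) (hb : |α b| < 1)
    (hψ : ψ ∈ domL a b α) : opL a b α ψ ∈ domL a b α := by
  obtain ⟨γ, δ, η, hγ, hδ, h⟩ := exists_smallLoss ha hb hψ
  obtain ⟨-, g1, -, -, -, g2, -⟩ := hγ.bounds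
  obtain ⟨-, d1, -, -, -, d2, -⟩ := hδ.bounds
  have hη := hγ.2.1
  have hγ0 := hγ.1
  have hδ0 := hδ.1
  refine (mem_domL_iff ha hb).2 ⟨γ + η, δ + η, g2, d2, ?_⟩
  have hH : WeightedHolder a b (γ + η) (δ + η) (hilbert a b ψ) :=
    h.hilbert (by linarith) (by linarith) (by linarith) (by linarith) g1.le d1.le
  have hT := (weightedHolder_tan hab hα hcos).mul hH
  rw [zero_add, zero_add] at hT
  exact (h.mono (by linarith) (by linarith)).add hT

theorem opLInv_mem_domL (hα : IsHolderOn α (Icc a b)) (ha : |α a| < 1) (hb : |α b| < 1)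
    (hφ : φ ∈ domL a b α) : opLInv a b α φ ∈ domL a b α := by
  obtain ⟨γ, δ, η, hγ, hδ, h⟩ := exists_smallLoss ha hb hφ
  obtain ⟨-, -, -, -, -, g2, -, -, -, -, g3, g4⟩ := hγ.bounds
  obtain ⟨-, -, -, -, -, d2, -, -, -, -, d3, d4⟩ := hδ.bounds
  have hη := hγ.2.1
  have hη1 := hγ.2.2.1
  rw [neg_neg] at d4
  have hf := weightedHolder_invDensity hα hη hη1 h
  -- The exponent is cut off at 0 because H does not preserve decay at the endpoints. This is why
  -- the domain requires γ < 1 - max(α(a), 0), and likewise at b.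
  have hH : WeightedHolder a b (max (α a + η + γ) 0 + η) (max (-α b + η + δ) 0 + η)
      (hilbert a b (invDensity a b α φ)) :=
    hf.hilbert (by linarith [le_max_left (α a + η + γ) 0]) (by linarith [le_max_left (-α b + η + δ) 0])
      (by linarith [le_max_right (α a + η + γ) 0]) (by linarith [le_max_right (-α b + η + δ) 0]) g3 d3
  have hT := (weightedHolder_sin_mul_exp_neg hα hη hη1).mul hH
  have hC := ((weightedHolder_cos hα).mul (weightedHolder_cos hα)).mul h
  rw [add_zero, zero_add, zero_add] at hC
  refine (mem_domL_iff ha hb).2 ⟨_, _, max_lt (by linarith : γ < 1 - max (α a) 0) g4,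
    max_lt (by linarith : δ < 1 - max (-α b) 0) d4, ?_⟩
  refine ((hC.mono (le_max_left _ _) (le_max_left _ _)).sub
    (hT.mono (le_max_right _ _) (le_max_right _ _))).congr fun s _ => ?_
  simp only [opLInv, sq]

theorem opLInv_opL (hα : IsHolderOn α (Icc a b))
    (hcos : ∀ s ∈ Icc a b, cos (π * α s) ≠ 0) (ha : |α a| < 1) (hb : |α b| < 1)
    (hψ : ψ ∈ domL a b α) : EqOn (opLInv a b α (opL a b α ψ)) ψ (Ioo a b) := by
  intro s hs
  obtain ⟨γ, δ, η, hγ, hδ, h⟩ := exists_smallLoss ha hb hψ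
  obtain ⟨g1, -, -, -, -, -, g2, g3, -⟩ := hγ.bounds
  obtain ⟨d1, -, -, -, -, -, d2, d3, -⟩ := hδ.bounds
  have hS := weightedHolder_sin_mul_exp hα hγ.2.1 hγ.2.2.1
  set S := fun r => sin (π * α r) * exp (π * hilbert a b α r) with hSdef
  have hHS : ∀ r ∈ Ioo a b, hilbert a b S r = cos (π * α r) * exp (π * hilbert a b α r) - 1 :=
    fun r hr => hilbert_sin_mul_exp hα ha hb hr
  -- The -1 in H[S] produces the isolated ψ; the rest has the form on the left of Tricomi's formula.
  have e : EqOn (invDensity a b α (opL a b α ψ))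
      (fun r => ψ r + (S r * hilbert a b ψ r + ψ r * hilbert a b S r)) (Ioo a b) := fun r hr => by
    have hc := hcos r (Ioo_subset_Icc_self hr)
    simp only [hHS r hr]
    simp only [invDensity, opL, hSdef, tan_eq_sin_div_cos]
    field_simp
    ring
  obtain ⟨_, _, h1, h2, h3⟩ := hS.mul_hilbert_add h g2 g3 d2 d3
  have hH : hilbert a b (invDensity a b α (opL a b α ψ)) s =
      cos (π * α s) * exp (π * hilbert a b α s) * hilbert a b ψ s - S s * ψ s := by
    rw [hilbert_congr e, (h.hilbertExists g1 d1 hs).hilbert_add (h3.hilbertExists h1 h2 hs),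
      hS.hilbert_mul_hilbert_add h g2 g3 d2 d3 hs, hHS s hs]
    ring
  have hc := hcos s (Ioo_subset_Icc_self hs)
  have he : exp (-(π * hilbert a b α s)) * exp (π * hilbert a b α s) = 1 := by
    rw [← exp_add, neg_add_cancel, exp_zero]
  have hsc := sin_sq_add_cos_sq (π * α s)
  simp only [opLInv, hH, opL, hSdef, tan_eq_sin_div_cos]
  field_simp
  linear_combination (-(sin (π * α s)) * (cos (π * α s) * hilbert a b ψ s - sin (π * α s) * ψ s)) * he
    + ψ s * hsc

theorem opL_opLInv (hα : IsHolderOn α (Icc a b))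
    (hcos : ∀ s ∈ Icc a b, cos (π * α s) ≠ 0) (ha : |α a| < 1) (hb : |α b| < 1)
    (hφ : φ ∈ domL a b α) : EqOn (opL a b α (opLInv a b α φ)) φ (Ioo a b) := by
  intro s hs
  obtain ⟨γ, δ, η, hγ, hδ, h⟩ := exists_smallLoss ha hb hφ
  obtain ⟨-, -, -, -, g1, -, -, -, g2, g3, -⟩ := hγ.bounds
  obtain ⟨-, -, -, -, d1, -, -, -, d2, d3, -⟩ := hδ.bounds
  rw [neg_neg] at d2 d3
  have hf := weightedHolder_invDensity hα hγ.2.1 hγ.2.2.1 h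
  have hS := weightedHolder_sin_mul_exp_neg hα hγ.2.1 hγ.2.2.1
  set f := invDensity a b α φ with hfdef
  set S := fun r => sin (π * α r) * exp (-(π * hilbert a b α r)) with hSdef
  have hHS : ∀ r ∈ Ioo a b, hilbert a b S r = 1 - cos (π * α r) * exp (-(π * hilbert a b α r)) :=
    fun r hr => hilbert_sin_mul_exp_neg hα ha hb hr
  have he : ∀ r, exp (-(π * hilbert a b α r)) * exp (π * hilbert a b α r) = 1 := fun r => by
    rw [← exp_add, neg_add_cancel, exp_zero]
  have hfr : ∀ r, cos (π * α r) * exp (-(π * hilbert a b α r)) * f r = cos (π * α r) ^ 2 * φ r :=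
    fun r => by
      simp only [hfdef, invDensity]
      linear_combination (cos (π * α r) ^ 2 * φ r) * he r
  -- As cos(πα) e^{-πH[α]} = 1 - H[S], the first term cos² φ equals f - f H[S], which again exposes
  -- Tricomi's combination, now for S and f.
  have e : EqOn (opLInv a b α φ)
      (fun r => f r - (S r * hilbert a b f r + f r * hilbert a b S r)) (Ioo a b) := fun r hr => by
    simp only [hHS r hr]
    simp only [opLInv, ← hfdef, hSdef]
    linear_combination -hfr r
  obtain ⟨_, _, h1, h2, h3⟩ := hS.mul_hilbert_add hf g2 g3 d2 d3
  have hH : hilbert a b (opLInv a b α φ) s =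
      cos (π * α s) * exp (-(π * hilbert a b α s)) * hilbert a b f s + S s * f s := by
    rw [hilbert_congr e, (hf.hilbertExists g1 d1 hs).hilbert_sub (h3.hilbertExists h1 h2 hs),
      hS.hilbert_mul_hilbert_add hf g2 g3 d2 d3 hs, hHS s hs]
    ring
  have hc := hcos s (Ioo_subset_Icc_self hs)
  have hsc := sin_sq_add_cos_sq (π * α s)
  have hSf : S s * f s = sin (π * α s) * cos (π * α s) * φ s := by
    simp only [hSdef, hfdef, invDensity]
    linear_combination (sin (π * α s) * cos (π * α s) * φ s) * he s
  rw [opL, hH, hSf, opLInv, ← hfdef, tan_eq_sin_div_cos]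
  field_simp
  linear_combination φ s * hsc

theorem opL_congr (h : EqOn φ ψ (Ioo a b)) : EqOn (opL a b α φ) (opL a b α ψ) (Ioo a b) :=
  fun s hs => by rw [opL, opL, h hs, hilbert_congr h]

theorem opLInv_congr (h : EqOn φ ψ (Ioo a b)) :
    EqOn (opLInv a b α φ) (opLInv a b α ψ) (Ioo a b) := fun s hs => by
  have e : EqOn (invDensity a b α φ) (invDensity a b α ψ) (Ioo a b) := fun r hr => by
    rw [invDensity, invDensity, h hr]
  rw [opLInv, opLInv, h hs, hilbert_congr e]

theorem exp_pi_mul_hilbert_of_const (hα : IsHolderOn α (Icc a b)) {c : ℝ}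
    (hc : ∀ s ∈ Icc a b, α s = c) (hs : s ∈ Ioo a b) :
    exp (π * hilbert a b α s) = ((b - s) / (s - a)) ^ c := by
  have h1 := sub_pos.2 hs.1
  have h2 := sub_pos.2 hs.2
  have h0 : ∫ r in Ioo a b, (α r - α s) / (r - s) = 0 := by
    rw [setIntegral_congr_fun (g := fun _ => (0 : ℝ)) measurableSet_Ioo fun r hr => ?_,
      integral_zero]
    simp [hc r (Ioo_subset_Icc_self hr), hc s (Ioo_subset_Icc_self hs)]
  rw [pi_mul_hilbert_eq (weightedHolder_of_isHolderOn hα) hs, h0, zero_add,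
    hc s (Ioo_subset_Icc_self hs), rpow_def_of_pos (div_pos h2 h1), log_div h2.ne' h1.ne', mul_comm]

theorem opLInv_of_const (hα : IsHolderOn α (Icc a b)) (ha : |α a| < 1)
    (hb : |α b| < 1) {c : ℝ} (hc : ∀ s ∈ Icc a b, α s = c) (hφ : φ ∈ domL a b α)
    (hs : s ∈ Ioo a b) :
    HilbertExists a b (fun r => ((b - r) / (r - a)) ^ c * φ r) s ∧
      opLInv a b α φ s = cos (π * c) ^ 2 * φ s - sin (π * c) * cos (π * c) *
        ((s - a) / (b - s)) ^ c * hilbert a b (fun r => ((b - r) / (r - a)) ^ c * φ r) s := by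
  obtain ⟨γ, δ, η, hγ, hδ, h⟩ := exists_smallLoss ha hb hφ
  obtain ⟨-, -, -, -, g1, -⟩ := hγ.bounds
  obtain ⟨-, -, -, -, d1, -⟩ := hδ.bounds
  have hk : WeightedHolder a b (α a + η + γ) (-α b + η + δ)
      (fun r => ((b - r) / (r - a)) ^ c * φ r) :=
    ((weightedHolder_exp_pi_mul_hilbert hα hγ.2.1 hγ.2.2.1).mul h).congr fun r hr => by
      simp only [exp_pi_mul_hilbert_of_const hα hc hr]
  have hex := hk.hilbertExists g1 d1 hs
  refine ⟨hex, ?_⟩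
  have e : EqOn (invDensity a b α φ) (fun r => cos (π * c) * (((b - r) / (r - a)) ^ c * φ r))
      (Ioo a b) := fun r hr => by
    simp only [invDensity, exp_pi_mul_hilbert_of_const hα hc hr, hc r (Ioo_subset_Icc_self hr)]
    ring
  have h1 := sub_pos.2 hs.1
  have h2 := sub_pos.2 hs.2
  rw [opLInv, hilbert_congr e, hex.hilbert_const_mul, exp_neg,
    exp_pi_mul_hilbert_of_const hα hc hs, hc s (Ioo_subset_Icc_self hs),
    ← inv_rpow (div_pos h2 h1).le, inv_div]
  ring

end Inverse

end

/-! ### The main theorem -/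

theorem mainTheorem2 (k₁ k₂ : ℝ) (hk₁ : 0 ≤ k₁) (hk : k₁ < k₂) (α : ℝ → ℝ)
    (hα : IsHolderOn α (Icc (k₁ ^ 2) (k₂ ^ 2)))
    (hcos : ∀ s ∈ Icc (k₁ ^ 2) (k₂ ^ 2), cos (π * α s) ≠ 0)
    (hα₁ : |α (k₁ ^ 2)| < 1) (hα₂ : |α (k₂ ^ 2)| < 1) :
    -- the principal values in `L_α` and in the formula for its inverse exist
    (∀ s ∈ Ioo (k₁ ^ 2) (k₂ ^ 2), HilbertExists (k₁ ^ 2) (k₂ ^ 2) α s) ∧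
    (∀ ψ ∈ domL (k₁ ^ 2) (k₂ ^ 2) α, ∀ s ∈ Ioo (k₁ ^ 2) (k₂ ^ 2),
      HilbertExists (k₁ ^ 2) (k₂ ^ 2) ψ s ∧
      HilbertExists (k₁ ^ 2) (k₂ ^ 2) (invDensity (k₁ ^ 2) (k₂ ^ 2) α ψ) s) ∧
    -- both operators map the function space into itself
    (∀ ψ ∈ domL (k₁ ^ 2) (k₂ ^ 2) α,
      opL (k₁ ^ 2) (k₂ ^ 2) α ψ ∈ domL (k₁ ^ 2) (k₂ ^ 2) α ∧
      opLInv (k₁ ^ 2) (k₂ ^ 2) α ψ ∈ domL (k₁ ^ 2) (k₂ ^ 2) α) ∧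
    -- they are two-sided inverses of each other
    (∀ ψ ∈ domL (k₁ ^ 2) (k₂ ^ 2) α,
      EqOn (opLInv (k₁ ^ 2) (k₂ ^ 2) α (opL (k₁ ^ 2) (k₂ ^ 2) α ψ)) ψ
        (Ioo (k₁ ^ 2) (k₂ ^ 2)) ∧
      EqOn (opL (k₁ ^ 2) (k₂ ^ 2) α (opLInv (k₁ ^ 2) (k₂ ^ 2) α ψ)) ψ
        (Ioo (k₁ ^ 2) (k₂ ^ 2))) ∧
    -- `L_α ψ = φ` has the formula as its one and only solution
    (∀ φ ∈ domL (k₁ ^ 2) (k₂ ^ 2) α, ∀ ψ ∈ domL (k₁ ^ 2) (k₂ ^ 2) α,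
      EqOn (opL (k₁ ^ 2) (k₂ ^ 2) α ψ) φ (Ioo (k₁ ^ 2) (k₂ ^ 2)) ↔
        EqOn ψ (opLInv (k₁ ^ 2) (k₂ ^ 2) α φ) (Ioo (k₁ ^ 2) (k₂ ^ 2))) ∧
    -- the explicit form for constant `α`
    (∀ c : ℝ, (∀ s ∈ Icc (k₁ ^ 2) (k₂ ^ 2), α s = c) →
      ∀ φ ∈ domL (k₁ ^ 2) (k₂ ^ 2) α, ∀ s ∈ Ioo (k₁ ^ 2) (k₂ ^ 2),
        HilbertExists (k₁ ^ 2) (k₂ ^ 2)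
          (fun r => ((k₂ ^ 2 - r) / (r - k₁ ^ 2)) ^ c * φ r) s ∧
        opLInv (k₁ ^ 2) (k₂ ^ 2) α φ s =
          cos (π * c) ^ 2 * φ s -
            sin (π * c) * cos (π * c) * ((s - k₁ ^ 2) / (k₂ ^ 2 - s)) ^ c *
              hilbert (k₁ ^ 2) (k₂ ^ 2)
                (fun r => ((k₂ ^ 2 - r) / (r - k₁ ^ 2)) ^ c * φ r) s) := by
  have hab : k₁ ^ 2 < k₂ ^ 2 := pow_lt_pow_left₀ hk hk₁ two_ne_zero
  refine ⟨fun s hs => (weightedHolder_of_isHolderOn hα).hilbertExists one_pos one_pos hs,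
    fun ψ hψ s hs => hilbertExists_of_mem_domL hα hα₁ hα₂ hψ hs,
    fun ψ hψ => ⟨opL_mem_domL hab hα hcos hα₁ hα₂ hψ, opLInv_mem_domL hα hα₁ hα₂ hψ⟩,
    fun ψ hψ => ⟨opLInv_opL hα hcos hα₁ hα₂ hψ, opL_opLInv hα hcos hα₁ hα₂ hψ⟩,
    fun φ hφ ψ hψ => ⟨fun h => ?_, fun h => ?_⟩,
    fun c hc φ hφ s hs => opLInv_of_const hα hα₁ hα₂ hc hφ hs⟩
  -- The equation holds only on the open interval, so applying the inverse to both sides uses that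
  -- the formula depends only on values there.
  · exact (opLInv_opL hα hcos hα₁ hα₂ hψ).symm.trans (opLInv_congr h)
  · exact (opL_congr h).trans (opL_opLInv hα hcos hα₁ hα₂ hφ)
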